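/- **Lemma (Approximation).** We first fix the setting. *Walks and percolation.* Let $m\ge 2$. A *walk* is a sequence $z=(z(0),z(1),\dots)$ in $\{0,\dots,m-1\}$ with $z(n+1)\ne z(n)$. The random walk on the complete graph $K_m$ starts uniformly and moves each time to a uniformly chosen other vertex; $\Pr[\,\cdot\mid Z(a)=k]$ is its conditional law, where for $a=-1$ it means that $Z(0)$ is uniform on the vertices $\ne k$. Given walks $x,y$, the graph on $\mathbb Z_+^2$ has an edge from $p$ to its right or upper neighbor $p'=(i,j)$ iff $x(i)\neq y(j)$; $u\leadsto v$ means that there is a directed path from $u$ to $v$. For $u=(u_0,u_1)$, $v=(v_0,v_1)$ put $\mathrm{slope}(u,v)=\frac{v_1-u_1}{v_0-u_0}$, $\mathrm{minslope}=\min(\mathrm{slope},1/\mathrm{slope})$. A *rectangle* from $u$ to $v$ is *closed* $[u_0,v_0]\times[u_1,v_1]$, *left-open* $(u_0,v_0]\times[u_1,v_1]$ or *bottom-open* $[u_0,v_0]\times(u_1,v_1]$. *Data.* A structure $M$ assigns to walks: to $(x,y)$ a set of *traps* (closed rectangles $[a_0,b_0]\times[a_1,b_1]$, $a_0,a_1\in\mathbb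 Z_+$, $b_i$ real); to each axis and walk on it a set of *walls* and a set of *barriers*, each consisting of a body $(a,b]$ with integers $-1\le a<b$, and a real rank; for integer intervals on each axis, which of the two endpoints is *clean*, *strongly clean*; for rectangles with integer corners, whether the lower left (upper right) corner is *trap-clean*. Empty intervals, degenerate rectangles and the left endpoint $-1$ carry no cleanness requirement. A point $a$ is *right-clean* if it is clean in all intervals $(a,b]$, *left-clean* if clean in all $(b,a]$ with $b\ge-1$, *clean* if both; an interval is *inner clean* if both its ends are clean in it, and is a *hop* if moreover it contains no wall. It is *external* if it meets no wall. A corner of a rectangle is *clean* if it is trap-clean and its two coordinates are clean in the projections; *H-clean* if it is trap-clean and its $X$-coordinate is strongly clean in the projection. A rectangle is a *hop* if both its corners are clean in it (it is inner clean), it contains no trap and neither projection contains a wall. A lattice point is *upper right clean* if it is clean as lower left corner of all closed rectangles, *lower left clean* if it is clean as upper right corner of all rectangles of all three kinds. A nonempty sequence of walls, consecutive ones separated by (possibly empty) hops, *spans* the interval from the left end of the first to the right end of the last; a ray $(a,\infty)$ is spanned by an infinite such sequence starting at $a$, or by a finite one followed by a right-infinite hop (right-clean start, no wall contained). A *vertical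 hole* fitting a horizontal barrier with body $(u,v]$, $u\ge 0$, is an interval $(a,b]$ with $0\le a<b$, $b-a\le v-u$, such that $(b,v)$ is reachable from $(a,u)$ by a path all of whose points after the first lie in $(a,b]\times[u,v]$. It is *good* if $(a,u)$ is H-clean as upper right corner of all left-open rectangles and $(b,v)$ is H-clean as lower left corner of all left-open rectangles. *Mazeries.* Let $\Delta,R,w>0$, $\sigma$, $q$, $\chi$, $c_1,c_2,c_3$ be real, $p(r)=c_2r^{-c_1}2^{-r/2}$, $h(r)=c_32^{-\chi r/2}$. $M$ is a *mazery* with these parameters if for all walks $x,y$ the following holds, also with the axes exchanged. 1. Trap sides and wall lengths are $\le\Delta$; barriers have rank $\ge R$; walls are barriers; strongly clean implies clean. 2. Whether a rectangle $I\times J$ is a trap depends only on $x|_I,y|_J$; whether $(a,b]$ is the body of a barrier of a given rank, and strong cleanness in $(a,b]$, only on $x|_{(a,b]}$; trap-cleanness in a rectangle only on $x,y$ over its projections. Cleanness, strong cleanness and trap-cleanness of a point are preserved when the interval or rectangle, having that point as the given end or corner, shrinks. If they hold in an interval of length at least $\Delta$ (respectively, for trap-cleanness, in a square of side at least $\Delta$),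 then they hold in all intervals (respectively, rectangles of the same kind) that have that point as the same end or corner. 3. Every maximal external interval that has size $\ge\Delta$ or starts at $-1$ is inner clean; if a maximal external interval is infinite, then its left end is right-clean. If $(e,a]$ is such a finite interval and $(b,c]$ with $b>a$ is a maximal external interval with $c-b\ge\Delta$ or $c=\infty$, then $(a,b]$ is spanned by a sequence of neighbor walls; in any case $(a,\infty)$ is spanned. 4. If a right-closed interval $(s,t]$, $s\ge-1$, of size $\ge3\Delta$ contains no wall, its middle third contains a clean integer point. If $(s,t]\times(s',t']$ has both sides $\ge3\Delta$ and lower ends $\ge -1$, contains no trap, and $(s',t']$ contains no horizontal wall, then for each integer $a$ in the middle third of $(s,t]$ that is right-clean (left-clean; clean) the middle third of $(s',t']$ contains an integer $b$ with $(a,b)$ upper right clean (lower left clean; both). 5. Given $x$ and $a,b\ge 0$, $s$: $\Pr[\text{some trap starts at }(a,b)\mid Y(b-1)=s]\le w$. For $r\ge R$: $\sum_{l}\sup_{a\ge-1,k}\Pr[(a,a+l]\text{ is a barrier body of rank }r\mid X(a)=k]\le p(r)$. 6. $q<0.1$; for $0\le a<b$, given $X(a)=k$, each endpoint fails to be strongly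 clean in $(a,b]$ with probability $\le q/2$; for each fixed $y$, each corner of a left-open (closed) rectangle from $u$ to $v$ fails to be trap-clean with probability $\le q/2$ given $X(u_0)=k$ (given $X(u_0-1)=k$). 7. Let $B$ be a horizontal wall with body $(v,v']$ and rank $r$, $0\le u\le v\le u+12\Delta$, $a\ge0$, $b=a+\lceil (v-u)/2\rceil$, $c=a+(v-u)+1$. For each fixed $y$ and given $X(a)=k$, with probability $\ge(c-b)^{\chi}h(r)$ there is a $d\in[b,c-1]$ such that a vertical hole fitting $B$ starts at $d$, the left-open rectangle from $(a,u)$ to $(d,v)$ contains no trap and no vertical barrier, and both its corners are H-clean in it. 8. *Reachability condition with slope bound $\sigma$:* $0\le\sigma<\frac12$, and for all walks $x,y$, if a closed, left-open or bottom-open rectangle from $u\in\mathbb Z_+^2$ to $v$, with $u_0<v_0$, $u_1<v_1$ and $\mathrm{minslope}(u,v)\ge\sigma$, is a hop, then $u\leadsto v$. *Scaling up.* Given $M$ and numbers $\Delta,f,g,w,R^*,\hat R$, a structure $M^*$ is built as follows (always also with the axes exchanged). Distances in the plane are maximum distances; walls and barriers of rank $<R^*$ are *light*. (a) An end is clean in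 an interval for $M^*$ if it is so for $M$ and the interval contains no wall of $M$ whose corresponding end is closer than $f/3$; strong cleanness likewise with barriers. A corner of a rectangle is trap-clean for $M^*$ if it is so for $M$ and every trap of $M$ contained in the rectangle is at distance $\ge g$ from it. (b) Traps of $M^*$. *Uncorrelated:* the smallest rectangle containing two traps with disjoint projections on both axes whose starting points are at distance $\le f$. *Horizontal, of type $j\in\{1,2,3\}$:* put $\ell_1=7\Delta$, $\ell_2=2.2g$, $L_1=4\ell_1$, $L_2=4\ell_2$, $L_3=g$, $H_1=H_2=5\Delta$, $H_3=3\Delta$. For $I=[a,a+L_j]$ with $a\in\mathbb Z_+$, $b\in\mathbb Z_+$, the event $\mathcal L_j(x,y,I,b)$ for $j=1,2$ says that for each right-closed interval $\hat I\subseteq I$ of length $\ell_j$ the rectangle $\hat I\times[b,b+H_j]$ contains a trap. $\mathcal L_3(x,y,I,b)$ says that for some horizontal light potential wall $W$ starting at $b+\lceil\Delta\rceil$ no good hole $(a_1,a_2]$ fitting $W$ has $a\le a_1-\Delta$, $a_2+\Delta\le a+g$; here a *potential wall* is a barrier that is a wall for some walk agreeing with the given one on its body. $I\times[b,b+H_j]$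 is a trap of $M^*$ if $\mathcal L_j(x,y,I,b)$ holds and $\Pr[\mathcal L_j(x,Y,I,b)\mid Y(b-1)=s]\le w^2$ for all $s$. (c) Emerging walls. $(u,v]$, $u\ge-1$, is an *emerging barrier* of type $j$ if there is an integer $u'\in(u,u+2\Delta]$ with $v'=u'+L_j\in(v-2\Delta,v]$ and $\Pr[\mathcal L_j(x,Y,[u',v'],b)\mid Y(b-1)=s]>w^2$ for some $b\ge0$ and $s$; its rank is $\hat R$. A wall of $M$ is *dominant* if it is bordered on the right by an external interval of length $\ge\Delta$, and on the left by one that has length $\ge\Delta$ or starts at $-1$. An emerging barrier $(u,v]$ is a *pre-wall* if (i) either it is an external hop, or it properly contains a dominant light wall such that each of the two remaining parts is either empty or an external hop of length $\ge\Delta$; and (ii) on each side it is adjacent either to a wall of $M$ or to an external hop of length $\ge\Delta$. Processing first the pre-walls of type 1, then of type 3, then of type 2, each type in an arbitrary order, designate a pre-wall as an emerging *wall* if it is disjoint from all those designated before. (d) Compounds. Put $d_0=0$, $d_1=1$, $d_i=\lceil 2^{i/2}\rceil$ for $i\ge2$. Walls $(a,b]$, $(c,d]$ of ranks $r_1,r_2$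 with $b\le c\le b+f$ such that the interval from $b$ to $c$ is a hop of $M$ form the compound $(a,d]$ of rank $r_1+r_2-i$, where $d_i\le c-b<d_{i+1}$. Add to the walls of $M$ and the emerging walls first all compounds whose first member is light, then all compounds, of walls now present, whose second member is light. Do the same with barriers, without the hop requirement. (e) Remove all light walls and barriers; with each dominant light wall of $M$ remove also all other walls contained in it. The rest are the walls and barriers of $M^*$. *Exponents.* Let $\delta,\gamma,\varphi,\tau,\tau',\omega,\chi$ be real numbers with $1<\tau<2$, $\tau<\tau'<\tau^2$, $0<\delta<\gamma<\varphi<1$, $\tau=2-\varphi$, $\varphi<\tau\delta$, $\gamma\ge(\delta+\varphi)/2$, $4(\gamma+\delta)<\omega(4-\tau)$, $4\gamma+6\delta+\tau'<\omega$, $\tau(\delta+1)<\tau'$, $\chi>0$, $\tau\chi<\gamma-\delta$, $\frac{2\tau}{\tau-1}\chi<\min(1-\tau\delta,\ \omega-2\tau\delta)$ (for example $\delta=0.15$, $\gamma=0.2$, $\varphi=0.25$, $\tau=1.75$, $\tau'=2.5$, $\omega=4.5$, $\chi=0.015$). For $R_0>1$ and $k\ge1$ put $R_k=R_0\tau^k$,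 $T_k=2^{R_k/2}$, $\Delta_k=T_k^{\delta}$, $g_k=T_k^{\gamma}$, $f_k=T_k^{\varphi}$, $w_k=T_k^{-\omega}$, $\Lambda=500$, $\sigma_1=0$, $\sigma_{k+1}=\sigma_k+\Lambda g_k/f_k$. **Statement.** For all exponents as above and all real $c_1,c_2,c_3$ there is a number $R_1>1$ such that the following holds for all $R_0\ge R_1$, $k\ge1$, $m\ge2$ and real $q$. Let $M$ be any mazery with the parameters $\Delta_k,\sigma_k,R_k,w_k,q,\chi,c_1,c_2,c_3$, and let $M^*$ be obtained from it by scaling up with $\Delta_k,f_k,g_k,w_k$, $R^*=R_{k+1}$, $\hat R=\tau'R_k$ (with any order of processing the pre-walls). Then $M^*$ satisfies the reachability condition with slope bound $$\sigma^*=\sigma_k+\Lambda\, g_k/f_k .$$ That is, $0\le\sigma^*<\frac12$, and for all walks $x,y$, if $u\in\mathbb Z_+^2$, $u_0<v_0$, $u_1<v_1$, $\mathrm{minslope}(u,v)\ge\sigma^*$, and the closed, left-open or bottom-open rectangle from $u$ to $v$ is a hop of $M^*$ (it is inner clean and contains no traps or walls of $M^*$), then $v$ is reachable from $u$. -/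

import Mathlib

open MeasureTheory ProbabilityTheory

noncomputable section

namespace Clairvoyant

/-! ### Random walks on the complete graph with vertex set `Fin m` -/

/-- Sequences of vertices; `x i` is the colour of the `i`-th vertical (or horizontal) line. -/
abbrev Seq (m : ℕ) := ℕ → Fin m

/-- `z` is a possible trajectory of the walk on the complete graph. -/
def IsWalk {m : ℕ} (z : Seq m) : Prop := ∀ n, z (n + 1) ≠ z n

/-- The starting vertex is uniform, every later increment (modulo `m`) is uniform on the nonzero
residues: from each vertex the walk moves to one of the other `m - 1` vertices, all equally
likely. -/
def stepLaw (m : ℕ) [m.AtLeastTwo] (n : ℕ) : Measure (Fin m) :=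
  uniformOn (if n = 0 then Set.univ else {0}ᶜ)

instance (m : ℕ) [hm : m.AtLeastTwo] (n : ℕ) : IsProbabilityMeasure (stepLaw m n) := by
  unfold stepLaw
  refine isProbabilityMeasure_uniformOn (Set.toFinite _) ?_
  have h2 : 2 ≤ m := hm.prop
  split_ifs
  · exact Set.univ_nonempty
  · refine ⟨⟨1, by omega⟩, ?_⟩
    intro h
    have := congrArg Fin.val (Set.mem_singleton_iff.mp h)
    simp at this

/-- The law of the random walk on the complete graph on `m` vertices. -/
def walkLaw (m : ℕ) [m.AtLeastTwo] : Measure (Seq m) :=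
  (Measure.infinitePi (stepLaw m)).map (fun ξ n => ∑ i ∈ Finset.range (n + 1), ξ i)

/-- The conditional law of the walk `Z` given `Z a = k`, for `a ≥ -1`.  For `a = -1` the walk is
thought of as having been in state `k` one step before time `0`, so that `Z 0` is uniform on the
other vertices. -/
def lawGiven (m : ℕ) [m.AtLeastTwo] (a : ℤ) (k : Fin m) : Measure (Seq m) :=
  if 0 ≤ a then (walkLaw m)[|{z | z a.toNat = k}] else (walkLaw m)[|{z | z 0 ≠ k}]

/-! ### Reachability -/

/-- An edge of the percolation graph: from a lattice point to its right or upper neighbour, which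
has to be open. -/
def Step {m : ℕ} (x y : Seq m) (p q : ℤ × ℤ) : Prop :=
  0 ≤ p.1 ∧ 0 ≤ p.2 ∧ (q = (p.1 + 1, p.2) ∨ q = (p.1, p.2 + 1)) ∧ x q.1.toNat ≠ y q.2.toNat

/-- `v` is reachable from `u` (which itself may be closed). -/
def Reach {m : ℕ} (x y : Seq m) (u v : ℤ × ℤ) : Prop :=
  Relation.ReflTransGen (Step x y) u v

/-- `v` is reachable from `u` by a path whose points after `u` all lie in `S`. -/
def ReachIn {m : ℕ} (x y : Seq m) (S : Set (ℤ × ℤ)) (u v : ℤ × ℤ) : Prop :=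
  Relation.ReflTransGen (fun p q => Step x y p q ∧ q ∈ S) u v

/-! ### Rectangles, traps, walls -/

/-- The two coordinate axes: `X` (index `0`) and `Y` (index `1`). -/
inductive Axis
  | X
  | Y

def Axis.other : Axis → Axis
  | .X => .Y
  | .Y => .X

/-- Which corner or endpoint is meant: `lower` (left endpoint, lower left corner; the sign `1`) or
`upper` (right endpoint, upper right corner; the sign `-1`). -/
inductive End
  | lower
  | upper

/-- The three kinds of rectangles. -/
inductive Kind
  | closed
  | leftOpen
  | bottomOpen

def Kind.swap : Kind → Kind
  | .closed => .closed
  | .leftOpen => .bottomOpen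
  | .bottomOpen => .leftOpen

/-- The rectangle of the given kind with lower left corner `u` and upper right corner `v`. -/
def rectSet (k : Kind) (u v : ℤ × ℤ) : Set (ℝ × ℝ) :=
  match k with
  | .closed => Set.Icc (u.1 : ℝ) v.1 ×ˢ Set.Icc (u.2 : ℝ) v.2
  | .leftOpen => Set.Ioc (u.1 : ℝ) v.1 ×ˢ Set.Icc (u.2 : ℝ) v.2
  | .bottomOpen => Set.Icc (u.1 : ℝ) v.1 ×ˢ Set.Ioc (u.2 : ℝ) v.2

def slope (u v : ℤ × ℤ) : ℝ := ((v.2 : ℝ) - u.2) / ((v.1 : ℝ) - u.1)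

def minslope (u v : ℤ × ℤ) : ℝ := min (slope u v) (1 / slope u v)

/-- A closed rectangle `[a₀, b₀] × [a₁, b₁]` that starts at the lattice point `(a₀, a₁)`. -/
structure Trap where
  a₀ : ℤ
  a₁ : ℤ
  b₀ : ℝ
  b₁ : ℝ
  nonneg₀ : 0 ≤ a₀
  nonneg₁ : 0 ≤ a₁
  le₀ : (a₀ : ℝ) ≤ b₀
  le₁ : (a₁ : ℝ) ≤ b₁

namespace Trap

def toSet (t : Trap) : Set (ℝ × ℝ) := Set.Icc (t.a₀ : ℝ) t.b₀ ×ˢ Set.Icc (t.a₁ : ℝ) t.b₁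

def swap (t : Trap) : Trap := ⟨t.a₁, t.a₀, t.b₁, t.b₀, t.nonneg₁, t.nonneg₀, t.le₁, t.le₀⟩

/-- Both projections of the two rectangles are disjoint. -/
def DisjointProj (t t' : Trap) : Prop :=
  Disjoint (Set.Icc (t.a₀ : ℝ) t.b₀) (Set.Icc (t'.a₀ : ℝ) t'.b₀) ∧
  Disjoint (Set.Icc (t.a₁ : ℝ) t.b₁) (Set.Icc (t'.a₁ : ℝ) t'.b₁)

end Trap

/-- A wall value: the body is the right-closed interval `(left, right]`. -/
structure WallValue where
  left : ℤ
  right : ℤ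
  rank : ℝ
  neg_one_le : -1 ≤ left
  lt : left < right

/-- The (closed or right-closed) interval from `a` to `b` contains the body of the wall. -/
def WallValue.ContainedIn (E : WallValue) (a b : ℤ) : Prop := a ≤ E.left ∧ E.right ≤ b

/-! ### The data of a mazery -/

/-- The random objects of a mazery, as functions of the two walks.  Walls, barriers and
one-dimensional cleanness of an axis are functions of the sequence of that axis only.
`clean δ z a b e` says that `(a, b, e)` belongs to the cleanness process of axis `δ`, `strong` is the
same for strong cleanness, `trapClean x y u v e k` is trap-cleanness of the lower left
(`e = lower`) or upper right (`e = upper`) corner in the rectangle of kind `k` from `u` to `v`.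
They are only consulted for `a < b`, resp. `u₀ < v₀`, `u₁ < v₁`. -/
structure MazeData (m : ℕ) where
  trap : Seq m → Seq m → Set Trap
  wall : Axis → Seq m → Set WallValue
  barrier : Axis → Seq m → Set WallValue
  clean : Axis → Seq m → ℤ → ℤ → End → Prop
  strong : Axis → Seq m → ℤ → ℤ → End → Prop
  trapClean : Seq m → Seq m → ℤ × ℤ → ℤ × ℤ → End → Kind → Prop

namespace MazeData

variable {m : ℕ}

/-- The same structure with the roles of the two axes exchanged. -/
def swap (M : MazeData m) : MazeData m where
  trap x y := {t | t.swap ∈ M.trap y x}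
  wall δ := M.wall δ.other
  barrier δ := M.barrier δ.other
  clean δ := M.clean δ.other
  strong δ := M.strong δ.other
  trapClean x y u v e k := M.trapClean y x u.swap v.swap e k.swap

/-- The structure seen with axis `δ` as its `X`-axis. -/
def orient (M : MazeData m) (δ : Axis) : MazeData m :=
  match δ with
  | .X => M
  | .Y => M.swap

/-! #### Cleanness -/

/-- The left (`e = lower`) or right (`e = upper`) endpoint is clean in the interval from `a` to `b`.
There is no requirement for empty intervals nor for the left endpoint `-1`, which is not a
lattice point. -/
def CleanIn (M : MazeData m) (δ : Axis) (z : Seq m) (a b : ℤ) (e : End) : Prop :=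
  a < b → (e = .lower → 0 ≤ a) → M.clean δ z a b e

def StrongIn (M : MazeData m) (δ : Axis) (z : Seq m) (a b : ℤ) (e : End) : Prop :=
  a < b → (e = .lower → 0 ≤ a) → M.strong δ z a b e

def RightClean (M : MazeData m) (δ : Axis) (z : Seq m) (a : ℤ) : Prop :=
  ∀ b, a ≤ b → M.CleanIn δ z a b .lower

def LeftClean (M : MazeData m) (δ : Axis) (z : Seq m) (b : ℤ) : Prop :=
  ∀ a, -1 ≤ a → a ≤ b → M.CleanIn δ z a b .upper

def PointClean (M : MazeData m) (δ : Axis) (z : Seq m) (a : ℤ) : Prop :=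
  M.LeftClean δ z a ∧ M.RightClean δ z a

def InnerClean (M : MazeData m) (δ : Axis) (z : Seq m) (a b : ℤ) : Prop :=
  M.CleanIn δ z a b .lower ∧ M.CleanIn δ z a b .upper

def TrapCleanIn (M : MazeData m) (x y : Seq m) (u v : ℤ × ℤ) (e : End) (k : Kind) : Prop :=
  u.1 < v.1 → u.2 < v.2 → M.trapClean x y u v e k

/-- A corner is clean in the rectangle: trap-clean, with clean projections. -/
def CornerClean (M : MazeData m) (x y : Seq m) (u v : ℤ × ℤ) (e : End) (k : Kind) : Prop :=
  M.TrapCleanIn x y u v e k ∧ M.CleanIn .X x u.1 v.1 e ∧ M.CleanIn .Y y u.2 v.2 e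

/-- A corner is H-clean in the rectangle: trap-clean, with strongly clean `X`-projection. -/
def HClean (M : MazeData m) (x y : Seq m) (u v : ℤ × ℤ) (e : End) (k : Kind) : Prop :=
  M.TrapCleanIn x y u v e k ∧ M.StrongIn .X x u.1 v.1 e

/-- Upper right clean points (defined through closed rectangles). -/
def UpperRightClean (M : MazeData m) (x y : Seq m) (p : ℤ × ℤ) : Prop :=
  ∀ v : ℤ × ℤ, p.1 ≤ v.1 → p.2 ≤ v.2 → M.CornerClean x y p v .lower .closed

/-- Lower left clean points (all kinds of rectangles are closed at the upper right). -/
def LowerLeftClean (M : MazeData m) (x y : Seq m) (p : ℤ × ℤ) : Prop :=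
  ∀ u : ℤ × ℤ, 0 ≤ u.1 → 0 ≤ u.2 → u.1 ≤ p.1 → u.2 ≤ p.2 →
    ∀ k, M.CornerClean x y u p .upper k

/-! #### Hops, external intervals, sequences of neighbor walls -/

def NoWallIn (M : MazeData m) (δ : Axis) (z : Seq m) (a b : ℤ) : Prop :=
  ∀ E ∈ M.wall δ z, ¬ E.ContainedIn a b

def NoBarrierIn (M : MazeData m) (δ : Axis) (z : Seq m) (a b : ℤ) : Prop :=
  ∀ E ∈ M.barrier δ z, ¬ E.ContainedIn a b

def NoTrapIn (M : MazeData m) (x y : Seq m) (S : Set (ℝ × ℝ)) : Prop :=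
  ∀ t ∈ M.trap x y, ¬ t.toSet ⊆ S

/-- The interval `(a, b]` (or `[a, b]`) is a hop. -/
def Hop (M : MazeData m) (δ : Axis) (z : Seq m) (a b : ℤ) : Prop :=
  M.InnerClean δ z a b ∧ M.NoWallIn δ z a b

/-- The rectangle of kind `k` from `u` to `v` is a hop. -/
def HopRect (M : MazeData m) (x y : Seq m) (u v : ℤ × ℤ) (k : Kind) : Prop :=
  M.CornerClean x y u v .lower k ∧ M.CornerClean x y u v .upper k ∧
  M.NoTrapIn x y (rectSet k u v) ∧
  M.NoWallIn .X x u.1 v.1 ∧ M.NoWallIn .Y y u.2 v.2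

/-- `(a, b]` intersects no wall. -/
def External (M : MazeData m) (δ : Axis) (z : Seq m) (a b : ℤ) : Prop :=
  ∀ E ∈ M.wall δ z, Disjoint (Set.Ioc a b) (Set.Ioc E.left E.right)

def ExternalHop (M : MazeData m) (δ : Axis) (z : Seq m) (a b : ℤ) : Prop :=
  M.External δ z a b ∧ M.Hop δ z a b

/-- `(a, b]` is a maximal external interval. -/
def MaxExternal (M : MazeData m) (δ : Axis) (z : Seq m) (a b : ℤ) : Prop :=
  -1 ≤ a ∧ a ≤ b ∧ M.External δ z a b ∧
  (a = -1 ∨ ¬ M.External δ z (a - 1) b) ∧ ¬ M.External δ z a (b + 1)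

/-- `(a, ∞)` is a maximal external interval. -/
def MaxExternalInf (M : MazeData m) (δ : Axis) (z : Seq m) (a : ℤ) : Prop :=
  -1 ≤ a ∧ (∀ b, a ≤ b → M.External δ z a b) ∧ (a = -1 ∨ ¬ M.External δ z (a - 1) a)

/-- A dominant wall: it is surrounded by external intervals of size at least `Δ`, or, on its left,
by one at the beginning of the half-line. -/
def Dominant (M : MazeData m) (Δ : ℝ) (δ : Axis) (z : Seq m) (E : WallValue) : Prop :=
  E ∈ M.wall δ z ∧
  (∃ a, -1 ≤ a ∧ a ≤ E.left ∧ M.External δ z a E.left ∧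
    (Δ ≤ (E.left : ℝ) - a ∨ a = -1)) ∧
  (∃ b, E.right ≤ b ∧ M.External δ z E.right b ∧ Δ ≤ (b : ℝ) - E.right)

/-- `(a, b]` is spanned by a finite nonempty sequence of neighbor walls. -/
inductive Spans (M : MazeData m) (δ : Axis) (z : Seq m) : ℤ → ℤ → Prop
  | single (E : WallValue) (hE : E ∈ M.wall δ z) : Spans M δ z E.left E.right
  | cons (E : WallValue) (hE : E ∈ M.wall δ z) (c b : ℤ) (hc : E.right ≤ c)
      (hop : M.Hop δ z E.right c) (rest : Spans M δ z c b) : Spans M δ z E.left b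

/-- `(a, ∞)` is spanned by an infinite sequence of neighbor walls, or by a finite one followed by
a right-infinite hop. -/
def SpansInf (M : MazeData m) (δ : Axis) (z : Seq m) (a : ℤ) : Prop :=
  (∃ W : ℕ → WallValue, (∀ n, W n ∈ M.wall δ z) ∧ (W 0).left = a ∧
    ∀ n, (W n).right ≤ (W (n + 1)).left ∧ M.Hop δ z (W n).right (W (n + 1)).left) ∨
  (∃ b, M.Spans δ z a b ∧ M.RightClean δ z b ∧ ∀ c, M.NoWallIn δ z b c)

/-! #### Holes (vertical ones; horizontal ones are those of `M.swap`) -/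

/-- `(a₀, b₀]` is a vertical hole passing through the horizontal barrier value `B`. -/
def IsHole (x y : Seq m) (B : WallValue) (a₀ b₀ : ℤ) : Prop :=
  0 ≤ a₀ ∧ 0 ≤ B.left ∧ a₀ < b₀ ∧ b₀ - a₀ ≤ B.right - B.left ∧
  ReachIn x y (Set.Ioc a₀ b₀ ×ˢ Set.Icc B.left B.right) (a₀, B.left) (b₀, B.right)

/-- A good hole: it is good as seen from every point to its lower left. -/
def GoodHole (M : MazeData m) (x y : Seq m) (B : WallValue) (a₀ b₀ : ℤ) : Prop :=
  IsHole x y B a₀ b₀ ∧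
  (∀ u : ℤ × ℤ, 0 ≤ u.1 → 0 ≤ u.2 → u.1 ≤ a₀ → u.2 ≤ B.left →
    M.HClean x y u (a₀, B.left) .upper .leftOpen) ∧
  (∀ v : ℤ × ℤ, b₀ ≤ v.1 → B.right ≤ v.2 →
    M.HClean x y (b₀, B.right) v .lower .leftOpen)

/-- The two sequences agree on the body of the wall value. -/
def AgreeOn (z z' : Seq m) (S : Set ℝ) : Prop := ∀ n : ℕ, (n : ℝ) ∈ S → z n = z' n

/-- A potential wall: a barrier such that some walk which agrees with `z` on its body makes it a
wall. -/
def PotentialWall (M : MazeData m) (δ : Axis) (z : Seq m) (E : WallValue) : Prop :=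
  E ∈ M.barrier δ z ∧
  ∃ z', IsWalk z' ∧ AgreeOn z z' (Set.Ioc (E.left : ℝ) E.right) ∧ E ∈ M.wall δ z'

end MazeData

/-! ### Mazeries -/

/-- The constant `√2`. -/
def lam : ℝ := Real.sqrt 2

/-- The parameters of a mazery, together with the constants in its probability bounds. -/
structure Params where
  Δ : ℝ
  σ : ℝ
  R : ℝ
  w : ℝ
  q : ℝ
  c₁ : ℝ
  c₂ : ℝ
  c₃ : ℝ
  χ : ℝ

/-- The upper bound for the probability of walls of rank `r`. -/
def Params.wallBound (P : Params) (r : ℝ) : ℝ := P.c₂ * r ^ (-P.c₁) * lam ^ (-r)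

/-- The lower bound for the probability of holes through walls of rank `r`. -/
def Params.holeBound (P : Params) (r : ℝ) : ℝ := P.c₃ * lam ^ (-(P.χ * r))

namespace MazeData

variable {m : ℕ}

/-- The reachability condition with slope bound `σ`. -/
def Reachability (M : MazeData m) (σ : ℝ) : Prop :=
  0 ≤ σ ∧ σ < 1 / 2 ∧
  ∀ x y : Seq m, IsWalk x → IsWalk y →
  ∀ u v : ℤ × ℤ, 0 ≤ u.1 → 0 ≤ u.2 → u.1 < v.1 → u.2 < v.2 →
  ∀ k : Kind, σ ≤ minslope u v → M.HopRect x y u v k → Reach x y u v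

/-- `a` is in the middle third of the right-closed real interval `(s, t]`. -/
def MiddleThird (s t : ℝ) (a : ℤ) : Prop :=
  s + (t - s) / 3 < a ∧ (a : ℝ) ≤ s + 2 * (t - s) / 3

/-- The event in the hole lower bound: with `b = a + ⌈(v - u) / 2⌉`, `c = a + (v - u) + 1`, for some
`d ∈ [b, c - 1]` a vertical hole fitting `B` starts at `d`, and the left-open rectangle from
`(a, u)` to `(d, v)` contains no traps or vertical barriers and is inner H-clean
(`v` is the left end of the body of `B`). -/
def HoleEvent (M : MazeData m) (x y : Seq m) (B : WallValue) (u a : ℤ) : Prop :=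
  ∃ d : ℤ, a + ⌈((B.left : ℝ) - u) / 2⌉ ≤ d ∧ d ≤ a + (B.left - u) ∧
    (∃ d', IsHole x y B d d') ∧
    M.NoTrapIn x y (rectSet .leftOpen (a, u) (d, B.left)) ∧
    M.NoBarrierIn .X x a d ∧
    M.HClean x y (a, u) (d, B.left) .lower .leftOpen ∧
    M.HClean x y (a, u) (d, B.left) .upper .leftOpen

/-- The defining conditions of a mazery other than reachability.  One-dimensional conditions are
stated for the `X`-axis, two-dimensional ones in one of their two symmetric forms; the other forms
are obtained by requiring the conditions for `M.swap` too. -/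
structure Conditions [m.AtLeastTwo] (M : MazeData m) (P : Params) : Prop where
  /- sizes, ranks, inclusions -/
  trap_size : ∀ x y, IsWalk x → IsWalk y → ∀ t ∈ M.trap x y,
    t.b₀ - t.a₀ ≤ P.Δ ∧ t.b₁ - t.a₁ ≤ P.Δ
  wall_size : ∀ x, IsWalk x → ∀ E ∈ M.wall .X x, (E.right : ℝ) - E.left ≤ P.Δ
  rank_ge : ∀ x, IsWalk x → ∀ E ∈ M.barrier .X x, P.R ≤ E.rank
  wall_barrier : ∀ x, IsWalk x → M.wall .X x ⊆ M.barrier .X x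
  strong_clean : ∀ x, IsWalk x → ∀ a b e, M.strong .X x a b e → M.clean .X x a b e
  /- dependencies -/
  dep_trap : ∀ x x' y y', IsWalk x → IsWalk x' → IsWalk y → IsWalk y' → ∀ t : Trap,
    AgreeOn x x' (Set.Icc (t.a₀ : ℝ) t.b₀) → AgreeOn y y' (Set.Icc (t.a₁ : ℝ) t.b₁) →
    (t ∈ M.trap x y ↔ t ∈ M.trap x' y')
  dep_barrier : ∀ x x', IsWalk x → IsWalk x' → ∀ E : WallValue,
    AgreeOn x x' (Set.Ioc (E.left : ℝ) E.right) →
    (E ∈ M.barrier .X x ↔ E ∈ M.barrier .X x')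
  dep_strong : ∀ x x', IsWalk x → IsWalk x' → ∀ a b : ℤ, -1 ≤ a → a < b →
    AgreeOn x x' (Set.Ioc (a : ℝ) b) → ∀ e, (M.strong .X x a b e ↔ M.strong .X x' a b e)
  mono_lower : ∀ x, IsWalk x → ∀ a b b' : ℤ, 0 ≤ a → a < b' → b' ≤ b →
    (M.clean .X x a b .lower → M.clean .X x a b' .lower) ∧
    (M.strong .X x a b .lower → M.strong .X x a b' .lower)
  mono_upper : ∀ x, IsWalk x → ∀ a a' b : ℤ, -1 ≤ a → a ≤ a' → a' < b →
    (M.clean .X x a b .upper → M.clean .X x a' b .upper) ∧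
    (M.strong .X x a b .upper → M.strong .X x a' b .upper)
  min_lower : ∀ x, IsWalk x → ∀ a b b' : ℤ, 0 ≤ a → a < b → P.Δ ≤ (b : ℝ) - a → a < b' →
    (M.clean .X x a b .lower → M.clean .X x a b' .lower) ∧
    (M.strong .X x a b .lower → M.strong .X x a b' .lower)
  min_upper : ∀ x, IsWalk x → ∀ a a' b : ℤ, -1 ≤ a → a < b → P.Δ ≤ (b : ℝ) - a →
    -1 ≤ a' → a' < b →
    (M.clean .X x a b .upper → M.clean .X x a' b .upper) ∧
    (M.strong .X x a b .upper → M.strong .X x a' b .upper)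
  dep_trapClean : ∀ x x' y y', IsWalk x → IsWalk x' → IsWalk y → IsWalk y' →
    ∀ u v : ℤ × ℤ, 0 ≤ u.1 → 0 ≤ u.2 → u.1 < v.1 → u.2 < v.2 → ∀ k,
    AgreeOn x x' (Prod.fst '' rectSet k u v) → AgreeOn y y' (Prod.snd '' rectSet k u v) →
    ∀ e, (M.trapClean x y u v e k ↔ M.trapClean x' y' u v e k)
  mono_trapClean_lower : ∀ x y, IsWalk x → IsWalk y →
    ∀ u v v' : ℤ × ℤ, 0 ≤ u.1 → 0 ≤ u.2 → u.1 < v.1 → u.2 < v.2 → u.1 < v'.1 → u.2 < v'.2 →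
    ∀ k k', rectSet k' u v' ⊆ rectSet k u v →
    M.trapClean x y u v .lower k → M.trapClean x y u v' .lower k'
  mono_trapClean_upper : ∀ x y, IsWalk x → IsWalk y →
    ∀ u u' v : ℤ × ℤ, 0 ≤ u.1 → 0 ≤ u.2 → u.1 < v.1 → u.2 < v.2 →
    0 ≤ u'.1 → 0 ≤ u'.2 → u'.1 < v.1 → u'.2 < v.2 →
    ∀ k k', rectSet k' u' v ⊆ rectSet k u v →
    M.trapClean x y u v .upper k → M.trapClean x y u' v .upper k'
  min_trapClean_lower : ∀ x y, IsWalk x → IsWalk y →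
    ∀ u v : ℤ × ℤ, 0 ≤ u.1 → 0 ≤ u.2 → u.1 < v.1 → u.2 < v.2 →
    ∀ (n : ℤ) (k : Kind), 0 < n → P.Δ ≤ (n : ℝ) →
    M.trapClean x y u (u.1 + n, u.2 + n) .lower k → M.trapClean x y u v .lower k
  min_trapClean_upper : ∀ x y, IsWalk x → IsWalk y →
    ∀ u v : ℤ × ℤ, 0 ≤ u.1 → 0 ≤ u.2 → u.1 < v.1 → u.2 < v.2 →
    ∀ (n : ℤ) (k : Kind), 0 < n → P.Δ ≤ (n : ℝ) → n ≤ v.1 → n ≤ v.2 →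
    M.trapClean x y (v.1 - n, v.2 - n) v .upper k → M.trapClean x y u v .upper k
  /- combinatorial requirements -/
  inner_clean : ∀ x, IsWalk x → ∀ a b : ℤ, M.MaxExternal .X x a b →
    (P.Δ ≤ (b : ℝ) - a ∨ a = -1) → M.InnerClean .X x a b
  inner_clean_inf : ∀ x, IsWalk x → ∀ a : ℤ, M.MaxExternalInf .X x a → M.RightClean .X x a
  cover : ∀ x, IsWalk x → ∀ e a b : ℤ, M.MaxExternal .X x e a →
    (P.Δ ≤ (a : ℝ) - e ∨ e = -1) → a < b →
    ((∃ c, M.MaxExternal .X x b c ∧ P.Δ ≤ (c : ℝ) - b) ∨ M.MaxExternalInf .X x b) →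
    M.Spans .X x a b
  cover_inf : ∀ x, IsWalk x → ∀ e a : ℤ, M.MaxExternal .X x e a →
    (P.Δ ≤ (a : ℝ) - e ∨ e = -1) → M.SpansInf .X x a
  clean_dense : ∀ x, IsWalk x → ∀ s t : ℝ, -1 ≤ s → 3 * P.Δ ≤ t - s →
    (∀ E ∈ M.wall .X x, ¬ (s ≤ E.left ∧ (E.right : ℝ) ≤ t)) →
    ∃ a : ℤ, MiddleThird s t a ∧ M.PointClean .X x a
  clean_dense_plane : ∀ x y, IsWalk x → IsWalk y → ∀ s t s' t' : ℝ,
    -1 ≤ s → -1 ≤ s' → 3 * P.Δ ≤ t - s → 3 * P.Δ ≤ t' - s' →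
    (∀ E ∈ M.wall .Y y, ¬ (s' ≤ E.left ∧ (E.right : ℝ) ≤ t')) →
    M.NoTrapIn x y (Set.Ioc s t ×ˢ Set.Ioc s' t') →
    ∀ a : ℤ, MiddleThird s t a →
    (M.RightClean .X x a → ∃ b : ℤ, MiddleThird s' t' b ∧ M.UpperRightClean x y (a, b)) ∧
    (M.LeftClean .X x a → ∃ b : ℤ, MiddleThird s' t' b ∧ M.LowerLeftClean x y (a, b)) ∧
    (M.PointClean .X x a → ∃ b : ℤ, MiddleThird s' t' b ∧
      M.UpperRightClean x y (a, b) ∧ M.LowerLeftClean x y (a, b))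
  /- probability bounds -/
  trap_bound : ∀ x, IsWalk x → ∀ a b : ℤ, 0 ≤ a → 0 ≤ b → ∀ s : Fin m,
    lawGiven m (b - 1) s {y | ∃ t ∈ M.trap x y, t.a₀ = a ∧ t.a₁ = b} ≤ ENNReal.ofReal P.w
  wall_bound : ∀ r : ℝ, P.R ≤ r →
    ∑' l : ℕ, ⨆ (a : ℤ) (_ : -1 ≤ a) (k : Fin m),
      lawGiven m a k {x | ∃ E ∈ M.barrier .X x, E.rank = r ∧ E.left = a ∧ E.right = a + l}
    ≤ ENNReal.ofReal (P.wallBound r)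
  q_lt : P.q < 0.1
  clean_bound : ∀ (k : Fin m) (a b : ℤ), 0 ≤ a → a < b → ∀ e,
    lawGiven m a k {x | ¬ M.strong .X x a b e} ≤ ENNReal.ofReal (P.q / 2)
  trapClean_bound_open : ∀ y, IsWalk y → ∀ (k : Fin m) (u v : ℤ × ℤ),
    0 ≤ u.1 → 0 ≤ u.2 → u.1 < v.1 → u.2 < v.2 → ∀ e,
    lawGiven m u.1 k {x | ¬ M.trapClean x y u v e .leftOpen} ≤ ENNReal.ofReal (P.q / 2)
  trapClean_bound_closed : ∀ y, IsWalk y → ∀ (k : Fin m) (u v : ℤ × ℤ),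
    0 ≤ u.1 → 0 ≤ u.2 → u.1 < v.1 → u.2 < v.2 → ∀ e,
    lawGiven m (u.1 - 1) k {x | ¬ M.trapClean x y u v e .closed} ≤ ENNReal.ofReal (P.q / 2)
  hole_bound : ∀ y, IsWalk y → ∀ B ∈ M.wall .Y y, ∀ u a : ℤ, 0 ≤ u → 0 ≤ a →
    u ≤ B.left → (B.left : ℝ) - u ≤ 12 * P.Δ → ∀ k : Fin m,
    ENNReal.ofReal
      (((B.left : ℝ) - u + 1 - ⌈((B.left : ℝ) - u) / 2⌉) ^ P.χ * P.holeBound B.rank)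
    ≤ lawGiven m a k {x | M.HoleEvent x y B u a}

/-- The structure `M` with parameters `P` is a mazery. -/
structure IsMazery [m.AtLeastTwo] (M : MazeData m) (P : Params) : Prop where
  delta_pos : 0 < P.Δ
  rank_pos : 0 < P.R
  w_pos : 0 < P.w
  conditions : M.Conditions P
  conditions_swap : M.swap.Conditions P
  reachability : M.Reachability P.σ

end MazeData

/-! ### The scaled-up structure -/

/-- The parameters of the scale-up: `Rstar` separates light from heavy walls, `Rhat` is the rank of
emerging walls. -/
structure ScaleParams where
  Δ : ℝ
  f : ℝ
  g : ℝ
  w : ℝ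
  Rstar : ℝ
  Rhat : ℝ

/-- The types of correlated (`one`, `two`) and missing-hole (`three`) traps, and of emerging
walls. -/
inductive EType
  | one
  | two
  | three

namespace ScaleParams

/-- The lengths `ℓ₁ = 7Δ`, `ℓ₂ = g' = 2.2 g` for correlated traps. -/
def len (P : ScaleParams) : EType → ℝ
  | .one => 7 * P.Δ
  | .two => 2.2 * P.g
  | .three => P.g

/-- The lengths `L₁ = 4 ℓ₁`, `L₂ = 4 ℓ₂`, `L₃ = g`. -/
def bigLen (P : ScaleParams) : EType → ℝ
  | .one => 4 * P.len .one
  | .two => 4 * P.len .two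
  | .three => P.g

/-- The heights of the new traps. -/
def height (P : ScaleParams) : EType → ℝ
  | .one => 5 * P.Δ
  | .two => 5 * P.Δ
  | .three => 3 * P.Δ

end ScaleParams

/-- The jump types `d_i`. -/
def jump (i : ℕ) : ℤ := if i ≤ 1 then i else ⌈lam ^ i⌉

/-- `E` is the compound `E₁ + E₂`. -/
def IsCompound (f : ℝ) (E₁ E₂ E : WallValue) : Prop :=
  E₁.right ≤ E₂.left ∧ ((E₂.left - E₁.right : ℤ) : ℝ) ≤ f ∧
  E.left = E₁.left ∧ E.right = E₂.right ∧
  ∃ i : ℕ, jump i ≤ E₂.left - E₁.right ∧ E₂.left - E₁.right < jump (i + 1) ∧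
    E.rank = E₁.rank + E₂.rank - i

/-- A way of listing all intervals `(u, v]`, for each type: it determines the order in which the
emerging pre-walls of that type are processed. -/
abbrev Listing := EType → (ℤ × ℤ) ↪ ℕ

/-- Going through the intervals in the order of the list `ord`, add to `D` each member of `C` that is
disjoint from all members added earlier (and from those of `D`). -/
def greedyUpTo (C : Set (ℤ × ℤ)) (ord : (ℤ × ℤ) ↪ ℕ) (D : Set (ℤ × ℤ)) : ℕ → Set (ℤ × ℤ)
  | 0 => D
  | n + 1 => greedyUpTo C ord D n ∪
      {I | I ∈ C ∧ ord I = n ∧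
        ∀ J ∈ greedyUpTo C ord D n, Disjoint (Set.Ioc I.1 I.2) (Set.Ioc J.1 J.2)}

def greedy (C : Set (ℤ × ℤ)) (ord : (ℤ × ℤ) ↪ ℕ) (D : Set (ℤ × ℤ)) : Set (ℤ × ℤ) :=
  ⋃ n, greedyUpTo C ord D n

namespace MazeData

variable {m : ℕ}

/-! #### New traps -/

/-- The (horizontal) bad events over the interval `[a, a + L]` at height `b`. -/
def BadEvent (M : MazeData m) (P : ScaleParams) (j : EType) (x y : Seq m) (a b : ℤ) : Prop :=
  match j with
  | .three => ∃ W : WallValue, W.left = b + ⌈P.Δ⌉ ∧ W.rank < P.Rstar ∧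
      M.PotentialWall .Y y W ∧
      ¬ ∃ a₁ a₂ : ℤ, (a : ℝ) ≤ a₁ - P.Δ ∧ a₂ + P.Δ ≤ a + P.g ∧ M.GoodHole x y W a₁ a₂
  | j => ∀ s : ℝ, (a : ℝ) ≤ s → s + P.len j ≤ a + P.bigLen j →
      ∃ t ∈ M.trap x y,
        t.toSet ⊆ Set.Ioc s (s + P.len j) ×ˢ Set.Icc (b : ℝ) (b + P.height j)

/-- Horizontal correlated traps (types one, two), and those of the missing-hole kind (type three). -/
def HorizontalTrap [m.AtLeastTwo] (M : MazeData m) (P : ScaleParams) (x y : Seq m)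
    (t : Trap) : Prop :=
  ∃ j : EType, t.b₀ = t.a₀ + P.bigLen j ∧ t.b₁ = t.a₁ + P.height j ∧
    M.BadEvent P j x y t.a₀ t.a₁ ∧
    ∀ s : Fin m, lawGiven m (t.a₁ - 1) s {y' | M.BadEvent P j x y' t.a₀ t.a₁}
      ≤ ENNReal.ofReal (P.w ^ 2)

/-- Uncorrelated compound traps. -/
def UncorrelatedTrap (M : MazeData m) (P : ScaleParams) (x y : Seq m) (t : Trap) : Prop :=
  ∃ t₁ ∈ M.trap x y, ∃ t₂ ∈ M.trap x y, t₁.DisjointProj t₂ ∧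
    |(t₁.a₀ : ℝ) - t₂.a₀| ≤ P.f ∧ |(t₁.a₁ : ℝ) - t₂.a₁| ≤ P.f ∧
    t.a₀ = min t₁.a₀ t₂.a₀ ∧ t.a₁ = min t₁.a₁ t₂.a₁ ∧
    t.b₀ = max t₁.b₀ t₂.b₀ ∧ t.b₁ = max t₁.b₁ t₂.b₁

/-! #### Emerging walls (of the `X`-axis) -/

/-- `(u, v]` is the body of an emerging barrier of type `j`: for some closed interval `[u', v']` of
length `L_j` with `u' ∈ (u, u + 2Δ]`, `v' ∈ (v - 2Δ, v]` the conditional probability of the bad event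
exceeds `w²`.  (The height `b` at which the event is looked at is immaterial when the structure is
homogeneous; no height is singled out.) -/
def EmergingBarrier [m.AtLeastTwo] (M : MazeData m) (P : ScaleParams) (j : EType) (x : Seq m)
    (u v : ℤ) : Prop :=
  -1 ≤ u ∧ u < v ∧ ∃ u' : ℤ, u < u' ∧ (u' : ℝ) ≤ u + 2 * P.Δ ∧
    (v : ℝ) - 2 * P.Δ < u' + P.bigLen j ∧ u' + P.bigLen j ≤ v ∧
    ∃ b : ℤ, 0 ≤ b ∧ ∃ k : Fin m,
      ENNReal.ofReal (P.w ^ 2) < lawGiven m (b - 1) k {y | M.BadEvent P j x y u' b}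

/-- A dominant light wall of the `X`-axis. -/
def DominantLight (M : MazeData m) (P : ScaleParams) (x : Seq m) (E : WallValue) : Prop :=
  M.Dominant P.Δ .X x E ∧ E.rank < P.Rstar

/-- Emerging pre-walls. -/
def PreWall [m.AtLeastTwo] (M : MazeData m) (P : ScaleParams) (j : EType) (x : Seq m)
    (u v : ℤ) : Prop :=
  M.EmergingBarrier P j x u v ∧
  (M.ExternalHop .X x u v ∨
    ∃ E, M.DominantLight P x E ∧ E.ContainedIn u v ∧ ¬ (u = E.left ∧ E.right = v) ∧
      (u = E.left ∨ (P.Δ ≤ (E.left : ℝ) - u ∧ M.ExternalHop .X x u E.left)) ∧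
      (E.right = v ∨ (P.Δ ≤ (v : ℝ) - E.right ∧ M.ExternalHop .X x E.right v))) ∧
  ((∃ a, -1 ≤ a ∧ a ≤ u ∧ P.Δ ≤ (u : ℝ) - a ∧ M.ExternalHop .X x a u) ∨
    ∃ E ∈ M.wall .X x, E.right = u) ∧
  ((∃ b, v ≤ b ∧ P.Δ ≤ (b : ℝ) - v ∧ M.ExternalHop .X x v b) ∨
    ∃ E ∈ M.wall .X x, E.left = v)

/-- The emerging pre-walls designated as walls: those of type one are processed first, then those of
type three, then those of type two. -/
def designated [m.AtLeastTwo] (M : MazeData m) (P : ScaleParams) (ord : Listing) (x : Seq m) :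
    Set (ℤ × ℤ) :=
  greedy {I | M.PreWall P .two x I.1 I.2} (ord .two)
    (greedy {I | M.PreWall P .three x I.1 I.2} (ord .three)
      (greedy {I | M.PreWall P .one x I.1 I.2} (ord .one) ∅))

/-! #### Walls and barriers (of the `X`-axis) during the scale-up -/

/-- Walls of `M` and emerging walls. -/
def wall₀ [m.AtLeastTwo] (M : MazeData m) (P : ScaleParams) (ord : Listing) (x : Seq m) :
    Set WallValue :=
  M.wall .X x ∪ {E | E.rank = P.Rhat ∧ (E.left, E.right) ∈ M.designated P ord x}

/-- Barriers of `M` and emerging barriers. -/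
def barrier₀ [m.AtLeastTwo] (M : MazeData m) (P : ScaleParams) (x : Seq m) : Set WallValue :=
  M.barrier .X x ∪ {E | E.rank = P.Rhat ∧ ∃ j, M.EmergingBarrier P j x E.left E.right}

/-- After the first compounding step (the left component is light). -/
def wall₁ [m.AtLeastTwo] (M : MazeData m) (P : ScaleParams) (ord : Listing) (x : Seq m) :
    Set WallValue :=
  M.wall₀ P ord x ∪ {E | ∃ E₁ ∈ M.wall₀ P ord x, ∃ E₂ ∈ M.wall₀ P ord x,
    E₁.rank < P.Rstar ∧ IsCompound P.f E₁ E₂ E ∧ M.Hop .X x E₁.right E₂.left}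

def barrier₁ [m.AtLeastTwo] (M : MazeData m) (P : ScaleParams) (x : Seq m) : Set WallValue :=
  M.barrier₀ P x ∪ {E | ∃ E₁ ∈ M.barrier₀ P x, ∃ E₂ ∈ M.barrier₀ P x,
    E₁.rank < P.Rstar ∧ IsCompound P.f E₁ E₂ E}

/-- After the second compounding step (the right component is light). -/
def wall₂ [m.AtLeastTwo] (M : MazeData m) (P : ScaleParams) (ord : Listing) (x : Seq m) :
    Set WallValue :=
  M.wall₁ P ord x ∪ {E | ∃ E₁ ∈ M.wall₁ P ord x, ∃ E₂ ∈ M.wall₁ P ord x,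
    E₂.rank < P.Rstar ∧ IsCompound P.f E₁ E₂ E ∧ M.Hop .X x E₁.right E₂.left}

def barrier₂ [m.AtLeastTwo] (M : MazeData m) (P : ScaleParams) (x : Seq m) : Set WallValue :=
  M.barrier₁ P x ∪ {E | ∃ E₁ ∈ M.barrier₁ P x, ∃ E₂ ∈ M.barrier₁ P x,
    E₂.rank < P.Rstar ∧ IsCompound P.f E₁ E₂ E}

/-- The walls of the scaled-up structure: light walls are removed, and with each dominant light wall
also the other walls contained in it. -/
def newWall [m.AtLeastTwo] (M : MazeData m) (P : ScaleParams) (ord : Listing) (x : Seq m) :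
    Set WallValue :=
  {E | E ∈ M.wall₂ P ord x ∧ P.Rstar ≤ E.rank ∧
    ¬ ∃ D, M.DominantLight P x D ∧ E.ContainedIn D.left D.right}

def newBarrier [m.AtLeastTwo] (M : MazeData m) (P : ScaleParams) (x : Seq m) : Set WallValue :=
  {E | E ∈ M.barrier₂ P x ∧ P.Rstar ≤ E.rank}

/-- No element of `S` contained in the interval from `a` to `b` has its left end (`e = lower`) closer
than `r` to `a`, resp. its right end (`e = upper`) closer than `r` to `b`. -/
def NoneNear (S : Set WallValue) (r : ℝ) (a b : ℤ) (e : End) : Prop :=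
  ∀ E ∈ S, E.ContainedIn a b →
    match e with
    | .lower => r ≤ (E.left : ℝ) - a
    | .upper => r ≤ (b : ℝ) - E.right

/-- The corner of the rectangle from `u` to `v` selected by `e`, as a point of the plane.  (The
distance on `ℝ × ℝ` is the maximum of the coordinate distances.) -/
def corner (u v : ℤ × ℤ) (e : End) : ℝ × ℝ :=
  match e with
  | .lower => (u.1, u.2)
  | .upper => (v.1, v.2)

/-- The scaled-up structure.  `ord` is the choice, for each axis and each sequence, of the order in
which emerging pre-walls are processed. -/
def scaleUp [m.AtLeastTwo] (M : MazeData m) (P : ScaleParams) (ord : Axis → Seq m → Listing) :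
    MazeData m where
  trap x y := {t | M.UncorrelatedTrap P x y t ∨ M.HorizontalTrap P x y t ∨
    M.swap.HorizontalTrap P y x t.swap}
  wall δ z := (M.orient δ).newWall P (ord δ z) z
  barrier δ z := (M.orient δ).newBarrier P z
  clean δ z a b e := M.clean δ z a b e ∧ NoneNear (M.wall δ z) (P.f / 3) a b e
  strong δ z a b e := M.strong δ z a b e ∧ NoneNear (M.barrier δ z) (P.f / 3) a b e
  trapClean x y u v e k := M.trapClean x y u v e k ∧
    ∀ t ∈ M.trap x y, t.toSet ⊆ rectSet k u v → ∀ p ∈ t.toSet, P.g ≤ dist (corner u v e) p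

end MazeData

/-! ### The parameters of the hierarchy -/

/-- Admissible exponents. -/
structure Exponents where
  δ : ℝ
  φ : ℝ
  γ : ℝ
  τ : ℝ
  τ' : ℝ
  ω : ℝ
  χ : ℝ
  one_lt_τ : 1 < τ
  τ_lt_two : τ < 2
  τ_lt_τ' : τ < τ'
  τ'_lt : τ' < τ ^ 2
  δ_pos : 0 < δ
  δ_lt_γ : δ < γ
  γ_lt_φ : γ < φ
  φ_lt_one : φ < 1
  τ_eq : τ = 2 - φ
  φ_lt : φ < τ * δ
  γ_ge : (δ + φ) / 2 ≤ γ
  correl : 4 * (γ + δ) < ω * (4 - τ)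
  emerg₁ : 4 * γ + 6 * δ + τ' < ω
  emerg₂ : τ * (δ + 1) < τ'
  χ_pos : 0 < χ
  χ₁ : τ * χ < γ - δ
  χ₂ : 2 * τ / (τ - 1) * χ < 1 - τ * δ
  χ₃ : 2 * τ / (τ - 1) * χ < ω - 2 * τ * δ

namespace Exponents

variable (e : Exponents) (R₀ : ℝ) (k : ℕ)

/-- `R_k = R₀ τ^k`. -/
def R : ℝ := R₀ * e.τ ^ k

/-- `T_k = (√2)^{R_k}`. -/
def T : ℝ := lam ^ e.R R₀ k

def Δ : ℝ := e.T R₀ k ^ e.δ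

def f : ℝ := e.T R₀ k ^ e.φ

def g : ℝ := e.T R₀ k ^ e.γ

def w : ℝ := e.T R₀ k ^ (-e.ω)

/-- The slope bounds: `σ_1 = 0`, `σ_{k+1} = σ_k + Λ g_k / f_k` with `Λ = 500`. -/
def σ : ℝ := ∑ i ∈ Finset.Ico 1 k, 500 * e.g R₀ i / e.f R₀ i

/-- The parameters of the mazery of level `k`. -/
def params (q c₁ c₂ c₃ : ℝ) : Params where
  Δ := e.Δ R₀ k
  σ := e.σ R₀ k
  R := e.R R₀ k
  w := e.w R₀ k
  q := q
  c₁ := c₁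
  c₂ := c₂
  c₃ := c₃
  χ := e.χ

/-- The parameters of the scale-up from level `k` to level `k + 1`. -/
def scaleParams : ScaleParams where
  Δ := e.Δ R₀ k
  f := e.f R₀ k
  g := e.g R₀ k
  w := e.w R₀ k
  Rstar := e.R R₀ (k + 1)
  Rhat := e.τ' * e.R R₀ k

end Exponents

end Clairvoyant

end

open Clairvoyant

/-!
The upper right corner of a hop of the scaled-up structure is reached by following the diagonal
from one resting point to the next; the increase of the slope bound pays for the deviations from
it.

*One axis at a time.* In an interval that is a hop of the scaled-up structure `M*`, every wall of
`M` lies in a dominant light wall (`HopInterval.exists_domWall`): otherwise it is heavy or, by the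
covering condition, forms with a neighbor a compound wall of `M*`, and compounds of gap at most `f`
are heavy since `τ = 2 - φ`.  For the same reason dominant light walls are more than `f` apart
(`domWalls_sep`).  Moreover, the bad events defining emerging barriers have conditional probability
at most `w²` away from the ends of the interval (`HopInterval.lawGiven_le`): otherwise good ends
can be found near the interval in question that make it a pre-wall, and the designated pre-wall
which that one meets is a wall of `M*`.  Consequently the bad events do not occur at all in a
rectangle that is a hop of `M*`, as they would give traps of `M*`.  This is collected in `Setting`.

*Without walls.* Since there are no uncorrelated compound traps, the traps in a region of size `f`
lie in a strip of width `O(Δ)`, horizontal or vertical (`Setting.exists_strip`).  A strip that is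
met far from the ends of the diagonal of a wall-free rectangle has a gap near the diagonal, because
the first bad event does not occur; near the ends there are no traps at all, because these ends are
required to be at distance `g / 2` from traps (`Source`, `Target`).  The path consists of at most
three hops of `M`, whose slopes differ from that of the diagonal by `O(Δ / g)`, hence by `O(g / f)`
(`Setting.reach_of_wallFree`).

*Through walls.* A dominant wall can be crossed within distance `O(g)` of the diagonal, through a
good hole with no traps near its ends: the second bad event gives a long gap in a strip of traps
along the wall, and the third one a good hole there (`Setting.exists_crossing`).  A segment of the
diagonal of length less than `f` meets at most one wall of each axis.  If it meets both, the holes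
are taken on the proper sides of the diagonal, so that the path between them makes progress in the
right direction (`Setting.reach_through_walls`).  Among three points spaced by `f / 4` along the
diagonal one is far from all walls, and near it there is a resting point, which is both a source
and a target (`Setting.exists_resting`).  Induction over segments of length at most `0.9 f` gives
the path (`Setting.reach_end`).
-/

namespace Clairvoyant

/-! ### Numerical relations between the scales -/

theorem one_lt_lam : 1 < lam := by
  rw [lam]; exact Real.lt_sqrt_of_sq_lt (by norm_num)

/-- The numerical relations between the parameters of a mazery and of its scale-up on which the
approximation argument rests: `1 ≪ Δ ≪ g ≪ f`, with the error of one scale, `g / f`, dominating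
`Δ / g`; compounds of light walls, and emerging walls, are heavy. -/
structure Scale (P : Params) (S : ScaleParams) : Prop where
  Δ_eq : S.Δ = P.Δ
  ten_le : 10 ≤ S.Δ
  g_ge : 1000 * S.Δ ≤ S.g
  f_ge : 10000 * S.g ≤ S.f
  mul_le : S.Δ * S.f ≤ S.g * S.g
  σ_nonneg : 0 ≤ P.σ
  σ_le : P.σ + 500 * (S.g / S.f) ≤ 1 / 10
  rank_compound : ∀ i : ℕ, (jump i : ℝ) ≤ S.f → S.Rstar ≤ 2 * P.R - i
  rank_emerging : S.Rstar ≤ S.Rhat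

namespace MazeData

variable {m : ℕ}

/-! ### External intervals and the ends of dominant walls -/

theorem external_iff {M : MazeData m} {δ : Axis} {z : Seq m} {a b : ℤ} :
    M.External δ z a b ↔ ∀ E ∈ M.wall δ z, b ≤ a ∨ E.right ≤ a ∨ b ≤ E.left := by
  refine forall₂_congr fun E _ => ?_
  have := E.lt
  rw [Set.Ioc_disjoint_Ioc]
  rcases le_total b E.right with h | h <;> rcases le_total a E.left with h' | h' <;>
    simp only [min_eq_left, min_eq_right, max_eq_left, max_eq_right, h, h'] <;> omega

theorem External.mono {M : MazeData m} {δ : Axis} {z : Seq m} {a b a' b' : ℤ}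
    (h : M.External δ z a b) (ha : a ≤ a') (hb : b' ≤ b) : M.External δ z a' b' := by
  rw [external_iff] at h ⊢
  intro E hE
  have := h E hE
  omega

/-- A long interval containing no wall is external away from its ends. -/
theorem external_of_noWallIn {M : MazeData m} {δ : Axis} {z : Seq m} {Δ : ℝ} {p q a b : ℤ}
    (hsize : ∀ E ∈ M.wall δ z, (E.right : ℝ) - E.left ≤ Δ) (h : M.NoWallIn δ z p q)
    (ha : (p : ℝ) + Δ ≤ a + 1) (hb : (b : ℝ) + Δ ≤ q + 1) : M.External δ z a b := by
  rw [external_iff]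
  intro E hE
  by_contra! hcon
  obtain ⟨-, h1, h2⟩ := hcon
  have hs := hsize E hE
  have h1' : (a : ℝ) + 1 ≤ E.right := by exact_mod_cast h1
  have h2' : (E.left : ℝ) + 1 ≤ b := by exact_mod_cast h2
  exact h E hE ⟨by exact_mod_cast (by linarith : (p : ℝ) ≤ E.left),
    by exact_mod_cast (by linarith : (E.right : ℝ) ≤ q)⟩

theorem External.exists_max_left {M : MazeData m} {δ : Axis} {z : Seq m} {a b : ℤ}
    (h : M.External δ z a b) (ha : -1 ≤ a) :
    ∃ e, -1 ≤ e ∧ e ≤ a ∧ M.External δ z e b ∧ (e = -1 ∨ ¬ M.External δ z (e - 1) b) := by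
  obtain ⟨e, ⟨he, he'⟩, hmin⟩ := Int.exists_least_of_bdd
    (P := fun e => -1 ≤ e ∧ M.External δ z e b) ⟨-1, fun z hz => hz.1⟩ ⟨a, ha, h⟩
  refine ⟨e, he, hmin a ⟨ha, h⟩, he', ?_⟩
  by_contra! hcon
  have := hmin (e - 1) ⟨by omega, hcon.2⟩
  omega

theorem External.exists_max_right {M : MazeData m} {δ : Axis} {z : Seq m} {a b : ℤ}
    (h : M.External δ z a b) :
    (∃ c, b ≤ c ∧ M.External δ z a c ∧ ¬ M.External δ z a (c + 1)) ∨
      ∀ c, M.External δ z a c := by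
  by_cases hall : ∀ c, M.External δ z a c
  · exact Or.inr hall
  push Not at hall
  obtain ⟨c₀, hc₀⟩ := hall
  obtain ⟨c, hc, hmax⟩ := Int.exists_greatest_of_bdd (P := fun c => M.External δ z a c)
    ⟨c₀, fun c hc => by
      by_contra! hlt
      exact hc₀ (hc.mono le_rfl hlt.le)⟩ ⟨b, h⟩
  refine Or.inl ⟨c, hmax b h, hc, fun h' => ?_⟩
  have := hmax _ h'
  omega

theorem not_external_of_wall {M : MazeData m} {δ : Axis} {z : Seq m} {E : WallValue} {a b : ℤ}
    (hE : E ∈ M.wall δ z) (ha : a < E.right) (hb : E.left < b) (hab : a < b) :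
    ¬ M.External δ z a b := by
  rw [external_iff]
  intro h
  have := h E hE
  omega

theorem Spans.exists_first {M : MazeData m} {δ : Axis} {z : Seq m} {a b : ℤ}
    (h : M.Spans δ z a b) :
    ∃ E ∈ M.wall δ z, E.left = a ∧ E.right ≤ b ∧ (E.right = b ∨ ∃ E₂ ∈ M.wall δ z,
      E.right ≤ E₂.left ∧ E₂.right ≤ b ∧ M.Hop δ z E.right E₂.left) := by
  induction h with
  | single E hE => exact ⟨E, hE, rfl, le_rfl, Or.inl rfl⟩
  | cons E hE c b hc hop rest ih =>
    obtain ⟨E₂, hE₂, h1, h2, -⟩ := ih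
    have := E₂.lt
    exact ⟨E, hE, rfl, by omega, Or.inr ⟨E₂, hE₂, by omega, h2, by rw [h1]; exact hop⟩⟩

/-- A dominant wall away from the beginning of the half-line is preceded by an external interval of
length `⌈Δ⌉`. -/
theorem DominantLight.external_left {M : MazeData m} {P : Params} {S : ScaleParams}
    (hS : Scale P S) {x : Seq m} {D : WallValue} (hD : M.DominantLight S x D)
    (hfar : S.Δ ≤ (D.left : ℝ)) : M.External .X x (D.left - ⌈P.Δ⌉) D.left := by
  obtain ⟨a, ha, haD, hext, hlen⟩ := hD.1.2.1
  rw [hS.Δ_eq] at hfar hlen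
  refine hext.mono ?_ le_rfl
  have : ⌈P.Δ⌉ ≤ D.left - a := by
    rw [Int.ceil_le]
    push_cast
    rcases hlen with h | rfl
    · exact h
    · push_cast; linarith
  omega

theorem DominantLight.external_right {M : MazeData m} {P : Params} {S : ScaleParams}
    (hS : Scale P S) {x : Seq m} {D : WallValue} (hD : M.DominantLight S x D) :
    M.External .X x D.right (D.right + ⌈P.Δ⌉) := by
  obtain ⟨b, hb, hext, hlen⟩ := hD.1.2.2
  rw [hS.Δ_eq] at hlen
  refine hext.mono le_rfl ?_
  have : ⌈P.Δ⌉ ≤ b - D.right := by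
    rw [Int.ceil_le]
    push_cast
    exact hlen
  omega

variable [m.AtLeastTwo]

/-- The left end of a wall preceded by a long external interval is left-clean. -/
theorem Conditions.leftClean {M : MazeData m} {P : Params} (hC : M.Conditions P) {x : Seq m}
    (hx : IsWalk x) {E : WallValue} (hE : E ∈ M.wall .X x) {a : ℤ} (ha : -1 ≤ a)
    (haE : a < E.left) (hlen : P.Δ ≤ (E.left : ℝ) - a) (hext : M.External .X x a E.left) :
    M.LeftClean .X x E.left := by
  obtain ⟨e, he, hea, hext', hmax⟩ := hext.exists_max_left ha
  have hME : M.MaxExternal .X x e E.left :=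
    ⟨he, by omega, hext', hmax, not_external_of_wall hE (by have := E.lt; omega) (by omega)
      (by omega)⟩
  have hea' : (e : ℝ) ≤ a := by exact_mod_cast hea
  have hcl := (hC.inner_clean x hx e E.left hME (Or.inl (by linarith))).2
  intro a' ha' _ hlt _
  exact (hC.min_upper x hx e a' E.left he (by omega) (by linarith) ha' hlt).1
    (hcl (by omega) (by simp))

/-- The right end of a wall followed by a long external interval is right-clean. -/
theorem Conditions.rightClean {M : MazeData m} {P : Params} (hC : M.Conditions P) {x : Seq m}
    (hx : IsWalk x) {E : WallValue} (hE : E ∈ M.wall .X x) {b : ℤ}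
    (hEb : E.right < b) (hlen : P.Δ ≤ (b : ℝ) - E.right) (hext : M.External .X x E.right b) :
    M.RightClean .X x E.right := by
  have h1 := E.neg_one_le
  have h2 := E.lt
  have hnot : ∀ c, E.right ≤ c → ¬ M.External .X x (E.right - 1) c := fun c hc =>
    not_external_of_wall hE (by omega) (by omega) (by omega)
  rcases hext.exists_max_right with ⟨c, hbc, hext', hmax⟩ | hall
  · have hME : M.MaxExternal .X x E.right c :=
      ⟨by omega, by omega, hext', Or.inr (hnot c (by omega)), hmax⟩
    have hbc' : (b : ℝ) ≤ c := by exact_mod_cast hbc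
    have hcl := (hC.inner_clean x hx E.right c hME (Or.inl (by linarith))).1
    intro b' _ hlt _
    exact (hC.min_lower x hx E.right c b' (by omega) (by omega) (by linarith) hlt).1
      (hcl (by omega) (fun _ => by omega))
  · exact hC.inner_clean_inf x hx E.right
      ⟨by omega, fun b _ => hall b, Or.inr (hnot _ le_rfl)⟩

/-! ### Walls in an interval that is a hop of the scaled-up structure -/

/-- The properties used of an interval that is a hop of the scaled-up structure: it contains no
wall of that structure, and none of the walls of `M` that it contains is near its ends. -/
structure HopInterval (M : MazeData m) (S : ScaleParams) (ord : Listing) (x : Seq m)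
    (A B : ℤ) : Prop where
  nonneg : 0 ≤ A
  left_far : ∀ E ∈ M.wall .X x, E.ContainedIn A B → S.f / 3 ≤ (E.left : ℝ) - A
  right_far : ∀ E ∈ M.wall .X x, E.ContainedIn A B → S.f / 3 ≤ (B : ℝ) - E.right
  no_newWall : ∀ E ∈ M.newWall S ord x, ¬ E.ContainedIn A B

/-- The dominant light walls contained in the interval from `A` to `B`. -/
def domWalls (M : MazeData m) (S : ScaleParams) (x : Seq m) (A B : ℤ) : Set WallValue :=
  {D | M.DominantLight S x D ∧ D.ContainedIn A B}

theorem exists_jump {d : ℤ} (hd : 0 ≤ d) : ∃ i : ℕ, jump i ≤ d ∧ d < jump (i + 1) := by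
  classical
  have hex : ∃ i : ℕ, d < jump (i + 1) := by
    obtain ⟨n, hn⟩ := pow_unbounded_of_one_lt (d : ℝ) one_lt_lam
    refine ⟨n + 1, ?_⟩
    have h2 : lam ^ n ≤ lam ^ (n + 1 + 1) := pow_le_pow_right₀ one_lt_lam.le (by omega)
    have h3 : (d : ℝ) < (⌈lam ^ (n + 1 + 1)⌉ : ℤ) := (hn.trans_le h2).trans_le (Int.le_ceil _)
    simp only [jump, show ¬ (n + 1 + 1 ≤ 1) by omega, if_false]
    exact_mod_cast h3
  refine ⟨Nat.find hex, ?_, Nat.find_spec hex⟩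
  rcases Nat.eq_zero_or_pos (Nat.find hex) with h0 | h0
  · rw [h0]; simpa [jump] using hd
  · have := Nat.find_min hex (m := Nat.find hex - 1) (by omega)
    rw [Nat.sub_add_cancel h0] at this
    omega

/-- A light wall followed, after a short hop, by another wall forms a heavy compound.  In a hop of
the scaled-up structure this can only happen inside a dominant light wall. -/
theorem HopInterval.exists_of_compound {M : MazeData m} {P : Params} {S : ScaleParams}
    {ord : Listing} {x : Seq m} {A B : ℤ} (hC : M.Conditions P) (hS : Scale P S) (hx : IsWalk x)
    (hI : M.HopInterval S ord x A B) {E₁ E₂ : WallValue}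
    (h₁ : E₁ ∈ M.wall .X x) (h₂ : E₂ ∈ M.wall .X x) (hlight : E₁.rank < S.Rstar)
    (hle : E₁.right ≤ E₂.left) (hf : ((E₂.left : ℝ)) - E₁.right ≤ S.f)
    (hop : M.Hop .X x E₁.right E₂.left) (hA : A ≤ E₁.left) (hB : E₂.right ≤ B) :
    ∃ D, M.DominantLight S x D ∧ D.left ≤ E₁.left ∧ E₂.right ≤ D.right := by
  obtain ⟨i, hi, hi'⟩ := exists_jump (d := E₂.left - E₁.right) (by omega)
  let E : WallValue := ⟨E₁.left, E₂.right, E₁.rank + E₂.rank - i, E₁.neg_one_le, by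
    have := E₁.lt; have := E₂.lt; omega⟩
  have hcomp : IsCompound S.f E₁ E₂ E :=
    ⟨hle, by push_cast; exact hf, rfl, rfl, i, hi, hi', rfl⟩
  have hE : E ∈ M.wall₁ S ord x :=
    Or.inr ⟨E₁, Or.inl h₁, E₂, Or.inl h₂, hlight, hcomp, hop⟩
  have hr₁ := hC.rank_ge x hx E₁ (hC.wall_barrier x hx h₁)
  have hr₂ := hC.rank_ge x hx E₂ (hC.wall_barrier x hx h₂)
  have hji : (jump i : ℝ) ≤ S.f := by
    have : (jump i : ℝ) ≤ ((E₂.left - E₁.right : ℤ) : ℝ) := by exact_mod_cast hi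
    push_cast at this
    linarith
  have hrank : S.Rstar ≤ E.rank := by
    have := hS.rank_compound i hji
    change S.Rstar ≤ E₁.rank + E₂.rank - i
    linarith
  by_contra hcon
  refine hI.no_newWall E ⟨Or.inl hE, hrank, fun ⟨D, hD, hED⟩ => hcon ⟨D, hD, hED.1, hED.2⟩⟩ ⟨hA, hB⟩

/-- A wall of `M` that is not light can only occur inside a dominant light wall. -/
theorem HopInterval.exists_of_heavy {M : MazeData m} {S : ScaleParams}
    {ord : Listing} {x : Seq m} {A B : ℤ} (hI : M.HopInterval S ord x A B) {E : WallValue}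
    (hE : E ∈ M.wall .X x) (hheavy : S.Rstar ≤ E.rank) (hA : A ≤ E.left) (hB : E.right ≤ B) :
    ∃ D, M.DominantLight S x D ∧ D.left ≤ E.left ∧ E.right ≤ D.right := by
  by_contra hcon
  exact hI.no_newWall E ⟨Or.inl (Or.inl (Or.inl hE)), hheavy,
    fun ⟨D, hD, hED⟩ => hcon ⟨D, hD, hED.1, hED.2⟩⟩ ⟨hA, hB⟩

/-- Every wall contained in a hop of the scaled-up structure lies in a dominant light wall. -/
theorem HopInterval.exists_domWall {M : MazeData m} {P : Params} {S : ScaleParams}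
    {ord : Listing} {x : Seq m} {A B : ℤ} (hC : M.Conditions P) (hS : Scale P S) (hx : IsWalk x)
    (hI : M.HopInterval S ord x A B) {E : WallValue} (hE : E ∈ M.wall .X x)
    (hEAB : E.ContainedIn A B) :
    ∃ D ∈ M.domWalls S x A B, E.ContainedIn D.left D.right := by
  have hΔ := hS.Δ_eq
  have h10 := hS.ten_le
  have hg := hS.g_ge
  have hf := hS.f_ge
  rw [hΔ] at h10 hg
  have hA0 : (0 : ℝ) ≤ A := by exact_mod_cast hI.nonneg
  obtain ⟨n, hn⟩ : ∃ n : ℤ, n = ⌈P.Δ⌉ := ⟨_, rfl⟩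
  have hn1 : P.Δ ≤ n := by rw [hn]; exact Int.le_ceil _
  have hn2 : (n : ℝ) < P.Δ + 1 := by rw [hn]; exact Int.ceil_lt_add_one _
  have hn10 : 10 ≤ n := by exact_mod_cast (h10.trans hn1)
  have hlt := E.lt
  -- The walls near the ends of the interval being excluded, there are external stretches there.
  have hleft := hI.left_far E hE hEAB
  have hright := hI.right_far E hE hEAB
  have hcL : ∀ E' ∈ M.wall .X x, ¬ E'.ContainedIn A (A + 4 * n) := by
    intro E' hE' hc
    have hlt' : (E'.left : ℝ) < E'.right := by exact_mod_cast E'.lt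
    have h4 : (A + 4 * n : ℝ) ≤ B := by
      have : (E.left : ℝ) ≤ E.right := by exact_mod_cast hlt.le
      linarith
    have h4' : A + 4 * n ≤ B := by exact_mod_cast h4
    have := hI.left_far E' hE' ⟨hc.1, hc.2.trans h4'⟩
    have h5 : (E'.right : ℝ) ≤ A + 4 * n := by exact_mod_cast hc.2
    linarith
  have hcR : ∀ E' ∈ M.wall .X x, ¬ E'.ContainedIn (B - 4 * n) B := by
    intro E' hE' hc
    have hlt' : (E'.left : ℝ) < E'.right := by exact_mod_cast E'.lt
    have h4 : (A : ℝ) ≤ B - 4 * n := by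
      have : (E.left : ℝ) ≤ E.right := by exact_mod_cast hlt.le
      linarith
    have h4' : A ≤ B - 4 * n := by exact_mod_cast h4
    have := hI.right_far E' hE' ⟨h4'.trans hc.1, hc.2⟩
    have h5 : (B - 4 * n : ℝ) ≤ E'.left := by exact_mod_cast hc.1
    linarith
  have hsize := hC.wall_size x hx
  have hextL : M.External .X x (A + 2 * n - n) (A + 2 * n) :=
    external_of_noWallIn hsize hcL (by push_cast; linarith) (by push_cast; linarith)
  have hextR : M.External .X x (B - 2 * n) (B - 2 * n + n) :=
    external_of_noWallIn hsize hcR (by push_cast; linarith) (by push_cast; linarith)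
  have hAE : A + 2 * n ≤ E.left := by
    exact_mod_cast (by push_cast; linarith : ((A + 2 * n : ℤ) : ℝ) ≤ E.left)
  have hEB : E.right ≤ B - 2 * n := by
    exact_mod_cast (by push_cast; linarith : (E.right : ℝ) ≤ ((B - 2 * n : ℤ) : ℝ))
  -- The last long external stretch before `E` and the first one after it.
  obtain ⟨a, ⟨haE, haext⟩, hamax⟩ := Int.exists_greatest_of_bdd
    (P := fun a => a ≤ E.left ∧ M.External .X x (a - n) a) ⟨E.left, fun a ha => ha.1⟩
    ⟨A + 2 * n, hAE, hextL⟩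
  obtain ⟨b, ⟨hbE, hbext⟩, hbmin⟩ := Int.exists_least_of_bdd
    (P := fun b => E.right ≤ b ∧ M.External .X x b (b + n)) ⟨E.right, fun b hb => hb.1⟩
    ⟨B - 2 * n, hEB, hextR⟩
  have haA := hamax _ ⟨hAE, hextL⟩
  have hbB := hbmin _ ⟨hEB, hextR⟩
  have hA := hI.nonneg
  have hnotE : ∀ p q, p < E.right → E.left < q → p < q → ¬ M.External .X x p q :=
    fun p q h1 h2 h3 => not_external_of_wall hE h1 h2 h3
  obtain ⟨e, he, hea, heext, hemax⟩ := haext.exists_max_left (by omega)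
  have hME : M.MaxExternal .X x e a := by
    refine ⟨he, by omega, heext, hemax, fun h => ?_⟩
    rcases haE.lt_or_eq with h' | h'
    · have := hamax (a + 1) ⟨by omega, h.mono (by omega) le_rfl⟩
      omega
    · exact hnotE e (a + 1) (by omega) (by omega) (by omega) h
  have hbnot : ∀ c, b ≤ c → ¬ M.External .X x (b - 1) c := by
    intro c hc h
    rcases hbE.lt_or_eq with h' | h'
    · have hb' : M.External .X x (b - 1) (b - 1 + n) := by
        rw [external_iff] at h hbext ⊢
        intro E' hE'
        have := h E' hE'
        have := hbext E' hE'
        have := E'.lt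
        omega
      have := hbmin (b - 1) ⟨by omega, hb'⟩
      omega
    · exact hnotE (b - 1) c (by omega) (by omega) (by omega) h
  have hright' : (∃ c, M.MaxExternal .X x b c ∧ P.Δ ≤ (c : ℝ) - b) ∨ M.MaxExternalInf .X x b := by
    rcases hbext.exists_max_right with ⟨c, hbc, hext', hmax⟩ | hall
    · refine Or.inl ⟨c, ⟨by omega, by omega, hext', Or.inr (hbnot c (by omega)), hmax⟩, ?_⟩
      have : ((b + n : ℤ) : ℝ) ≤ c := by exact_mod_cast hbc
      push_cast at this
      linarith
    · exact Or.inr ⟨by omega, fun b' _ => hall b', Or.inr (hbnot b le_rfl)⟩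
  have hspan := hC.cover x hx e a b hME (Or.inl (by
    have : (e : ℝ) ≤ ((a - n : ℤ) : ℝ) := by exact_mod_cast hea
    push_cast at this
    linarith)) (by omega) hright'
  -- The first wall of the spanning sequence lies in a dominant light wall.
  obtain ⟨E₁, hE₁, hE₁a, hE₁b, hrest⟩ := hspan.exists_first
  have hE₁lt := E₁.lt
  have hD : ∃ D, M.DominantLight S x D ∧ D.left ≤ E₁.left ∧ E₁.right ≤ D.right := by
    rcases le_or_gt S.Rstar E₁.rank with hheavy | hlight
    · exact hI.exists_of_heavy hE₁ hheavy (by omega) (by omega)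
    rcases hrest with hr | ⟨E₂, hE₂, hle, hE₂b, hop⟩
    · refine ⟨E₁, ⟨⟨hE₁, ⟨a - n, by omega, by omega, hE₁a ▸ haext, Or.inl ?_⟩,
        ⟨b + n, by omega, hr ▸ hbext, ?_⟩⟩, hlight⟩, le_rfl, le_rfl⟩
      · rw [hE₁a, hΔ]; push_cast; linarith
      · rw [hr, hΔ]; push_cast; linarith
    · have hE₂lt := E₂.lt
      -- A longer hop would contain an external stretch between `a` and `b`.
      have hshort : E₂.left - E₁.right < 3 * n := by
        by_contra! hlong
        have hz : M.External .X x (E₁.right + n) (E₁.right + n + n) :=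
          external_of_noWallIn hsize hop.2 (by push_cast; linarith) (by
            have : ((3 * n : ℤ) : ℝ) ≤ ((E₂.left - E₁.right : ℤ) : ℝ) := by exact_mod_cast hlong
            push_cast at this ⊢
            linarith)
        rcases le_or_gt (E₁.right + n + n) E.left with h1 | h1
        · have := hamax (E₁.right + n + n) ⟨h1, by simpa using hz⟩
          omega
        · rcases le_or_gt E.right (E₁.right + n) with h2 | h2
          · have := hbmin (E₁.right + n) ⟨h2, hz⟩
            omega
          · exact hnotE _ _ h2 h1 (by omega) hz
      have hshort' : ((E₂.left - E₁.right : ℤ) : ℝ) < ((3 * n : ℤ) : ℝ) := by exact_mod_cast hshort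
      push_cast at hshort'
      obtain ⟨D, hD, h1, h2⟩ := hI.exists_of_compound hC hS hx hE₁ hE₂ hlight hle (by linarith) hop
        (by omega) (by omega)
      exact ⟨D, hD, h1, by omega⟩
  obtain ⟨D, hD, hD₁, hD₂⟩ := hD
  have hDlt := D.lt
  have hDl : D.left = a := by
    have := (external_iff.1 haext) D hD.1.1
    omega
  have hDext := hD.external_right hS
  rw [← hn] at hDext
  have hDE : E.right ≤ D.right := by
    rcases le_or_gt D.right E.left with h1 | h1
    · have h3 := (external_iff.1 hDext) E hE
      have := hamax (D.right + n) ⟨by omega, by simpa using hDext⟩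
      omega
    · by_contra! h2
      exact hnotE _ _ h2 (by omega) (by omega) hDext
  have hDsize := hsize D hD.1.1
  have hDr : D.right ≤ B := by
    have h1 : (D.left : ℝ) ≤ E.left := by exact_mod_cast (by omega : D.left ≤ E.left)
    have h2 : (E.left : ℝ) ≤ E.right := by exact_mod_cast hlt.le
    exact_mod_cast (by linarith : (D.right : ℝ) ≤ B)
  exact ⟨D, ⟨hD, by omega, hDr⟩, by omega, hDE⟩

/-- Dominant walls are disjoint or equal. -/
theorem domWalls_eq_or_lt {M : MazeData m} {P : Params} {S : ScaleParams}
    {ord : Listing} {x : Seq m} {A B : ℤ} (hS : Scale P S)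
    (hI : M.HopInterval S ord x A B) {D₁ D₂ : WallValue} (h₁ : D₁ ∈ M.domWalls S x A B)
    (h₂ : D₂ ∈ M.domWalls S x A B) (hle : D₁.left ≤ D₂.left) :
    (D₁.left = D₂.left ∧ D₁.right = D₂.right) ∨ D₁.right < D₂.left := by
  have h10 := hS.ten_le
  have hg := hS.g_ge
  have hf := hS.f_ge
  have hA0 : (0 : ℝ) ≤ A := by exact_mod_cast hI.nonneg
  have hfar := hI.left_far D₂ h₂.1.1.1 h₂.2
  have hn : 0 < ⌈P.Δ⌉ := by
    rw [← hS.Δ_eq]; exact Int.ceil_pos.2 (by linarith)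
  have e1 := (external_iff.1 (h₂.1.external_left hS (by linarith))) D₁ h₁.1.1.1
  have e2 := (external_iff.1 (h₁.1.external_right hS)) D₂ h₂.1.1.1
  have e3 := (external_iff.1 (h₂.1.external_right hS)) D₁ h₁.1.1.1
  have := D₁.lt
  have := D₂.lt
  omega

/-- Different dominant light walls contained in a hop of the scaled-up structure are more than `f`
apart, because otherwise two neighbors among them would form a compound. -/
theorem domWalls_sep {M : MazeData m} {P : Params} {S : ScaleParams}
    {ord : Listing} {x : Seq m} {A B : ℤ} (hC : M.Conditions P) (hS : Scale P S) (hx : IsWalk x)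
    (hI : M.HopInterval S ord x A B) {D₁ D₂ : WallValue} (h₁ : D₁ ∈ M.domWalls S x A B)
    (h₂ : D₂ ∈ M.domWalls S x A B) (hle : D₁.left ≤ D₂.left) :
    (D₁.left = D₂.left ∧ D₁.right = D₂.right) ∨ (D₁.right : ℝ) + S.f < D₂.left := by
  obtain ⟨N, hN⟩ : ∃ N : ℕ, D₂.left - D₁.right < N := ⟨(D₂.left - D₁.right + 1).toNat, by omega⟩
  induction N generalizing D₁ D₂ with
  | zero =>
    rcases domWalls_eq_or_lt hS hI h₁ h₂ hle with h | h
    · exact Or.inl h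
    · omega
  | succ N ih =>
    rcases domWalls_eq_or_lt hS hI h₁ h₂ hle with h | hlt
    · exact Or.inl h
    refine Or.inr ?_
    by_contra! hcon
    have h10 := hS.ten_le
    have hg := hS.g_ge
    have hf := hS.f_ge
    have hA0 : (0 : ℝ) ≤ A := by exact_mod_cast hI.nonneg
    have l1 := D₁.lt
    have l2 := D₂.lt
    have hfar := hI.left_far D₂ h₂.1.1.1 h₂.2
    have hn : 0 < ⌈P.Δ⌉ := by
      rw [← hS.Δ_eq]; exact Int.ceil_pos.2 (by linarith)
    have hx2 := h₂.1.external_left hS (by linarith)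
    have hx1 := h₁.1.external_right hS
    have e2 := (external_iff.1 hx1) D₂ h₂.1.1.1
    have hD₂0 : ⌈P.Δ⌉ ≤ D₂.left := by
      rw [Int.ceil_le, ← hS.Δ_eq]; linarith
    have hlc := hC.leftClean hx h₂.1.1.1 (a := D₂.left - ⌈P.Δ⌉) (by omega) (by omega)
      (by push_cast; linarith [Int.le_ceil P.Δ]) hx2
    have hrc := hC.rightClean hx h₁.1.1.1 (b := D₁.right + ⌈P.Δ⌉) (by omega)
      (by push_cast; linarith [Int.le_ceil P.Δ]) hx1
    have hnw : M.NoWallIn .X x D₁.right D₂.left := by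
      intro E hE hEc
      have hA := h₁.2.1
      have hB := h₂.2.2
      obtain ⟨D, hD, hED⟩ := hI.exists_domWall hC hS hx hE
        ⟨by have := hEc.1; omega, by have := hEc.2; omega⟩
      have hElt := E.lt
      have := hEc.1
      have := hEc.2
      have := hED.1
      have := hED.2
      have hDD₂ : D.right < D₂.left := by
        rcases le_total D.left D₂.left with h | h
        · rcases domWalls_eq_or_lt hS hI hD h₂ h with h' | h' <;> omega
        · omega
      rcases ih h₁ hD (by
        by_contra! h
        rcases domWalls_eq_or_lt hS hI hD h₁ h.le with h' | h' <;> omega) (by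
          have := D.lt
          omega) with h' | h'
      · omega
      · have : (D.left : ℝ) < D₂.left := by exact_mod_cast (by omega : D.left < D₂.left)
        linarith
    have hneg := D₁.neg_one_le
    obtain ⟨D, hD, hD1, hD2⟩ := hI.exists_of_compound hC hS hx h₁.1.1.1 h₂.1.1.1 h₁.1.2 hlt.le
      (by linarith) ⟨⟨hrc _ hlt.le, hlc _ (by omega) hlt.le⟩, hnw⟩ h₁.2.1 h₂.2.2
    have := (external_iff.1 hx1) D hD.1.1
    omega

theorem domWalls_leftClean {M : MazeData m} {P : Params} {S : ScaleParams}
    {ord : Listing} {x : Seq m} {A B : ℤ} (hC : M.Conditions P) (hS : Scale P S) (hx : IsWalk x)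
    (hI : M.HopInterval S ord x A B) {D : WallValue} (hD : D ∈ M.domWalls S x A B) :
    M.LeftClean .X x D.left := by
  have h10 := hS.ten_le
  have hg := hS.g_ge
  have hf := hS.f_ge
  have hA0 : (0 : ℝ) ≤ A := by exact_mod_cast hI.nonneg
  have hfar := hI.left_far D hD.1.1.1 hD.2
  have hn : 0 < ⌈P.Δ⌉ := by
    rw [← hS.Δ_eq]; exact Int.ceil_pos.2 (by linarith)
  have hD0 : ⌈P.Δ⌉ ≤ D.left := by
    rw [Int.ceil_le, ← hS.Δ_eq]; linarith
  exact hC.leftClean hx hD.1.1.1 (a := D.left - ⌈P.Δ⌉) (by omega) (by omega)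
      (by push_cast; linarith [Int.le_ceil P.Δ]) (hD.1.external_left hS (by linarith))

theorem domWalls_rightClean {M : MazeData m} {P : Params} {S : ScaleParams}
    {x : Seq m} {A B : ℤ} (hC : M.Conditions P) (hS : Scale P S) (hx : IsWalk x)
    {D : WallValue} (hD : D ∈ M.domWalls S x A B) :
    M.RightClean .X x D.right := by
  have h10 := hS.ten_le
  have hn : 0 < ⌈P.Δ⌉ := by
    rw [← hS.Δ_eq]; exact Int.ceil_pos.2 (by linarith)
  exact hC.rightClean hx hD.1.1.1 (b := D.right + ⌈P.Δ⌉) (by omega)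
      (by push_cast; linarith [Int.le_ceil P.Δ]) (hD.1.external_right hS)

/-! ### Emerging walls -/

theorem domWalls_trichotomy {M : MazeData m} {P : Params} {S : ScaleParams}
    {ord : Listing} {x : Seq m} {A B : ℤ} (hC : M.Conditions P) (hS : Scale P S) (hx : IsWalk x)
    (hI : M.HopInterval S ord x A B) {D₁ D₂ : WallValue} (h₁ : D₁ ∈ M.domWalls S x A B)
    (h₂ : D₂ ∈ M.domWalls S x A B) :
    (D₁.left = D₂.left ∧ D₁.right = D₂.right) ∨ (D₁.right : ℝ) + S.f < D₂.left ∨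
      (D₂.right : ℝ) + S.f < D₁.left := by
  rcases le_total D₁.left D₂.left with h | h
  · rcases domWalls_sep hC hS hx hI h₁ h₂ h with h' | h'
    · exact Or.inl h'
    · exact Or.inr (Or.inl h')
  · rcases domWalls_sep hC hS hx hI h₂ h₁ h with h' | h'
    · exact Or.inl ⟨h'.1.symm, h'.2.symm⟩
    · exact Or.inr (Or.inr h')

theorem noWall_of_domWalls {M : MazeData m} {P : Params} {S : ScaleParams}
    {ord : Listing} {x : Seq m} {A B : ℤ} (hC : M.Conditions P) (hS : Scale P S) (hx : IsWalk x)
    (hI : M.HopInterval S ord x A B) {s t : ℝ} (hs : A ≤ s) (ht : t ≤ B)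
    (h : ∀ D ∈ M.domWalls S x A B, (D.right : ℝ) ≤ s ∨ t ≤ D.left) :
    ∀ E ∈ M.wall .X x, ¬ (s ≤ E.left ∧ (E.right : ℝ) ≤ t) := by
  intro E hE ⟨h1, h2⟩
  obtain ⟨D, hD, hDl, hDr⟩ := hI.exists_domWall hC hS hx hE
    ⟨by exact_mod_cast hs.trans h1, by exact_mod_cast h2.trans ht⟩
  have hlt : (E.left : ℝ) < E.right := by exact_mod_cast E.lt
  have hDl' : (D.left : ℝ) ≤ E.left := by exact_mod_cast hDl
  have hDr' : (E.right : ℝ) ≤ D.right := by exact_mod_cast hDr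
  rcases h D hD with h | h <;> linarith

theorem exists_clean {M : MazeData m} {P : Params} {S : ScaleParams}
    {ord : Listing} {x : Seq m} {A B : ℤ} (hC : M.Conditions P) (hS : Scale P S) (hx : IsWalk x)
    (hI : M.HopInterval S ord x A B) {s : ℝ} (hs : A ≤ s) (ht : s + 3 * S.Δ ≤ B)
    (h : ∀ D ∈ M.domWalls S x A B, (D.right : ℝ) ≤ s ∨ s + 3 * S.Δ ≤ D.left) :
    ∃ a : ℤ, s + S.Δ < a ∧ (a : ℝ) ≤ s + 2 * S.Δ ∧ M.PointClean .X x a := by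
  have hA : (0 : ℝ) ≤ A := by exact_mod_cast hI.nonneg
  obtain ⟨a, ⟨h1, h2⟩, h3⟩ := hC.clean_dense x hx s (s + 3 * S.Δ) (by linarith)
    (by rw [hS.Δ_eq]; linarith) (noWall_of_domWalls hC hS hx hI hs ht h)
  exact ⟨a, by linarith, by linarith, h3⟩

theorem external_of_domWalls {M : MazeData m} {P : Params} {S : ScaleParams}
    {ord : Listing} {x : Seq m} {A B : ℤ} (hC : M.Conditions P) (hS : Scale P S) (hx : IsWalk x)
    (hI : M.HopInterval S ord x A B) {a b : ℤ} (ha : A + S.Δ ≤ a) (hb : b + S.Δ ≤ B)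
    (h : ∀ D ∈ M.domWalls S x A B, (D.right : ℝ) ≤ a ∨ (b : ℝ) ≤ D.left) :
    M.External .X x a b := by
  rw [external_iff]
  intro E hE
  by_contra! hcon
  obtain ⟨-, h1, h2⟩ := hcon
  have hs := hC.wall_size x hx E hE
  rw [← hS.Δ_eq] at hs
  have h1' : (a : ℝ) < E.right := by exact_mod_cast h1
  have h2' : (E.left : ℝ) < b := by exact_mod_cast h2
  obtain ⟨D, hD, hDl, hDr⟩ := hI.exists_domWall hC hS hx hE
    ⟨by exact_mod_cast (by linarith : (A : ℝ) ≤ E.left),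
      by exact_mod_cast (by linarith : (E.right : ℝ) ≤ B)⟩
  have hDl' : (D.left : ℝ) ≤ E.left := by exact_mod_cast hDl
  have hDr' : (E.right : ℝ) ≤ D.right := by exact_mod_cast hDr
  rcases h D hD with h | h <;> linarith

theorem externalHop_of_domWalls {M : MazeData m} {P : Params} {S : ScaleParams}
    {ord : Listing} {x : Seq m} {A B : ℤ} (hC : M.Conditions P) (hS : Scale P S) (hx : IsWalk x)
    (hI : M.HopInterval S ord x A B) {a b : ℤ} (ha : A + S.Δ ≤ a) (hb : b + S.Δ ≤ B)
    (hab : a ≤ b) (hac : M.RightClean .X x a) (hbc : M.LeftClean .X x b)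
    (h : ∀ D ∈ M.domWalls S x A B, (D.right : ℝ) ≤ a ∨ (b : ℝ) ≤ D.left) :
    M.ExternalHop .X x a b := by
  have hA := hI.nonneg
  have h10 := hS.ten_le
  have hext := external_of_domWalls hC hS hx hI ha hb h
  have haA : A ≤ a := by exact_mod_cast (by linarith : (A : ℝ) ≤ a)
  refine ⟨hext, ⟨hac _ hab, hbc _ (by omega) hab⟩, fun E hE hEc => ?_⟩
  have := (external_iff.1 hext) E hE
  have := E.lt
  have := hEc.1
  have := hEc.2
  omega

/-- `u` can serve as the left end of an emerging pre-wall: on its left it borders on a wall or on an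
external hop, and it is not too near to any dominant wall lying on its right. -/
structure GoodLeftEnd (M : MazeData m) (S : ScaleParams) (x : Seq m) (A B u : ℤ) : Prop where
  adjacent : (∃ a, -1 ≤ a ∧ a ≤ u ∧ S.Δ ≤ (u : ℝ) - a ∧ M.ExternalHop .X x a u) ∨
    ∃ E ∈ M.wall .X x, E.right = u
  clean : M.RightClean .X x u ∨ ∃ D ∈ M.domWalls S x A B, D.left = u
  apart : ∀ D ∈ M.domWalls S x A B,
    (D.right : ℝ) ≤ u ∨ (D.left : ℝ) = u ∨ (u : ℝ) + S.Δ ≤ D.left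

/-- `v` can serve as the right end of an emerging pre-wall. -/
structure GoodRightEnd (M : MazeData m) (S : ScaleParams) (x : Seq m) (A B v : ℤ) : Prop where
  adjacent : (∃ b, v ≤ b ∧ S.Δ ≤ (b : ℝ) - v ∧ M.ExternalHop .X x v b) ∨
    ∃ E ∈ M.wall .X x, E.left = v
  clean : M.LeftClean .X x v ∨ ∃ D ∈ M.domWalls S x A B, D.right = v
  apart : ∀ D ∈ M.domWalls S x A B,
    (v : ℝ) ≤ D.left ∨ (D.right : ℝ) = v ∨ (D.right : ℝ) + S.Δ ≤ v

/-- Candidates for the left end of a pre-wall exist just before every `u'`.  An end of a dominant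
wall is taken if there is one in `[u' - 2Δ, u')`; otherwise a clean point, and the external hop
bordering on it starts at the end of a dominant wall if there is one shortly before it, and at
another clean point if not. -/
theorem exists_goodLeftEnd {M : MazeData m} {P : Params} {S : ScaleParams}
    {ord : Listing} {x : Seq m} {A B : ℤ} (hC : M.Conditions P) (hS : Scale P S) (hx : IsWalk x)
    (hI : M.HopInterval S ord x A B) {u' : ℤ} (hA : A + 9 * S.Δ ≤ u') (hB : u' + 9 * S.Δ ≤ B) :
    ∃ u : ℤ, u < u' ∧ (u' : ℝ) ≤ u + 2 * S.Δ ∧ M.GoodLeftEnd S x A B u := by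
  have h10 := hS.ten_le
  have hg := hS.g_ge
  have hf := hS.f_ge
  have hA0 : (0 : ℝ) ≤ A := by exact_mod_cast hI.nonneg
  have tri := fun {D₁ D₂} h₁ h₂ => domWalls_trichotomy (D₁ := D₁) (D₂ := D₂) hC hS hx hI h₁ h₂
  have hlt : ∀ D : WallValue, (D.left : ℝ) < D.right := fun D => by exact_mod_cast D.lt
  have hsize : ∀ D ∈ M.domWalls S x A B, (D.right : ℝ) - D.left ≤ S.Δ := fun D hD => by
    rw [hS.Δ_eq]; exact hC.wall_size x hx D hD.1.1.1
  by_cases ha : ∃ D ∈ M.domWalls S x A B, (u' : ℝ) ≤ D.left + 2 * S.Δ ∧ D.left < u'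
  · obtain ⟨D, hD, h1, h2⟩ := ha
    have h2' : (D.left : ℝ) < u' := by exact_mod_cast h2
    have hsep : ∀ D' ∈ M.domWalls S x A B,
        (D'.right : ℝ) ≤ D.left - 3 * S.Δ ∨ (D.left : ℝ) ≤ D'.left := by
      intro D' hD'
      have := hlt D
      rcases tri hD hD' with h | h | h
      · rw [h.1]; exact Or.inr le_rfl
      · right; linarith
      · left; linarith
    obtain ⟨a, ha1, ha2, hac⟩ := exists_clean hC hS hx hI (s := D.left - 3 * S.Δ) (by linarith)
      (by linarith) (fun D' hD' => (hsep D' hD').imp_right fun h => by linarith)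
    refine ⟨D.left, h2, h1, Or.inl ⟨a, ?_, ?_, by linarith, ?_⟩, Or.inr ⟨D, hD, rfl⟩, ?_⟩
    · exact_mod_cast (by push_cast; linarith : (((-1 : ℤ)) : ℝ) ≤ a)
    · exact_mod_cast (by linarith : (a : ℝ) ≤ D.left)
    · refine externalHop_of_domWalls hC hS hx hI (by linarith) (by linarith)
        (by exact_mod_cast (by linarith : (a : ℝ) ≤ D.left)) hac.2
        (domWalls_leftClean hC hS hx hI hD)
        fun D' hD' => (hsep D' hD').imp_left fun h => by linarith
    · intro D' hD'
      have := hlt D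
      rcases tri hD hD' with h | h | h
      · rw [h.1]; exact Or.inr (Or.inl rfl)
      · right; right; linarith
      · left; linarith
  by_cases hb : ∃ D ∈ M.domWalls S x A B, (u' : ℝ) ≤ D.right + 2 * S.Δ ∧ D.right < u'
  · obtain ⟨D, hD, h1, h2⟩ := hb
    refine ⟨D.right, h2, h1, Or.inr ⟨D, hD.1.1.1, rfl⟩,
      Or.inl (domWalls_rightClean hC hS hx hD), ?_⟩
    intro D' hD'
    have := hlt D
    rcases tri hD hD' with h | h | h
    · rw [h.2]; exact Or.inl le_rfl
    · right; right; linarith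
    · left; linarith [hlt D]
  push Not at ha hb
  have hdich : ∀ D ∈ M.domWalls S x A B, (D.right : ℝ) + 2 * S.Δ < u' ∨ (u' : ℝ) ≤ D.left := by
    intro D hD
    by_contra! hcon
    have h2 : (D.left : ℝ) + 2 * S.Δ < u' := by
      by_contra! h
      have := ha D hD h
      have : (u' : ℝ) ≤ D.left := by exact_mod_cast this
      linarith
    have := hsize D hD
    have h3 := hb D hD hcon.1
    have : (u' : ℝ) ≤ D.right := by exact_mod_cast h3
    linarith
  by_cases hc : ∃ D ∈ M.domWalls S x A B, (u' : ℝ) ≤ D.right + 5 * S.Δ ∧ D.right < u'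
  · obtain ⟨D, hD, h1, h2⟩ := hc
    have h2' : (D.right : ℝ) < u' := by exact_mod_cast h2
    have hDu : (D.right : ℝ) + 2 * S.Δ < u' := by
      rcases hdich D hD with h | h
      · exact h
      · linarith [hlt D]
    -- The clean point is chosen at a distance between `Δ` and `2Δ` from the larger of the wall's
    -- end `D.right` and `u' - 3Δ`.
    obtain ⟨c, hc⟩ : ∃ c : ℝ, c = max ((D.right : ℝ) + S.Δ) (u' - 2 * S.Δ) := ⟨_, rfl⟩
    have hc1 : (D.right : ℝ) + S.Δ ≤ c := hc ▸ le_max_left _ _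
    have hc2 : u' - 2 * S.Δ ≤ c := hc ▸ le_max_right _ _
    have hc3 : c < u' - S.Δ := by rw [hc, max_lt_iff]; constructor <;> linarith
    have hsep : ∀ D' ∈ M.domWalls S x A B,
        (D'.right : ℝ) ≤ D.right ∨ (u' : ℝ) + 2 * S.Δ ≤ D'.left := by
      intro D' hD'
      rcases tri hD hD' with h | h | h
      · rw [h.2]; exact Or.inl le_rfl
      · right; linarith
      · left; linarith [hlt D]
    obtain ⟨u, hu1, hu2, huc⟩ := exists_clean hC hS hx hI (s := c - S.Δ) (by linarith)
      (by linarith) (fun D' hD' => (hsep D' hD').imp (fun h => by linarith) fun h => by linarith)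
    have hDA : (A : ℝ) + S.Δ ≤ D.right := by linarith
    refine ⟨u, ?_, by linarith, Or.inl ⟨D.right, ?_, ?_, by linarith, ?_⟩, Or.inl huc.2, ?_⟩
    · exact_mod_cast (by linarith : (u : ℝ) < u')
    · have := D.lt; have := D.neg_one_le; omega
    · exact_mod_cast (by linarith : (D.right : ℝ) ≤ u)
    · exact externalHop_of_domWalls hC hS hx hI hDA (by linarith)
        (by exact_mod_cast (by linarith : (D.right : ℝ) ≤ u))
        (domWalls_rightClean hC hS hx hD) huc.1
        fun D' hD' => (hsep D' hD').imp_right fun h => by linarith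
    · intro D' hD'
      rcases hsep D' hD' with h | h
      · left; linarith
      · right; right; linarith
  · push Not at hc
    have hsep : ∀ D ∈ M.domWalls S x A B, (D.right : ℝ) + 5 * S.Δ < u' ∨ (u' : ℝ) ≤ D.left := by
      intro D hD
      rcases hdich D hD with h | h
      · left
        by_contra! h'
        have : (u' : ℝ) ≤ D.right := by exact_mod_cast hc D hD h'
        linarith
      · exact Or.inr h
    obtain ⟨u, hu1, hu2, huc⟩ := exists_clean hC hS hx hI (s := u' - 3 * S.Δ) (by linarith)
      (by linarith) (fun D' hD' => (hsep D' hD').imp (fun h => by linarith) fun h => by linarith)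
    obtain ⟨a, ha1, ha2, hac⟩ := exists_clean hC hS hx hI (s := u' - 5 * S.Δ) (by linarith)
      (by linarith) (fun D' hD' => (hsep D' hD').imp (fun h => by linarith) fun h => by linarith)
    refine ⟨u, ?_, by linarith, Or.inl ⟨a, ?_, ?_, by linarith, ?_⟩, Or.inl huc.2, ?_⟩
    · exact_mod_cast (by linarith : (u : ℝ) < u')
    · exact_mod_cast (by push_cast; linarith : (((-1 : ℤ)) : ℝ) ≤ a)
    · exact_mod_cast (by linarith : (a : ℝ) ≤ u)
    · exact externalHop_of_domWalls hC hS hx hI (by linarith) (by linarith)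
        (by exact_mod_cast (by linarith : (a : ℝ) ≤ u)) hac.2 huc.1
        fun D' hD' => (hsep D' hD').imp (fun h => by linarith) fun h => by linarith
    · intro D' hD'
      rcases hsep D' hD' with h | h
      · left; linarith
      · right; right; linarith

/-- The counterpart of `exists_goodLeftEnd` for right ends; here `v'` need not be an integer. -/
theorem exists_goodRightEnd {M : MazeData m} {P : Params} {S : ScaleParams}
    {ord : Listing} {x : Seq m} {A B : ℤ} (hC : M.Conditions P) (hS : Scale P S) (hx : IsWalk x)
    (hI : M.HopInterval S ord x A B) {v' : ℝ} (hA : A + 9 * S.Δ ≤ v') (hB : v' + 9 * S.Δ ≤ B) :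
    ∃ v : ℤ, v' ≤ v ∧ (v : ℝ) < v' + 2 * S.Δ ∧ M.GoodRightEnd S x A B v := by
  have h10 := hS.ten_le
  have hg := hS.g_ge
  have hf := hS.f_ge
  have hA0 : (0 : ℝ) ≤ A := by exact_mod_cast hI.nonneg
  have tri := fun {D₁ D₂} h₁ h₂ => domWalls_trichotomy (D₁ := D₁) (D₂ := D₂) hC hS hx hI h₁ h₂
  have hlt : ∀ D : WallValue, (D.left : ℝ) < D.right := fun D => by exact_mod_cast D.lt
  have hsize : ∀ D ∈ M.domWalls S x A B, (D.right : ℝ) - D.left ≤ S.Δ := fun D hD => by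
    rw [hS.Δ_eq]; exact hC.wall_size x hx D hD.1.1.1
  by_cases ha : ∃ D ∈ M.domWalls S x A B, v' ≤ D.right ∧ (D.right : ℝ) < v' + 2 * S.Δ
  · obtain ⟨D, hD, h1, h2⟩ := ha
    have hsep : ∀ D' ∈ M.domWalls S x A B,
        (D'.right : ℝ) ≤ D.right ∨ (D.right : ℝ) + 3 * S.Δ ≤ D'.left := by
      intro D' hD'
      rcases tri hD hD' with h | h | h
      · rw [h.2]; exact Or.inl le_rfl
      · right; linarith
      · left; linarith [hlt D]
    obtain ⟨b, hb1, hb2, hbc⟩ := exists_clean hC hS hx hI (s := D.right) (by linarith)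
      (by linarith) hsep
    refine ⟨D.right, h1, h2, Or.inl ⟨b, ?_, by linarith, ?_⟩, Or.inr ⟨D, hD, rfl⟩, ?_⟩
    · exact_mod_cast (by linarith : (D.right : ℝ) ≤ b)
    · exact externalHop_of_domWalls hC hS hx hI (by linarith) (by linarith)
        (by exact_mod_cast (by linarith : (D.right : ℝ) ≤ b)) (domWalls_rightClean hC hS hx hD)
        hbc.1 fun D' hD' => (hsep D' hD').imp_right fun h => by linarith
    · intro D' hD'
      rcases tri hD hD' with h | h | h
      · rw [h.2]; exact Or.inr (Or.inl rfl)
      · left; linarith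
      · right; right; linarith [hlt D]
  by_cases hb : ∃ D ∈ M.domWalls S x A B, v' ≤ D.left ∧ (D.left : ℝ) < v' + 2 * S.Δ
  · obtain ⟨D, hD, h1, h2⟩ := hb
    refine ⟨D.left, h1, h2, Or.inr ⟨D, hD.1.1.1, rfl⟩,
      Or.inl (domWalls_leftClean hC hS hx hI hD), ?_⟩
    intro D' hD'
    rcases tri hD hD' with h | h | h
    · rw [h.1]; exact Or.inl le_rfl
    · left; linarith [hlt D]
    · right; right; linarith
  push Not at ha hb
  have hdich : ∀ D ∈ M.domWalls S x A B, (D.right : ℝ) < v' ∨ v' + 2 * S.Δ ≤ D.left := by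
    intro D hD
    by_contra! hcon
    have h1 := ha D hD hcon.1
    have h2 := hsize D hD
    linarith [hb D hD (by linarith)]
  -- An integer below `v'` is at most `⌈v'⌉ - 1`.
  have hk1 : v' ≤ ⌈v'⌉ := Int.le_ceil v'
  have hk2 : (⌈v'⌉ : ℝ) < v' + 1 := Int.ceil_lt_add_one v'
  have hk : ∀ z : ℤ, (z : ℝ) < v' → (z : ℝ) ≤ ⌈v'⌉ - 1 := by
    intro z hz
    have : z < ⌈v'⌉ := by exact_mod_cast hz.trans_le hk1
    exact_mod_cast (by omega : z ≤ ⌈v'⌉ - 1)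
  by_cases hc : ∃ D ∈ M.domWalls S x A B, v' ≤ D.left ∧ (D.left : ℝ) < v' + 5 * S.Δ
  · obtain ⟨D, hD, h1, h2⟩ := hc
    have hDv : v' + 2 * S.Δ ≤ D.left := by
      rcases hdich D hD with h | h
      · linarith [hlt D]
      · exact h
    obtain ⟨c, hc⟩ : ∃ c : ℝ, c = min ((D.left : ℝ) - 3 * S.Δ) (⌈v'⌉ - 1) := ⟨_, rfl⟩
    have hc1 : c ≤ (D.left : ℝ) - 3 * S.Δ := hc ▸ min_le_left _ _
    have hc2 : c ≤ ⌈v'⌉ - 1 := hc ▸ min_le_right _ _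
    have hc3 : v' - S.Δ ≤ c := by rw [hc, le_min_iff]; constructor <;> linarith
    have hsep : ∀ D' ∈ M.domWalls S x A B,
        (D'.right : ℝ) ≤ v' - 2 * S.Δ ∨ (D.left : ℝ) ≤ D'.left := by
      intro D' hD'
      rcases tri hD hD' with h | h | h
      · rw [h.1]; exact Or.inr le_rfl
      · right; linarith [hlt D]
      · left; linarith
    obtain ⟨v, hv1, hv2, hvc⟩ := exists_clean hC hS hx hI (s := c) (by linarith)
      (by linarith) (fun D' hD' => (hsep D' hD').imp (fun h => by linarith) fun h => by linarith)
    refine ⟨v, by linarith, by linarith, Or.inl ⟨D.left, ?_, by linarith, ?_⟩, Or.inl hvc.1, ?_⟩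
    · exact_mod_cast (by linarith : (v : ℝ) ≤ D.left)
    · exact externalHop_of_domWalls hC hS hx hI (by linarith) (by linarith)
        (by exact_mod_cast (by linarith : (v : ℝ) ≤ D.left)) hvc.2
        (domWalls_leftClean hC hS hx hI hD)
        fun D' hD' => (hsep D' hD').imp_left fun h => by linarith
    · intro D' hD'
      rcases hsep D' hD' with h | h
      · right; right; linarith
      · left; linarith
  · push Not at hc
    have hsep : ∀ D ∈ M.domWalls S x A B,
        (D.right : ℝ) ≤ ⌈v'⌉ - 1 ∨ v' + 5 * S.Δ ≤ D.left := by
      intro D hD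
      rcases hdich D hD with h | h
      · exact Or.inl (hk _ h)
      · exact Or.inr (hc D hD (by linarith))
    obtain ⟨v, hv1, hv2, hvc⟩ := exists_clean hC hS hx hI (s := ⌈v'⌉ - 1) (by linarith)
      (by linarith) (fun D' hD' => (hsep D' hD').imp (fun h => by linarith) fun h => by linarith)
    obtain ⟨b, hb1, hb2, hbc⟩ := exists_clean hC hS hx hI (s := v' + 2 * S.Δ) (by linarith)
      (by linarith) (fun D' hD' => (hsep D' hD').imp (fun h => by linarith) fun h => by linarith)
    refine ⟨v, by linarith, by linarith, Or.inl ⟨b, ?_, by linarith, ?_⟩, Or.inl hvc.1, ?_⟩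
    · exact_mod_cast (by linarith : (v : ℝ) ≤ b)
    · exact externalHop_of_domWalls hC hS hx hI (by linarith) (by linarith)
        (by exact_mod_cast (by linarith : (v : ℝ) ≤ b)) hvc.2 hbc.1
        fun D' hD' => (hsep D' hD').imp (fun h => by linarith) fun h => by linarith
    · intro D' hD'
      rcases hsep D' hD' with h | h
      · right; right; linarith
      · left; linarith

end MazeData

theorem greedyUpTo_mono {C : Set (ℤ × ℤ)} {ord : (ℤ × ℤ) ↪ ℕ} {D : Set (ℤ × ℤ)} (n : ℕ) :
    D ⊆ greedyUpTo C ord D n := by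
  induction n with
  | zero => exact subset_rfl
  | succ n ih => exact ih.trans Set.subset_union_left

theorem subset_greedy {C : Set (ℤ × ℤ)} {ord : (ℤ × ℤ) ↪ ℕ} {D : Set (ℤ × ℤ)} :
    D ⊆ greedy C ord D :=
  (greedyUpTo_mono 0).trans (Set.subset_iUnion _ 0)

theorem greedy_subset {C : Set (ℤ × ℤ)} {ord : (ℤ × ℤ) ↪ ℕ} {D : Set (ℤ × ℤ)} :
    greedy C ord D ⊆ C ∪ D := by
  refine Set.iUnion_subset fun n => ?_
  induction n with
  | zero => exact Set.subset_union_right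
  | succ n ih => exact Set.union_subset ih fun I hI => Or.inl hI.1

/-- The greedy choice is maximal: every candidate meets a chosen interval. -/
theorem exists_mem_greedy {C : Set (ℤ × ℤ)} {ord : (ℤ × ℤ) ↪ ℕ} {D : Set (ℤ × ℤ)} {I : ℤ × ℤ}
    (hI : I ∈ C) (hlt : I.1 < I.2) :
    ∃ J ∈ greedy C ord D, ¬ Disjoint (Set.Ioc I.1 I.2) (Set.Ioc J.1 J.2) := by
  by_cases h : ∀ J ∈ greedyUpTo C ord D (ord I), Disjoint (Set.Ioc I.1 I.2) (Set.Ioc J.1 J.2)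
  · refine ⟨I, Set.mem_iUnion.2 ⟨ord I + 1, Or.inr ⟨hI, rfl, h⟩⟩, ?_⟩
    rw [disjoint_self]
    exact (Set.nonempty_Ioc.2 hlt).ne_empty
  · push Not at h
    obtain ⟨J, hJ, hJ'⟩ := h
    exact ⟨J, Set.mem_iUnion.2 ⟨_, hJ⟩, hJ'⟩

theorem Scale.le_bigLen {P : Params} {S : ScaleParams} (hS : Scale P S) (j : EType) :
    28 * S.Δ ≤ S.bigLen j := by
  have h10 := hS.ten_le
  have hg := hS.g_ge
  cases j <;> simp only [ScaleParams.bigLen, ScaleParams.len] <;> linarith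

theorem Scale.bigLen_le {P : Params} {S : ScaleParams} (hS : Scale P S) (j : EType) :
    S.bigLen j ≤ 9 * S.g := by
  have h10 := hS.ten_le
  have hg := hS.g_ge
  cases j <;> simp only [ScaleParams.bigLen, ScaleParams.len] <;> linarith

namespace MazeData

variable {m : ℕ} [m.AtLeastTwo]

/-- Every pre-wall of type `j` meets a designated one that is not longer than type `j` allows; this
is why the types are processed in the order of increasing length. -/
theorem exists_mem_designated {M : MazeData m} {P : Params} {S : ScaleParams} (hS : Scale P S)
    {ord : Listing} {x : Seq m} {j : EType} {u v : ℤ} (h : M.PreWall S j x u v) :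
    ∃ J ∈ M.designated S ord x, ¬ Disjoint (Set.Ioc u v) (Set.Ioc J.1 J.2) ∧
      ∃ i, M.EmergingBarrier S i x J.1 J.2 ∧ S.bigLen i ≤ S.bigLen j := by
  have h10 := hS.ten_le
  have hg := hS.g_ge
  have hlt := h.1.2.1
  cases j with
  | one =>
    obtain ⟨J, hJ, hd⟩ := exists_mem_greedy (C := {I | M.PreWall S .one x I.1 I.2})
      (ord := ord .one) (D := ∅) (I := (u, v)) h hlt
    refine ⟨J, subset_greedy (subset_greedy hJ), hd, .one, ?_, le_rfl⟩
    rcases greedy_subset hJ with h | h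
    · exact h.1
    · exact h.elim
  | three =>
    obtain ⟨J, hJ, hd⟩ := exists_mem_greedy (C := {I | M.PreWall S .three x I.1 I.2})
      (ord := ord .three) (D := greedy {I | M.PreWall S .one x I.1 I.2} (ord .one) ∅)
      (I := (u, v)) h hlt
    refine ⟨J, subset_greedy hJ, hd, ?_⟩
    rcases greedy_subset hJ with h | h
    · exact ⟨.three, h.1, le_rfl⟩
    rcases greedy_subset h with h | h
    · exact ⟨.one, h.1, by simp only [ScaleParams.bigLen, ScaleParams.len]; linarith⟩
    · exact h.elim
  | two =>
    obtain ⟨J, hJ, hd⟩ := exists_mem_greedy (C := {I | M.PreWall S .two x I.1 I.2})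
      (ord := ord .two) (D := greedy {I | M.PreWall S .three x I.1 I.2} (ord .three)
        (greedy {I | M.PreWall S .one x I.1 I.2} (ord .one) ∅)) (I := (u, v)) h hlt
    refine ⟨J, hJ, hd, ?_⟩
    rcases greedy_subset hJ with h | h
    · exact ⟨.two, h.1, le_rfl⟩
    rcases greedy_subset h with h | h
    · exact ⟨.three, h.1, by simp only [ScaleParams.bigLen, ScaleParams.len]; linarith⟩
    rcases greedy_subset h with h | h
    · exact ⟨.one, h.1, by simp only [ScaleParams.bigLen, ScaleParams.len]; linarith⟩
    · exact h.elim

/-- In a hop of the scaled-up structure no emerging wall is present, hence the bad events over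
subintervals away from its ends have small conditional probabilities. -/
theorem HopInterval.lawGiven_le {M : MazeData m} {P : Params} {S : ScaleParams}
    {ord : Listing} {x : Seq m} {A B : ℤ} (hC : M.Conditions P) (hS : Scale P S) (hx : IsWalk x)
    (hI : M.HopInterval S ord x A B) {j : EType} {a : ℤ}
    (ha : A + S.bigLen j + 10 * S.Δ ≤ a) (hb : a + S.bigLen j + S.bigLen j + 10 * S.Δ ≤ B)
    {b : ℤ} (hb0 : 0 ≤ b) (s : Fin m) :
    lawGiven m (b - 1) s {y | M.BadEvent S j x y a b} ≤ ENNReal.ofReal (S.w ^ 2) := by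
  by_contra! hcon
  have h10 := hS.ten_le
  have hg := hS.g_ge
  have hf := hS.f_ge
  have hL := hS.le_bigLen j
  have hL' := hS.bigLen_le j
  have hA0 : (0 : ℝ) ≤ A := by exact_mod_cast hI.nonneg
  have tri := fun {D₁ D₂} h₁ h₂ => domWalls_trichotomy (D₁ := D₁) (D₂ := D₂) hC hS hx hI h₁ h₂
  have hlt : ∀ D : WallValue, (D.left : ℝ) < D.right := fun D => by exact_mod_cast D.lt
  have hsize : ∀ D ∈ M.domWalls S x A B, (D.right : ℝ) - D.left ≤ S.Δ := fun D hD => by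
    rw [hS.Δ_eq]; exact hC.wall_size x hx D hD.1.1.1
  obtain ⟨u, hu1, hu2, hu⟩ := exists_goodLeftEnd hC hS hx hI (u' := a) (by linarith) (by linarith)
  obtain ⟨v, hv1, hv2, hv⟩ := exists_goodRightEnd hC hS hx hI (v' := a + S.bigLen j)
    (by linarith) (by linarith)
  have hu1' : (u : ℝ) < a := by exact_mod_cast hu1
  have huv : u < v := by exact_mod_cast (by linarith : (u : ℝ) < v)
  have hAu : A ≤ u := by exact_mod_cast (by linarith : (A : ℝ) ≤ u)
  have hA := hI.nonneg
  have hEB : M.EmergingBarrier S j x u v :=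
    ⟨by omega, huv, a, hu1, hu2, by linarith, hv1, b, hb0, s, hcon⟩
  -- At most one dominant wall is near `(u, v]`.
  have huniq : ∀ D ∈ M.domWalls S x A B, ∀ D' ∈ M.domWalls S x A B,
      (u : ℝ) ≤ D.right → (D.left : ℝ) ≤ v → (u : ℝ) ≤ D'.right → (D'.left : ℝ) ≤ v →
      D.left = D'.left ∧ D.right = D'.right := by
    intro D hD D' hD' h1 h2 h3 h4
    rcases tri hD hD' with h | h | h
    · exact h
    · linarith
    · linarith
  have hpos : (M.ExternalHop .X x u v ∨
      ∃ E, M.DominantLight S x E ∧ E.ContainedIn u v ∧ ¬ (u = E.left ∧ E.right = v) ∧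
      (u = E.left ∨ (S.Δ ≤ (E.left : ℝ) - u ∧ M.ExternalHop .X x u E.left)) ∧
      (E.right = v ∨ (S.Δ ≤ (v : ℝ) - E.right ∧ M.ExternalHop .X x E.right v))) := by
    by_cases hD : ∃ D ∈ M.domWalls S x A B, (u : ℝ) < D.right ∧ (D.left : ℝ) < v
    · obtain ⟨D, hD, hD1, hD2⟩ := hD
      have h1 := hu.apart D hD
      have h2 := hv.apart D hD
      have h3 := hlt D
      have h4 := hsize D hD
      have huD : (u : ℝ) ≤ D.left := by
        rcases h1 with h | h | h <;> linarith
      have hDv : (D.right : ℝ) ≤ v := by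
        rcases h2 with h | h | h <;> linarith
      refine Or.inr ⟨D, hD.1, ⟨by exact_mod_cast huD, by exact_mod_cast hDv⟩, ?_, ?_, ?_⟩
      · rintro ⟨h5, h6⟩
        rw [← h5, h6] at h4
        linarith
      · rcases h1 with h | h | h
        · linarith
        · left; exact_mod_cast h.symm
        · refine Or.inr ⟨by linarith, externalHop_of_domWalls hC hS hx hI (by linarith)
            (by linarith) (by exact_mod_cast huD) ?_ (domWalls_leftClean hC hS hx hI hD) ?_⟩
          · rcases hu.clean with hc | ⟨D', hD', hc⟩
            · exact hc
            · exfalso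
              have hc' : (D'.left : ℝ) = u := by exact_mod_cast hc
              have := hlt D'
              have h7 : (D.left : ℝ) = D'.left := by
                exact_mod_cast (huniq D hD D' hD' hD1.le hD2.le (by linarith) (by linarith)).1
              linarith
          · intro D' hD'
            by_contra! hcon'
            have h7 : (D.left : ℝ) = D'.left := by
              exact_mod_cast
                (huniq D hD D' hD' hD1.le hD2.le hcon'.1.le (by linarith)).1
            linarith
      · rcases h2 with h | h | h
        · linarith
        · left; exact_mod_cast h
        · refine Or.inr ⟨by linarith, externalHop_of_domWalls hC hS hx hI (by linarith)
            (by linarith) (by exact_mod_cast hDv) (domWalls_rightClean hC hS hx hD) ?_ ?_⟩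
          · rcases hv.clean with hc | ⟨D', hD', hc⟩
            · exact hc
            · exfalso
              have hc' : (D'.right : ℝ) = v := by exact_mod_cast hc
              have := hlt D'
              have h7 : (D.right : ℝ) = D'.right := by
                exact_mod_cast (huniq D hD D' hD' hD1.le hD2.le (by linarith) (by linarith)).2
              linarith
          · intro D' hD'
            by_contra! hcon'
            have h7 : (D.right : ℝ) = D'.right := by
              exact_mod_cast
                (huniq D hD D' hD' hD1.le hD2.le (by linarith) hcon'.2.le).2
            linarith
    · push Not at hD
      have hnear : ∀ D ∈ M.domWalls S x A B, (D.right : ℝ) ≤ u ∨ (v : ℝ) ≤ D.left := by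
        intro D hD'
        by_contra! h
        linarith [hD D hD' h.1]
      refine Or.inl (externalHop_of_domWalls hC hS hx hI (by linarith) (by linarith) huv.le ?_ ?_
        hnear)
      · rcases hu.clean with hc | ⟨D, hD', hc⟩
        · exact hc
        · exfalso
          have hc' : (D.left : ℝ) = u := by exact_mod_cast hc
          have := hlt D
          have : (u : ℝ) < v := by exact_mod_cast huv
          rcases hnear D hD' with h | h <;> linarith
      · rcases hv.clean with hc | ⟨D, hD', hc⟩
        · exact hc
        · exfalso
          have hc' : (D.right : ℝ) = v := by exact_mod_cast hc
          have := hlt D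
          have : (u : ℝ) < v := by exact_mod_cast huv
          rcases hnear D hD' with h | h <;> linarith
  -- The designated pre-wall met by this one is a wall of the scaled-up structure.
  obtain ⟨J, hJ, hmeet, i, hJi, hij⟩ := exists_mem_designated (ord := ord) hS
    (show M.PreWall S j x u v from ⟨hEB, hpos, hu.adjacent, hv.adjacent⟩)
  obtain ⟨hJ1, hJ2, u₂, hu₂, hu₂', hv₂, hv₂', -⟩ := hJi
  rw [Set.Ioc_disjoint_Ioc, not_le, max_lt_iff, lt_min_iff, lt_min_iff] at hmeet
  have hu₂r : (J.1 : ℝ) < u₂ := by exact_mod_cast hu₂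
  have hL₂ := hS.le_bigLen i
  have m1 : (u : ℝ) < J.2 := by exact_mod_cast hmeet.1.2
  have m2 : (J.1 : ℝ) < v := by exact_mod_cast hmeet.2.1
  refine hI.no_newWall ⟨J.1, J.2, S.Rhat, hJ1, hJ2⟩ ⟨Or.inl (Or.inl (Or.inr ⟨rfl, hJ⟩)),
    hS.rank_emerging, ?_⟩ ⟨?_, ?_⟩
  · rintro ⟨D, hD, hDl, hDr⟩
    have h1 : (D.left : ℝ) ≤ J.1 := by exact_mod_cast hDl
    have h2 : (J.2 : ℝ) ≤ D.right := by exact_mod_cast hDr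
    have h3 := hC.wall_size x hx D hD.1.1
    rw [← hS.Δ_eq] at h3
    linarith
  · exact_mod_cast (by linarith : (A : ℝ) ≤ J.1)
  · exact_mod_cast (by linarith : (J.2 : ℝ) ≤ B)

end MazeData

/-! ### Exchanging the axes -/

theorem Kind.swap_swap (k : Kind) : k.swap.swap = k := by cases k <;> rfl

theorem Step.swap {m : ℕ} {x y : Seq m} {p q : ℤ × ℤ} (h : Step x y p q) :
    Step y x p.swap q.swap := by
  obtain ⟨h1, h2, h3, h4⟩ := h
  refine ⟨h2, h1, ?_, h4.symm⟩
  rcases h3 with rfl | rfl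
  · exact Or.inr rfl
  · exact Or.inl rfl

theorem Reach.swap {m : ℕ} {x y : Seq m} {p q : ℤ × ℤ} (h : Reach x y p q) :
    Reach y x p.swap q.swap :=
  Relation.ReflTransGen.lift Prod.swap (fun _ _ => Step.swap) p q h

theorem ReachIn.reach {m : ℕ} {x y : Seq m} {A : Set (ℤ × ℤ)} {p q : ℤ × ℤ}
    (h : ReachIn x y A p q) : Reach x y p q :=
  Relation.ReflTransGen.mono (fun _ _ h => h.1) p q h

theorem mem_rectSet_swap {k : Kind} {u v : ℤ × ℤ} {p : ℝ × ℝ} :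
    p ∈ rectSet k.swap u.swap v.swap ↔ p.swap ∈ rectSet k u v := by
  cases k <;> simp [rectSet, Kind.swap] <;> tauto

theorem Trap.mem_toSet_swap {t : Trap} {p : ℝ × ℝ} : p ∈ t.swap.toSet ↔ p.swap ∈ t.toSet := by
  simp [Trap.toSet, Trap.swap, and_comm]

theorem Trap.swap_subset {t : Trap} {k : Kind} {u v : ℤ × ℤ} :
    t.swap.toSet ⊆ rectSet k.swap u.swap v.swap ↔ t.toSet ⊆ rectSet k u v := by
  constructor
  · intro h p hp
    have := h (Trap.mem_toSet_swap.2 (show p.swap.swap ∈ t.toSet by simpa using hp))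
    simpa using mem_rectSet_swap.1 this
  · intro h p hp
    exact mem_rectSet_swap.2 (h (Trap.mem_toSet_swap.1 hp))

theorem Trap.subset_swap {t : Trap} {k : Kind} {u v : ℤ × ℤ} :
    t.toSet ⊆ rectSet k.swap u.swap v.swap ↔ t.swap.toSet ⊆ rectSet k u v :=
  Trap.swap_subset (t := t.swap)

/-- The corners of a trap contained in a rectangle. -/
theorem Trap.bounds {t : Trap} {k : Kind} {u v : ℤ × ℤ} (h : t.toSet ⊆ rectSet k u v) :
    (u.1 : ℝ) ≤ t.a₀ ∧ t.b₀ ≤ v.1 ∧ (u.2 : ℝ) ≤ t.a₁ ∧ t.b₁ ≤ v.2 := by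
  have h1 : ((t.a₀ : ℝ), (t.a₁ : ℝ)) ∈ rectSet k u v := h ⟨⟨le_rfl, t.le₀⟩, ⟨le_rfl, t.le₁⟩⟩
  have h2 : (t.b₀, t.b₁) ∈ rectSet k u v := h ⟨⟨t.le₀, le_rfl⟩, ⟨t.le₁, le_rfl⟩⟩
  cases k <;> simp only [rectSet, Set.mem_prod, Set.mem_Icc, Set.mem_Ioc] at h1 h2
  · exact ⟨h1.1.1, h2.1.2, h1.2.1, h2.2.2⟩
  · exact ⟨h1.1.1.le, h2.1.2, h1.2.1, h2.2.2⟩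
  · exact ⟨h1.1.1, h2.1.2, h1.2.1.le, h2.2.2⟩

theorem Trap.subset_rectSet {t : Trap} {k : Kind} {u v : ℤ × ℤ} (h0 : (u.1 : ℝ) < t.a₀)
    (h1 : t.b₀ ≤ v.1) (h2 : (u.2 : ℝ) < t.a₁) (h3 : t.b₁ ≤ v.2) : t.toSet ⊆ rectSet k u v := by
  rintro p ⟨⟨p1, p2⟩, ⟨p3, p4⟩⟩
  cases k
  · exact ⟨⟨h0.le.trans p1, p2.trans h1⟩, ⟨h2.le.trans p3, p4.trans h3⟩⟩
  · exact ⟨⟨h0.trans_le p1, p2.trans h1⟩, ⟨h2.le.trans p3, p4.trans h3⟩⟩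
  · exact ⟨⟨h0.le.trans p1, p2.trans h1⟩, ⟨h2.trans_le p3, p4.trans h3⟩⟩

theorem rectSet_mono_right {k : Kind} {u v v' : ℤ × ℤ} (h0 : v'.1 ≤ v.1) (h1 : v'.2 ≤ v.2) :
    rectSet k u v' ⊆ rectSet k u v := by
  have h0' : (v'.1 : ℝ) ≤ v.1 := by exact_mod_cast h0
  have h1' : (v'.2 : ℝ) ≤ v.2 := by exact_mod_cast h1
  cases k <;> rintro p ⟨⟨p1, p2⟩, ⟨p3, p4⟩⟩ <;>
    exact ⟨⟨p1, p2.trans h0'⟩, ⟨p3, p4.trans h1'⟩⟩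

/-- A rectangle of any kind lies in every rectangle starting strictly to its lower left. -/
theorem rectSet_subset_of_lt {k k' : Kind} {u u' v v' : ℤ × ℤ} (h0 : u.1 < u'.1) (h1 : u.2 < u'.2)
    (h2 : v'.1 ≤ v.1) (h3 : v'.2 ≤ v.2) : rectSet k' u' v' ⊆ rectSet k u v := by
  have h0' : (u.1 : ℝ) < u'.1 := by exact_mod_cast h0
  have h1' : (u.2 : ℝ) < u'.2 := by exact_mod_cast h1
  have h2' : (v'.1 : ℝ) ≤ v.1 := by exact_mod_cast h2
  have h3' : (v'.2 : ℝ) ≤ v.2 := by exact_mod_cast h3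
  intro p hp
  have q : (u'.1 : ℝ) ≤ p.1 ∧ p.1 ≤ v'.1 ∧ (u'.2 : ℝ) ≤ p.2 ∧ p.2 ≤ v'.2 := by
    cases k' <;> obtain ⟨p0, p1⟩ := hp
    exacts [⟨p0.1, p0.2, p1.1, p1.2⟩, ⟨p0.1.le, p0.2, p1.1, p1.2⟩, ⟨p0.1, p0.2, p1.1.le, p1.2⟩]
  obtain ⟨q1, q2, q3, q4⟩ := q
  cases k <;> constructor <;> constructor <;> linarith

namespace MazeData

variable {m : ℕ}

theorem swap_swap (M : MazeData m) : M.swap.swap = M := by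
  obtain ⟨t, w, b, c, s, tc⟩ := M
  simp only [swap, MazeData.mk.injEq]
  refine ⟨rfl, ?_, ?_, ?_, ?_, ?_⟩
  · funext δ; cases δ <;> rfl
  · funext δ; cases δ <;> rfl
  · funext δ; cases δ <;> rfl
  · funext δ; cases δ <;> rfl
  · funext x y u v e k; simp [Kind.swap_swap]

theorem CornerClean.swap {M : MazeData m} {x y : Seq m} {u v : ℤ × ℤ} {e : End} {k : Kind}
    (h : M.CornerClean x y u v e k) : M.swap.CornerClean y x u.swap v.swap e k.swap := by
  refine ⟨fun h1 h2 => ?_, h.2.2, h.2.1⟩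
  change M.trapClean x y u.swap.swap v.swap.swap e k.swap.swap
  rw [Kind.swap_swap]
  exact h.1 h2 h1

theorem UncorrelatedTrap.of_swap {M : MazeData m} {S : ScaleParams} {x y : Seq m} {t : Trap}
    (h : M.swap.UncorrelatedTrap S y x t) : M.UncorrelatedTrap S x y t.swap := by
  obtain ⟨t₁, h₁, t₂, h₂, hd, f0, f1, e0, e1, e2, e3⟩ := h
  exact ⟨t₁.swap, h₁, t₂.swap, h₂, ⟨hd.2, hd.1⟩, f1, f0, e1, e0, e3, e2⟩

theorem HopRect.swap {M : MazeData m} {x y : Seq m} {u v : ℤ × ℤ} {k : Kind}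
    (h : M.HopRect x y u v k) : M.swap.HopRect y x u.swap v.swap k.swap := by
  obtain ⟨h1, h2, h3, h4, h5⟩ := h
  exact ⟨h1.swap, h2.swap, fun t ht hsub => h3 t.swap ht (Trap.subset_swap.1 hsub), h5, h4⟩

theorem minslope_swap (u v : ℤ × ℤ) : minslope u.swap v.swap = minslope u v := by
  simp only [minslope, slope, Prod.fst_swap, Prod.snd_swap, one_div_div]
  exact min_comm _ _

theorem Reachability.swap {M : MazeData m} {σ : ℝ} (h : M.Reachability σ) :
    M.swap.Reachability σ := by
  refine ⟨h.1, h.2.1, fun x y hx hy u v h0 h1 h2 h3 k hs hr => ?_⟩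
  have h4 := hr.swap
  rw [swap_swap] at h4
  exact (h.2.2 y x hy hx u.swap v.swap h1 h0 h3 h2 k.swap (by rwa [minslope_swap]) h4).swap

/-! ### The situation in a hop of the scaled-up structure -/

variable [m.AtLeastTwo]

/-- The properties of the rectangle of kind `κ` from `u` to `v` that follow from its being a hop of
the scaled-up structure, as far as they concern vertical walls and horizontal traps: `𝒱` and `𝒲`
are the sets of dominant light walls contained in its two projections.  The walls of `𝒱` contain
all walls and are more than `f` apart (`sep`, which allows two walls to differ by their ranks
only). The fields `gap_short`, `gap_long` and `hole` say that the bad events of the three types do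
not occur away from the sides of the rectangle; the last fields reflect cleanness of its corners
and the absence of uncorrelated traps. -/
structure HalfSetting (M : MazeData m) (P : Params) (S : ScaleParams) (x y : Seq m)
    (u v : ℤ × ℤ) (κ : Kind) (𝒱 𝒲 : Set WallValue) : Prop where
  scale : Scale P S
  conditions : M.Conditions P
  reachability : M.Reachability P.σ
  walk : IsWalk x
  nonneg : 0 ≤ u.1
  lt : u.1 < v.1
  cover : ∀ E ∈ M.wall .X x, E.ContainedIn u.1 v.1 → ∃ D ∈ 𝒱, E.ContainedIn D.left D.right
  size : ∀ D ∈ 𝒱, (D.right : ℝ) ≤ D.left + S.Δ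
  left_far : ∀ D ∈ 𝒱, (u.1 : ℝ) + S.f / 3 ≤ D.left
  right_far : ∀ D ∈ 𝒱, (D.right : ℝ) + S.f / 3 ≤ v.1
  left_clean : ∀ D ∈ 𝒱, M.LeftClean .X x D.left
  right_clean : ∀ D ∈ 𝒱, M.RightClean .X x D.right
  sep : ∀ D ∈ 𝒱, ∀ D' ∈ 𝒱, (D.left = D'.left ∧ D.right = D'.right) ∨
    (D.left : ℝ) + S.f < D'.left ∨ (D'.left : ℝ) + S.f < D.left
  gap_short : ∀ a b : ℤ, u.1 + 38 * S.Δ ≤ a → a + 66 * S.Δ ≤ v.1 → u.2 < b → b + 5 * S.Δ ≤ v.2 →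
    ∃ s : ℝ, a ≤ s ∧ s ≤ a + 21 * S.Δ ∧ ∀ t ∈ M.trap x y,
      ¬ t.toSet ⊆ Set.Ioc s (s + 7 * S.Δ) ×ˢ Set.Icc (b : ℝ) (b + 5 * S.Δ)
  gap_long : ∀ a b : ℤ, u.1 + 9 * S.g ≤ a → a + 18 * S.g ≤ v.1 → u.2 < b → b + 5 * S.Δ ≤ v.2 →
    ∃ s : ℝ, a ≤ s ∧ s ≤ a + 6.6 * S.g ∧ ∀ t ∈ M.trap x y,
      ¬ t.toSet ⊆ Set.Ioc s (s + 2.2 * S.g) ×ˢ Set.Icc (b : ℝ) (b + 5 * S.Δ)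
  hole : ∀ W ∈ 𝒲, ∀ a : ℤ, u.1 + 2 * S.g ≤ a → a + 3 * S.g ≤ v.1 →
    ∃ a₁ a₂ : ℤ, (a : ℝ) + S.Δ ≤ a₁ ∧ a₂ + S.Δ ≤ a + S.g ∧ M.GoodHole x y W a₁ a₂
  far_lower : ∀ t ∈ M.trap x y, t.toSet ⊆ rectSet κ u v →
    (u.1 : ℝ) + S.g ≤ t.a₀ ∨ (u.2 : ℝ) + S.g ≤ t.a₁
  far_upper : ∀ t ∈ M.trap x y, t.toSet ⊆ rectSet κ u v → t.b₀ + S.g ≤ v.1 ∨ t.b₁ + S.g ≤ v.2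
  uncorrelated : ∀ t ∈ M.trap x y, ∀ t' ∈ M.trap x y, t.toSet ⊆ rectSet κ u v →
    t'.toSet ⊆ rectSet κ u v → t.DisjointProj t' →
    ¬ (|(t.a₀ : ℝ) - t'.a₀| ≤ S.f ∧ |(t.a₁ : ℝ) - t'.a₁| ≤ S.f)
  clean_lower : M.CornerClean x y u v .lower κ
  clean_upper : M.CornerClean x y u v .upper κ

/-- The properties of a hop of the scaled-up structure used to find a path, for both axes. -/
def Setting (M : MazeData m) (P : Params) (S : ScaleParams) (x y : Seq m)
    (u v : ℤ × ℤ) (κ : Kind) (𝒱 𝒲 : Set WallValue) : Prop :=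
  M.HalfSetting P S x y u v κ 𝒱 𝒲 ∧ M.swap.HalfSetting P S y x u.swap v.swap κ.swap 𝒲 𝒱

theorem Setting.swap {M : MazeData m} {P : Params} {S : ScaleParams} {x y : Seq m}
    {u v : ℤ × ℤ} {κ : Kind} {𝒱 𝒲 : Set WallValue} (h : M.Setting P S x y u v κ 𝒱 𝒲) :
    M.swap.Setting P S y x u.swap v.swap κ.swap 𝒲 𝒱 := by
  refine ⟨h.2, ?_⟩
  rw [swap_swap, Kind.swap_swap]
  exact h.1

/-- Bad events do not occur in a hop of the scaled-up structure, away from its ends: otherwise there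
would be a trap there. -/
theorem not_badEvent {M : MazeData m} {P : Params} {S : ScaleParams} {ord : Listing}
    {x y : Seq m} {u v : ℤ × ℤ} {κ : Kind} (hC : M.Conditions P) (hS : Scale P S) (hx : IsWalk x)
    (hu : 0 ≤ u.2) (hI : M.HopInterval S ord x u.1 v.1)
    (hH : ∀ t, M.HorizontalTrap S x y t → ¬ t.toSet ⊆ rectSet κ u v) {j : EType} {a b : ℤ}
    (ha : u.1 + S.bigLen j + 10 * S.Δ ≤ a) (ha' : a + S.bigLen j + S.bigLen j + 10 * S.Δ ≤ v.1)
    (hb : u.2 < b) (hb' : b + S.height j ≤ v.2) : ¬ M.BadEvent S j x y a b := by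
  intro hbad
  have h10 := hS.ten_le
  have hL := hS.le_bigLen j
  have hA0 : (0 : ℝ) ≤ u.1 := by exact_mod_cast hI.nonneg
  have hh : 0 ≤ S.height j := by cases j <;> simp only [ScaleParams.height] <;> linarith
  have ha0 : 0 ≤ a := by exact_mod_cast (by push_cast; linarith : ((0 : ℤ) : ℝ) ≤ a)
  refine hH ⟨a, b, a + S.bigLen j, b + S.height j, ha0, by omega, by linarith, by linarith⟩
    ⟨j, rfl, rfl, hbad, fun s => hI.lawGiven_le hC hS hx ha ha' (hu.trans hb.le) s⟩
    (Trap.subset_rectSet ?_ ?_ ?_ ?_)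
  · change (u.1 : ℝ) < a; linarith
  · change (a : ℝ) + S.bigLen j ≤ v.1; linarith
  · change (u.2 : ℝ) < b; exact_mod_cast hb
  · exact hb'

/-- The two sources of the properties in `HalfSetting`: a wall of `M` not contained in a dominant
light wall, or two dominant light walls near to each other, would give a wall of the scaled-up
structure, and so would a bad event of large probability; a bad event of small probability would
give a trap. -/
theorem HalfSetting.of_hop {M : MazeData m} {P : Params} {S : ScaleParams} {ord ord' : Listing}
    {x y : Seq m} {u v : ℤ × ℤ} {κ : Kind} (hC : M.Conditions P) (hC' : M.swap.Conditions P)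
    (hR : M.Reachability P.σ) (hS : Scale P S) (hx : IsWalk x) (hy : IsWalk y)
    (hI : M.HopInterval S ord x u.1 v.1) (hI' : M.swap.HopInterval S ord' y u.2 v.2)
    (hlt : u.1 < v.1)
    (hH : ∀ t, M.HorizontalTrap S x y t → ¬ t.toSet ⊆ rectSet κ u v)
    (hU : ∀ t, M.UncorrelatedTrap S x y t → ¬ t.toSet ⊆ rectSet κ u v)
    (hfl : ∀ t ∈ M.trap x y, t.toSet ⊆ rectSet κ u v →
      (u.1 : ℝ) + S.g ≤ t.a₀ ∨ (u.2 : ℝ) + S.g ≤ t.a₁)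
    (hfu : ∀ t ∈ M.trap x y, t.toSet ⊆ rectSet κ u v → t.b₀ + S.g ≤ v.1 ∨ t.b₁ + S.g ≤ v.2)
    (hcl : M.CornerClean x y u v .lower κ) (hcu : M.CornerClean x y u v .upper κ) :
    M.HalfSetting P S x y u v κ (M.domWalls S x u.1 v.1) (M.swap.domWalls S y u.2 v.2) where
  scale := hS
  conditions := hC
  reachability := hR
  walk := hx
  nonneg := hI.nonneg
  lt := hlt
  cover := fun E hE hEc => hI.exists_domWall hC hS hx hE hEc
  size := fun D hD => by
    have := hC.wall_size x hx D hD.1.1.1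
    rw [hS.Δ_eq]; linarith
  left_far := fun D hD => by linarith [hI.left_far D hD.1.1.1 hD.2]
  right_far := fun D hD => by linarith [hI.right_far D hD.1.1.1 hD.2]
  left_clean := fun D hD => domWalls_leftClean hC hS hx hI hD
  right_clean := fun D hD => domWalls_rightClean hC hS hx hD
  sep := fun D hD D' hD' => by
    have h1 : (D.left : ℝ) < D.right := by exact_mod_cast D.lt
    have h2 : (D'.left : ℝ) < D'.right := by exact_mod_cast D'.lt
    rcases domWalls_trichotomy hC hS hx hI hD hD' with h | h | h
    · exact Or.inl h
    · right; left; linarith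
    · right; right; linarith
  gap_short := fun a b h1 h2 h3 h4 => by
    by_contra! hcon
    refine not_badEvent (j := .one) hC hS hx hI'.nonneg hI hH
      (a := a) (b := b) ?_ ?_ h3 ?_ (fun s hs hs' => ?_)
    · simp only [ScaleParams.bigLen, ScaleParams.len]; linarith
    · simp only [ScaleParams.bigLen, ScaleParams.len]; linarith
    · exact h4
    · simp only [ScaleParams.bigLen, ScaleParams.len] at hs'
      exact hcon s hs (by linarith)
  gap_long := fun a b h1 h2 h3 h4 => by
    have h10 := hS.ten_le
    have hg := hS.g_ge
    by_contra! hcon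
    refine not_badEvent (j := .two) hC hS hx hI'.nonneg hI hH
      (a := a) (b := b) ?_ ?_ h3 ?_ (fun s hs hs' => ?_)
    · simp only [ScaleParams.bigLen, ScaleParams.len]; linarith
    · simp only [ScaleParams.bigLen, ScaleParams.len]; linarith
    · exact h4
    · simp only [ScaleParams.bigLen, ScaleParams.len] at hs'
      exact hcon s hs (by linarith)
  hole := fun W hW a h1 h2 => by
    have h10 := hS.ten_le
    have hg := hS.g_ge
    have hf := hS.f_ge
    by_contra! hcon
    have hl := hI'.left_far W hW.1.1.1 hW.2
    have hr := hI'.right_far W hW.1.1.1 hW.2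
    have hlt : (W.left : ℝ) < W.right := by exact_mod_cast W.lt
    have hc1 := Int.le_ceil S.Δ
    have hc2 := Int.ceil_lt_add_one S.Δ
    refine not_badEvent (j := .three) hC hS hx hI'.nonneg hI hH
      (a := a) (b := W.left - ⌈S.Δ⌉) ?_ ?_ ?_ ?_ ?_
    · simp only [ScaleParams.bigLen]; linarith
    · simp only [ScaleParams.bigLen]; linarith
    · exact_mod_cast (by push_cast; linarith : (u.2 : ℝ) < ((W.left - ⌈S.Δ⌉ : ℤ) : ℝ))
    · simp only [ScaleParams.height]; push_cast; linarith
    · refine ⟨W, by omega, hW.1.2, ⟨hC'.wall_barrier y hy hW.1.1.1, y, hy, fun _ _ => rfl,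
        hW.1.1.1⟩, ?_⟩
      rintro ⟨a₁, a₂, h3, h4, h5⟩
      exact hcon a₁ a₂ (by linarith) h4 h5
  far_lower := hfl
  far_upper := hfu
  uncorrelated := fun t ht t' ht' h1 h2 hd hf => by
    refine hU ⟨min t.a₀ t'.a₀, min t.a₁ t'.a₁, max t.b₀ t'.b₀, max t.b₁ t'.b₁,
      le_min t.nonneg₀ t'.nonneg₀, le_min t.nonneg₁ t'.nonneg₁, ?_, ?_⟩
      ⟨t, ht, t', ht', hd, hf.1, hf.2, rfl, rfl, rfl, rfl⟩ ?_
    · push_cast; exact (min_le_left _ _).trans (t.le₀.trans (le_max_left _ _))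
    · push_cast; exact (min_le_left _ _).trans (t.le₁.trans (le_max_left _ _))
    · have q1 := h1 (a := ((t.a₀ : ℝ), (t.a₁ : ℝ))) ⟨⟨le_rfl, t.le₀⟩, ⟨le_rfl, t.le₁⟩⟩
      have q2 := h2 (a := ((t'.a₀ : ℝ), (t'.a₁ : ℝ))) ⟨⟨le_rfl, t'.le₀⟩, ⟨le_rfl, t'.le₁⟩⟩
      have r1 := Trap.bounds h1
      have r2 := Trap.bounds h2
      rintro p ⟨⟨p1, p2⟩, ⟨p3, p4⟩⟩
      simp only [Int.cast_min, min_le_iff, le_max_iff] at p1 p2 p3 p4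
      cases κ <;> simp only [rectSet, Set.mem_prod, Set.mem_Icc, Set.mem_Ioc] at q1 q2 ⊢ <;>
        refine ⟨⟨?_, ?_⟩, ⟨?_, ?_⟩⟩ <;>
        first
          | (rcases p1 with p1 | p1 <;> linarith)
          | (rcases p2 with p2 | p2 <;> linarith)
          | (rcases p3 with p3 | p3 <;> linarith)
          | (rcases p4 with p4 | p4 <;> linarith)
  clean_lower := hcl
  clean_upper := hcu

end MazeData

/-! ### Hops between clean points -/

theorem le_minslope {σ : ℝ} {p q : ℤ × ℤ} (h0 : p.1 < q.1) (h1 : p.2 < q.2)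
    (h2 : σ * ((q.1 : ℝ) - p.1) ≤ (q.2 : ℝ) - p.2) (h3 : σ * ((q.2 : ℝ) - p.2) ≤ (q.1 : ℝ) - p.1) :
    σ ≤ minslope p q := by
  have h0' : (0 : ℝ) < (q.1 : ℝ) - p.1 := by
    have : (p.1 : ℝ) < q.1 := by exact_mod_cast h0
    linarith
  have h1' : (0 : ℝ) < (q.2 : ℝ) - p.2 := by
    have : (p.2 : ℝ) < q.2 := by exact_mod_cast h1
    linarith
  rw [minslope, slope, one_div_div, le_min_iff]
  exact ⟨(le_div_iff₀ h0').2 h2, (le_div_iff₀ h1').2 h3⟩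

/-- The direction `(α, β)`, of maximum norm at most one, has slope and inverse slope exceeding `σ`
with the margin `c`. -/
structure Direction (σ c α β : ℝ) : Prop where
  σ_nonneg : 0 ≤ σ
  σ_le : σ ≤ 1 / 10
  c_pos : 0 < c
  α_le : α ≤ 1
  β_le : β ≤ 1
  left : c ≤ β - σ * α
  right : c ≤ α - σ * β

namespace Direction

variable {σ c α β : ℝ}

theorem swap (h : Direction σ c α β) : Direction σ c β α :=
  ⟨h.σ_nonneg, h.σ_le, h.c_pos, h.β_le, h.α_le, h.right, h.left⟩

theorem c_le_α (h : Direction σ c α β) : c ≤ α := by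
  have h1 := h.left
  have h2 := h.right
  have h3 := h.σ_nonneg
  have h4 := h.σ_le
  have h5 := h.c_pos
  by_contra! hlt
  have : β < 0 := by
    by_contra! hb
    nlinarith
  nlinarith

theorem c_le_β (h : Direction σ c α β) : c ≤ β := h.swap.c_le_α

/-- Moving a long displacement in the direction `(α, β)` by a little keeps its slope. -/
theorem near (h : Direction σ c α β) {t η A B : ℝ} (ht : 0 ≤ t) (hη : 11 / 10 * η < t * c)
    (hA1 : t * α - η ≤ A) (hA2 : A ≤ t * α + η)
    (hB1 : t * β - η ≤ B) (hB2 : B ≤ t * β + η) :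
    0 < A ∧ 0 < B ∧ σ * A ≤ B ∧ σ * B ≤ A := by
  have h3 := h.σ_nonneg
  have h4 := h.σ_le
  have h6 : t * c ≤ t * α := mul_le_mul_of_nonneg_left h.c_le_α ht
  have h7 : t * c ≤ t * β := mul_le_mul_of_nonneg_left h.c_le_β ht
  have h8 : t * c ≤ t * β - σ * (t * α) := by
    have := mul_le_mul_of_nonneg_left h.left ht
    linarith
  have h9 : t * c ≤ t * α - σ * (t * β) := by
    have := mul_le_mul_of_nonneg_left h.right ht
    linarith
  have hη0 : 0 ≤ η := by linarith
  have h10 : σ * η ≤ 1 / 10 * η := mul_le_mul_of_nonneg_right h4 hη0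
  have h11 : σ * A ≤ σ * (t * α + η) := mul_le_mul_of_nonneg_left hA2 h3
  have h12 : σ * B ≤ σ * (t * β + η) := mul_le_mul_of_nonneg_left hB2 h3
  refine ⟨by linarith, by linarith, by linarith, by linarith⟩

theorem gap_bounds {g Δ : ℝ} (hd : Direction σ c α β) (hg : 0 ≤ g)
    (hcg : 200 * Δ ≤ c * g) : 200 * Δ ≤ g * α ∧ 200 * Δ ≤ g * β := by
  have h1 := mul_le_mul_of_nonneg_left hd.c_le_α hg
  have h2 := mul_le_mul_of_nonneg_left hd.c_le_β hg
  constructor <;> linarith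

end Direction

namespace MazeData

variable {m : ℕ} [m.AtLeastTwo]

/-- A point from which paths can be continued: clean as the lower left corner of rectangles of kind
`k`, with the traps to its upper right at a distance. -/
structure Source (M : MazeData m) (S : ScaleParams) (x y : Seq m) (u v : ℤ × ℤ) (κ : Kind)
    (p : ℤ × ℤ) (k : Kind) : Prop where
  start : (p = u ∧ k = κ) ∨ (u.1 < p.1 ∧ u.2 < p.2)
  clean : ∀ q : ℤ × ℤ, p.1 < q.1 → p.2 < q.2 → q.1 ≤ v.1 → q.2 ≤ v.2 →
    M.CornerClean x y p q .lower k
  far : ∀ t ∈ M.trap x y, t.toSet ⊆ rectSet k p v →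
    (p.1 : ℝ) + S.g / 2 ≤ t.a₀ ∨ (p.2 : ℝ) + S.g / 2 ≤ t.a₁

/-- A point which paths can be made to reach: clean as the upper right corner of rectangles, with
the traps to its lower left at a distance. -/
structure Target (M : MazeData m) (S : ScaleParams) (x y : Seq m) (u v : ℤ × ℤ) (κ : Kind)
    (q : ℤ × ℤ) : Prop where
  le₀ : q.1 ≤ v.1
  le₁ : q.2 ≤ v.2
  clean : ∀ (p : ℤ × ℤ) (k : Kind), (p = u ∧ k = κ) ∨ (u.1 < p.1 ∧ u.2 < p.2) →
    p.1 < q.1 → p.2 < q.2 → M.CornerClean x y p q .upper k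
  far : ∀ t ∈ M.trap x y, t.toSet ⊆ rectSet κ u v → t.b₀ ≤ q.1 → t.b₁ ≤ q.2 →
    t.b₀ + S.g / 2 ≤ q.1 ∨ t.b₁ + S.g / 2 ≤ q.2

omit [m.AtLeastTwo] in
theorem Source.swap {M : MazeData m} {S : ScaleParams} {x y : Seq m} {u v p : ℤ × ℤ} {κ k : Kind}
    (h : M.Source S x y u v κ p k) :
    M.swap.Source S y x u.swap v.swap κ.swap p.swap k.swap := by
  refine ⟨?_, fun q h0 h1 h2 h3 => ?_, fun t ht hsub => ?_⟩
  · rcases h.start with ⟨rfl, rfl⟩ | h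
    · exact Or.inl ⟨rfl, rfl⟩
    · exact Or.inr ⟨h.2, h.1⟩
  · exact (h.clean q.swap h1 h0 h3 h2).swap
  · exact (h.far t.swap ht (Trap.subset_swap.1 hsub)).symm

omit [m.AtLeastTwo] in
theorem Target.swap {M : MazeData m} {S : ScaleParams} {x y : Seq m} {u v q : ℤ × ℤ} {κ : Kind}
    (h : M.Target S x y u v κ q) : M.swap.Target S y x u.swap v.swap κ.swap q.swap := by
  refine ⟨h.le₁, h.le₀, fun p k hp h0 h1 => ?_, fun t ht hsub h0 h1 => ?_⟩
  · have := (h.clean p.swap k.swap ?_ h1 h0).swap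
    · rwa [Kind.swap_swap] at this
    · rcases hp with ⟨rfl, rfl⟩ | h
      · exact Or.inl ⟨rfl, Kind.swap_swap κ⟩
      · exact Or.inr ⟨h.2, h.1⟩
  · exact (h.far t.swap ht (Trap.subset_swap.1 hsub) h1 h0).symm

variable {M : MazeData m} {P : Params} {S : ScaleParams} {x y : Seq m}
  {u v : ℤ × ℤ} {κ : Kind} {𝒱 𝒲 : Set WallValue}

omit [m.AtLeastTwo] in
theorem Source.rectSet_subset {p q : ℤ × ℤ} {k : Kind} (h : M.Source S x y u v κ p k)
    (h0 : q.1 ≤ v.1) (h1 : q.2 ≤ v.2) : rectSet k p q ⊆ rectSet κ u v := by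
  rcases h.start with ⟨rfl, rfl⟩ | h
  · exact rectSet_mono_right h0 h1
  · exact rectSet_subset_of_lt h.1 h.2 h0 h1

omit [m.AtLeastTwo] in
theorem Source.le {p : ℤ × ℤ} {k : Kind} (h : M.Source S x y u v κ p k) :
    u.1 ≤ p.1 ∧ u.2 ≤ p.2 := by
  rcases h.start with ⟨rfl, rfl⟩ | h
  · exact ⟨le_rfl, le_rfl⟩
  · exact ⟨h.1.le, h.2.le⟩

/-- Clean points can be chosen near any point that is at some distance from walls and traps. -/
theorem Setting.exists_clean_near (hs : M.Setting P S x y u v κ 𝒱 𝒲) {cx cy : ℝ}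
    (hcx : u.1 + 3 / 2 * S.Δ ≤ cx) (hcy : u.2 + 3 / 2 * S.Δ ≤ cy)
    (hX : ∀ E ∈ M.wall .X x, ¬ (cx - 3 / 2 * S.Δ ≤ E.left ∧ (E.right : ℝ) ≤ cx + 3 / 2 * S.Δ))
    (hY : ∀ E ∈ M.wall .Y y, ¬ (cy - 3 / 2 * S.Δ ≤ E.left ∧ (E.right : ℝ) ≤ cy + 3 / 2 * S.Δ))
    (hT : ∀ t ∈ M.trap x y, cx - 3 / 2 * S.Δ < t.a₀ → t.b₀ ≤ cx + 3 / 2 * S.Δ →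
      cy - 3 / 2 * S.Δ < t.a₁ → t.b₁ ≤ cy + 3 / 2 * S.Δ → False) :
    ∃ z : ℤ × ℤ, cx - S.Δ / 2 < z.1 ∧ (z.1 : ℝ) ≤ cx + S.Δ / 2 ∧
      cy - S.Δ / 2 < z.2 ∧ (z.2 : ℝ) ≤ cy + S.Δ / 2 ∧
      M.UpperRightClean x y z ∧ M.LowerLeftClean x y z := by
  have hΔ := hs.1.scale.Δ_eq
  have h0 : (0 : ℝ) ≤ u.1 := by exact_mod_cast hs.1.nonneg
  have h1 : (0 : ℝ) ≤ u.2 := by exact_mod_cast hs.2.nonneg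
  have h10 := hs.1.scale.ten_le
  have hC := hs.1.conditions
  obtain ⟨a, ha, hac⟩ := hC.clean_dense x hs.1.walk (cx - 3 / 2 * S.Δ) (cx + 3 / 2 * S.Δ)
    (by linarith) (by linarith) hX
  obtain ⟨b, hb, hb1, hb2⟩ := (hC.clean_dense_plane x y hs.1.walk hs.2.walk (cx - 3 / 2 * S.Δ)
    (cx + 3 / 2 * S.Δ) (cy - 3 / 2 * S.Δ) (cy + 3 / 2 * S.Δ) (by linarith) (by linarith)
    (by linarith) (by linarith) hY (fun t ht hsub => by
      have q1 := hsub (a := ((t.a₀ : ℝ), (t.a₁ : ℝ))) ⟨⟨le_rfl, t.le₀⟩, ⟨le_rfl, t.le₁⟩⟩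
      have q2 := hsub (a := (t.b₀, t.b₁)) ⟨⟨t.le₀, le_rfl⟩, ⟨t.le₁, le_rfl⟩⟩
      exact hT t ht q1.1.1 q2.1.2 q1.2.1 q2.2.2) a ha).2.2 hac
  unfold MiddleThird at ha hb
  exact ⟨(a, b), by linarith, by linarith, by linarith, by linarith, hb1, hb2⟩

/-- The reachability condition of `M`, inside the rectangle from `u` to `v`. -/
theorem Setting.reach_of_hop (hs : M.Setting P S x y u v κ 𝒱 𝒲) {p q : ℤ × ℤ} {k : Kind}
    (hp : u.1 ≤ p.1 ∧ u.2 ≤ p.2)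
    (hl : M.CornerClean x y p q .lower k) (hu : M.CornerClean x y p q .upper k)
    (hT : ∀ t ∈ M.trap x y, t.toSet ⊆ rectSet k p q → False)
    (hX : M.NoWallIn .X x p.1 q.1) (hY : M.NoWallIn .Y y p.2 q.2)
    (hslope : 0 < (q.1 : ℝ) - p.1 ∧ 0 < (q.2 : ℝ) - p.2 ∧
      P.σ * ((q.1 : ℝ) - p.1) ≤ (q.2 : ℝ) - p.2 ∧ P.σ * ((q.2 : ℝ) - p.2) ≤ (q.1 : ℝ) - p.1) :
    Reach x y p q := by
  obtain ⟨h0, h1, h2, h3⟩ := hslope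
  have h0' : p.1 < q.1 := by exact_mod_cast sub_pos.1 h0
  have h1' : p.2 < q.2 := by exact_mod_cast sub_pos.1 h1
  exact hs.1.reachability.2.2 x y hs.1.walk hs.2.walk p q (hs.1.nonneg.trans hp.1)
    (hs.2.nonneg.trans hp.2) h0' h1' k (le_minslope h0' h1' h2 h3) ⟨hl, hu, hT, hX, hY⟩

omit [m.AtLeastTwo] in
theorem NoWallIn.mono {δ : Axis} {z : Seq m} {a b a' b' : ℤ} (h : M.NoWallIn δ z a b)
    (ha : a ≤ a') (hb : b' ≤ b) : M.NoWallIn δ z a' b' :=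
  fun E hE hc => h E hE ⟨ha.trans hc.1, hc.2.trans hb⟩

omit [m.AtLeastTwo] in
theorem NoWallIn.real {δ : Axis} {z : Seq m} {a b : ℤ} (h : M.NoWallIn δ z a b) {s t : ℝ}
    (hs : (a : ℝ) ≤ s) (ht : t ≤ b) : ∀ E ∈ M.wall δ z, ¬ (s ≤ E.left ∧ (E.right : ℝ) ≤ t) :=
  fun E hE hc => h E hE ⟨by exact_mod_cast hs.trans hc.1, by exact_mod_cast hc.2.trans ht⟩

/-! ### Passing the traps -/

/-- From a source, a clean point that lies approximately in the direction `(α, β)` is reached if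
there are no walls and traps in between. -/
theorem Setting.reach_to_clean (hs : M.Setting P S x y u v κ 𝒱 𝒲) {c α β : ℝ}
    (hd : Direction P.σ c α β) {p q z : ℤ × ℤ} {k : Kind} (hp : M.Source S x y u v κ p k)
    (hq : M.Target S x y u v κ q) (hX : M.NoWallIn .X x p.1 q.1) (hY : M.NoWallIn .Y y p.2 q.2)
    (hz : M.LowerLeftClean x y z) (hz0 : z.1 ≤ q.1) (hz1 : z.2 ≤ q.2)
    (hT : ∀ t ∈ M.trap x y, t.toSet ⊆ rectSet k p z → False) (t η : ℝ) (ht : 0 ≤ t)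
    (hη : 11 / 10 * η < t * c) (a1 : t * α - η ≤ (z.1 : ℝ) - p.1)
    (a2 : (z.1 : ℝ) - p.1 ≤ t * α + η) (a3 : t * β - η ≤ (z.2 : ℝ) - p.2)
    (a4 : (z.2 : ℝ) - p.2 ≤ t * β + η) : Reach x y p z := by
  have hsl := hd.near ht hη a1 a2 a3 a4
  have z0 : p.1 < z.1 := by exact_mod_cast sub_pos.1 hsl.1
  have z1 : p.2 < z.2 := by exact_mod_cast sub_pos.1 hsl.2.1
  exact hs.reach_of_hop hp.le (hp.clean z z0 z1 (hz0.trans hq.le₀) (hz1.trans hq.le₁))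
    (hz p (hs.1.nonneg.trans hp.le.1) (hs.2.nonneg.trans hp.le.2) z0.le z1.le k) hT
    (hX.mono le_rfl hz0) (hY.mono le_rfl hz1) hsl

/-- A target is reached from a clean point that sees it approximately in the direction `(α, β)` if
there are no walls and traps in between. -/
theorem Setting.reach_from_clean (hs : M.Setting P S x y u v κ 𝒱 𝒲) {c α β : ℝ}
    (hd : Direction P.σ c α β) {p q z : ℤ × ℤ} {k : Kind} (hp : M.Source S x y u v κ p k)
    (hq : M.Target S x y u v κ q) (hX : M.NoWallIn .X x p.1 q.1) (hY : M.NoWallIn .Y y p.2 q.2)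
    (hz : M.UpperRightClean x y z) (hz0 : p.1 < z.1) (hz1 : p.2 < z.2)
    (hT : ∀ t ∈ M.trap x y, t.toSet ⊆ rectSet .closed z q → False) (t η : ℝ) (ht : 0 ≤ t)
    (hη : 11 / 10 * η < t * c) (a1 : t * α - η ≤ (q.1 : ℝ) - z.1)
    (a2 : (q.1 : ℝ) - z.1 ≤ t * α + η) (a3 : t * β - η ≤ (q.2 : ℝ) - z.2)
    (a4 : (q.2 : ℝ) - z.2 ≤ t * β + η) : Reach x y z q := by
  have hsl := hd.near ht hη a1 a2 a3 a4
  have z0 : z.1 < q.1 := by exact_mod_cast sub_pos.1 hsl.1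
  have z1 : z.2 < q.2 := by exact_mod_cast sub_pos.1 hsl.2.1
  have hle := hp.le
  exact hs.reach_of_hop ⟨by omega, by omega⟩ (hz q z0.le z1.le)
    (hq.clean z .closed (Or.inr ⟨by omega, by omega⟩) z0 z1) hT
    (hX.mono hz0.le le_rfl) (hY.mono hz1.le le_rfl) hsl

/-- A strip met near the source `p` is passed through a clean point at distance `0.42 g` from `p`:
before it there are no traps since they are at distance `g / 2` from `p`, and after it there are
none since it lies above the strip. -/
theorem Setting.reach_of_strip_near_source
    (hs : M.Setting P S x y u v κ 𝒱 𝒲) {c α β ℓ : ℝ}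
    (hd : Direction P.σ c α β) (hcg : 200 * S.Δ ≤ c * S.g)
    {p q : ℤ × ℤ} {k : Kind} (hp : M.Source S x y u v κ p k) (hq : M.Target S x y u v κ q)
    (e0 : (q.1 : ℝ) - p.1 = ℓ * α) (e1 : (q.2 : ℝ) - p.2 = ℓ * β)
    (hX : M.NoWallIn .X x p.1 q.1) (hY : M.NoWallIn .Y y p.2 q.2) {h : ℤ}
    (hstrip : ∀ t ∈ M.trap x y, t.toSet ⊆ rectSet k p q → h ≤ t.a₁ ∧ (t.a₁ : ℝ) ≤ h + 3 * S.Δ)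
    {τ : ℝ} (hτβ : τ * β = (h : ℝ) - p.2)
    (hℓ : S.g / 2 ≤ ℓ) (hnear : τ < 0.3 * S.g) : Reach x y p q := by
  have h10 := hs.1.scale.ten_le
  have hg := hs.1.scale.g_ge
  obtain ⟨hgα, hgβ⟩ := hd.gap_bounds (by linarith) hcg
  have hα1 := hd.α_le
  have hβ1 := hd.β_le
  have hup : (u.1 : ℝ) ≤ p.1 ∧ (u.2 : ℝ) ≤ p.2 :=
    ⟨by exact_mod_cast hp.le.1, by exact_mod_cast hp.le.2⟩
  have hqv : (q.1 : ℝ) ≤ v.1 ∧ (q.2 : ℝ) ≤ v.2 :=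
    ⟨by exact_mod_cast hq.le₀, by exact_mod_cast hq.le₁⟩
  have hc0 := hd.c_pos
  have hα0 := hc0.trans_le hd.c_le_α
  have hβ0 := hc0.trans_le hd.c_le_β
  have b1 : (0.42 * S.g) * α ≤ 0.42 * S.g := by nlinarith
  have b2 : (0.42 * S.g) * β ≤ 0.42 * S.g := by nlinarith
  have b3 : 0.08 * S.g * α ≤ ℓ * α - 0.42 * S.g * α := by nlinarith
  have b4 : 0.08 * S.g * β ≤ ℓ * β - 0.42 * S.g * β := by nlinarith
  have b5 : (h : ℝ) - p.2 ≤ 0.3 * S.g * β := by rw [← hτβ]; nlinarith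
  have b6 : 0.08 * S.g * c ≤ (ℓ - 0.42 * S.g) * c := by nlinarith
  obtain ⟨z, z1, z2, z3, z4, zu, zl⟩ := hs.exists_clean_near (cx := p.1 + 0.42 * S.g * α)
    (cy := p.2 + 0.42 * S.g * β) (by linarith) (by linarith)
    (hX.real (by linarith) (by linarith)) (hY.real (by linarith) (by linarith))
    (fun t ht t0 t1 t2 t3 => by
      have := (hstrip t ht (Trap.subset_rectSet (by linarith) (by linarith) (by linarith)
        (by linarith))).2
      linarith)
  have hzp0 : p.1 < z.1 := by exact_mod_cast (by linarith : (p.1 : ℝ) < z.1)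
  have hzp1 : p.2 < z.2 := by exact_mod_cast (by linarith : (p.2 : ℝ) < z.2)
  have hzq0 : z.1 ≤ q.1 := by exact_mod_cast (by linarith : (z.1 : ℝ) ≤ q.1)
  have hzq1 : z.2 ≤ q.2 := by exact_mod_cast (by linarith : (z.2 : ℝ) ≤ q.2)
  refine (hs.reach_to_clean hd hp hq hX hY zl hzq0 hzq1 ?_ (0.42 * S.g) (S.Δ / 2) (by linarith)
    (by linarith) (by linarith) (by linarith) (by linarith) (by linarith)).trans
    (hs.reach_from_clean hd hp hq hX hY zu hzp0 hzp1 ?_ (ℓ - 0.42 * S.g) (S.Δ / 2)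
      (by linarith) (by linarith) (by linarith) (by linarith) (by linarith) (by linarith))
  · intro t ht hsub
    have hb := Trap.bounds hsub
    have := t.le₀
    have := t.le₁
    rcases hp.far t ht (hsub.trans (rectSet_mono_right (hzq0.trans hq.le₀) (hzq1.trans hq.le₁)))
      with h | h <;> linarith
  · intro t ht hsub
    have hb := Trap.bounds hsub
    have := (hstrip t ht (hsub.trans (rectSet_subset_of_lt hzp0 hzp1 le_rfl le_rfl))).2
    linarith

/-- A strip met near the target `q` is passed through a clean point at distance `0.42 g` from `q`,
which lies below the strip. -/
theorem Setting.reach_of_strip_near_target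
    (hs : M.Setting P S x y u v κ 𝒱 𝒲) {c α β ℓ : ℝ}
    (hd : Direction P.σ c α β) (hcg : 200 * S.Δ ≤ c * S.g)
    {p q : ℤ × ℤ} {k : Kind} (hp : M.Source S x y u v κ p k) (hq : M.Target S x y u v κ q)
    (e0 : (q.1 : ℝ) - p.1 = ℓ * α) (e1 : (q.2 : ℝ) - p.2 = ℓ * β)
    (hX : M.NoWallIn .X x p.1 q.1) (hY : M.NoWallIn .Y y p.2 q.2) {h : ℤ}
    (hstrip : ∀ t ∈ M.trap x y, t.toSet ⊆ rectSet k p q → h ≤ t.a₁ ∧ (t.a₁ : ℝ) ≤ h + 3 * S.Δ)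
    {τ : ℝ} (hτβ : τ * β = (h : ℝ) - p.2)
    (hℓ : S.g / 2 ≤ ℓ) (hnear : ℓ - τ < 0.3 * S.g) : Reach x y p q := by
  have h10 := hs.1.scale.ten_le
  have hg := hs.1.scale.g_ge
  obtain ⟨hgα, hgβ⟩ := hd.gap_bounds (by linarith) hcg
  have hα1 := hd.α_le
  have hβ1 := hd.β_le
  have hup : (u.1 : ℝ) ≤ p.1 ∧ (u.2 : ℝ) ≤ p.2 :=
    ⟨by exact_mod_cast hp.le.1, by exact_mod_cast hp.le.2⟩
  have hqv : (q.1 : ℝ) ≤ v.1 ∧ (q.2 : ℝ) ≤ v.2 :=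
    ⟨by exact_mod_cast hq.le₀, by exact_mod_cast hq.le₁⟩
  have hc0 := hd.c_pos
  have hα0 := hc0.trans_le hd.c_le_α
  have hβ0 := hc0.trans_le hd.c_le_β
  have b1 : (0.42 * S.g) * α ≤ 0.42 * S.g := by nlinarith
  have b2 : (0.42 * S.g) * β ≤ 0.42 * S.g := by nlinarith
  have b3 : 0.08 * S.g * α ≤ ℓ * α - 0.42 * S.g * α := by nlinarith
  have b4 : 0.08 * S.g * β ≤ ℓ * β - 0.42 * S.g * β := by nlinarith
  have b5 : ℓ * β - 0.3 * S.g * β ≤ (h : ℝ) - p.2 := by rw [← hτβ]; nlinarith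
  have b6 : 0.08 * S.g * c ≤ (ℓ - 0.42 * S.g) * c := by nlinarith
  obtain ⟨z, z1, z2, z3, z4, zu, zl⟩ := hs.exists_clean_near (cx := q.1 - 0.42 * S.g * α)
    (cy := q.2 - 0.42 * S.g * β) (by linarith) (by linarith)
    (hX.real (by linarith) (by linarith)) (hY.real (by linarith) (by linarith))
    (fun t ht t0 t1 t2 t3 => by
      have h1 := (hstrip t ht (Trap.subset_rectSet (by linarith) (by linarith) (by linarith)
        (by linarith))).1
      have h1' : (h : ℝ) ≤ t.a₁ := by exact_mod_cast h1
      have := t.le₁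
      linarith)
  have hzp0 : p.1 < z.1 := by exact_mod_cast (by linarith : (p.1 : ℝ) < z.1)
  have hzp1 : p.2 < z.2 := by exact_mod_cast (by linarith : (p.2 : ℝ) < z.2)
  have hzq0 : z.1 ≤ q.1 := by exact_mod_cast (by linarith : (z.1 : ℝ) ≤ q.1)
  have hzq1 : z.2 ≤ q.2 := by exact_mod_cast (by linarith : (z.2 : ℝ) ≤ q.2)
  refine (hs.reach_to_clean hd hp hq hX hY zl hzq0 hzq1 ?_ (ℓ - 0.42 * S.g) (S.Δ / 2)
    (by linarith) (by linarith) (by linarith) (by linarith) (by linarith) (by linarith)).trans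
    (hs.reach_from_clean hd hp hq hX hY zu hzp0 hzp1 ?_ (0.42 * S.g) (S.Δ / 2) (by linarith)
      (by linarith) (by linarith) (by linarith) (by linarith) (by linarith))
  · intro t ht hsub
    have hb := Trap.bounds hsub
    have h1 := (hstrip t ht (hsub.trans (rectSet_mono_right hzq0 hzq1))).1
    have h1' : (h : ℝ) ≤ t.a₁ := by exact_mod_cast h1
    have := t.le₁
    linarith
  · intro t ht hsub
    have hb := Trap.bounds hsub
    have := t.le₀
    have := t.le₁
    have hle := hp.le
    rcases hq.far t ht (hsub.trans (rectSet_subset_of_lt (hle.1.trans_lt hzp0)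
      (hle.2.trans_lt hzp1) hq.le₀ hq.le₁)) hb.2.1 hb.2.2.2 with h | h <;> linarith

set_option maxHeartbeats 800000 in
/-- A strip met far from both ends is crossed through a gap of length `7Δ` near its intersection
with the diagonal, between two clean points below and above it. -/
theorem Setting.reach_of_strip_far
    (hs : M.Setting P S x y u v κ 𝒱 𝒲) {c α β ℓ : ℝ}
    (hd : Direction P.σ c α β) (hcg : 200 * S.Δ ≤ c * S.g)
    {p q : ℤ × ℤ} {k : Kind} (hp : M.Source S x y u v κ p k) (hq : M.Target S x y u v κ q)
    (e0 : (q.1 : ℝ) - p.1 = ℓ * α) (e1 : (q.2 : ℝ) - p.2 = ℓ * β)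
    (hX : M.NoWallIn .X x p.1 q.1) (hY : M.NoWallIn .Y y p.2 q.2) {h : ℤ}
    (hstrip : ∀ t ∈ M.trap x y, t.toSet ⊆ rectSet k p q → h ≤ t.a₁ ∧ (t.a₁ : ℝ) ≤ h + 3 * S.Δ)
    {τ : ℝ} (hτβ : τ * β = (h : ℝ) - p.2)
    (hfar : 0.3 * S.g ≤ τ) (hfar' : 0.3 * S.g ≤ ℓ - τ) : Reach x y p q := by
  have h10 := hs.1.scale.ten_le
  have hg := hs.1.scale.g_ge
  obtain ⟨hgα, hgβ⟩ := hd.gap_bounds (by linarith) hcg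
  have hα1 := hd.α_le
  have hβ1 := hd.β_le
  have hup : (u.1 : ℝ) ≤ p.1 ∧ (u.2 : ℝ) ≤ p.2 :=
    ⟨by exact_mod_cast hp.le.1, by exact_mod_cast hp.le.2⟩
  have hqv : (q.1 : ℝ) ≤ v.1 ∧ (q.2 : ℝ) ≤ v.2 :=
    ⟨by exact_mod_cast hq.le₀, by exact_mod_cast hq.le₁⟩
  have hc0 := hd.c_pos
  have hα0 := hc0.trans_le hd.c_le_α
  have hβ0 := hc0.trans_le hd.c_le_β
  have hu0 := hs.1.nonneg
  have hu1 := hs.2.nonneg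
  have hg0 : 0 < S.g := by linarith
  have b1 : 60 * S.Δ ≤ τ * α := by nlinarith
  have b2 : 60 * S.Δ ≤ τ * β := by nlinarith
  have b3 : 60 * S.Δ ≤ (ℓ - τ) * α := by nlinarith
  have b4 : 60 * S.Δ ≤ (ℓ - τ) * β := by nlinarith
  have b5 : 60 * S.Δ ≤ τ * c := by nlinarith
  have b6 : 60 * S.Δ ≤ (ℓ - τ) * c := by nlinarith
  have f1 := Int.floor_le (p.1 + τ * α - 14 * S.Δ)
  have f2 := Int.lt_floor_add_one (p.1 + τ * α - 14 * S.Δ)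
  obtain ⟨s, s1, s2, hgap⟩ := hs.1.gap_short ⌊p.1 + τ * α - 14 * S.Δ⌋ h (by linarith) (by linarith)
    (by exact_mod_cast (by linarith : (u.2 : ℝ) < h)) (by linarith)
  obtain ⟨z, z1, z2, z3, z4, zu, zl⟩ := hs.exists_clean_near (cx := s + 3 / 2 * S.Δ)
    (cy := h - 5 / 2 * S.Δ) (by linarith) (by linarith)
    (hX.real (by linarith) (by linarith)) (hY.real (by linarith) (by linarith))
    (fun t ht t0 t1 t2 t3 => by
      have h1 := (hstrip t ht (Trap.subset_rectSet (by linarith) (by linarith) (by linarith)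
        (by linarith))).1
      have h1' : (h : ℝ) ≤ t.a₁ := by exact_mod_cast h1
      have := t.le₁
      linarith)
  obtain ⟨z', z1', z2', z3', z4', zu', zl'⟩ := hs.exists_clean_near (cx := s + 11 / 2 * S.Δ)
    (cy := h + 11 / 2 * S.Δ) (by linarith) (by linarith)
    (hX.real (by linarith) (by linarith)) (hY.real (by linarith) (by linarith))
    (fun t ht t0 t1 t2 t3 => by
      have := (hstrip t ht (Trap.subset_rectSet (by linarith) (by linarith) (by linarith)
        (by linarith))).2
      linarith)
  have hzp0 : p.1 < z.1 := by exact_mod_cast (by linarith : (p.1 : ℝ) < z.1)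
  have hzp1 : p.2 < z.2 := by exact_mod_cast (by linarith : (p.2 : ℝ) < z.2)
  have hzq0 : z'.1 ≤ q.1 := by exact_mod_cast (by linarith : (z'.1 : ℝ) ≤ q.1)
  have hzq1 : z'.2 ≤ q.2 := by exact_mod_cast (by linarith : (z'.2 : ℝ) ≤ q.2)
  have hzz0 : z.1 < z'.1 := by exact_mod_cast (by linarith : (z.1 : ℝ) < z'.1)
  have hzz1 : z.2 < z'.2 := by exact_mod_cast (by linarith : (z.2 : ℝ) < z'.2)
  refine (hs.reach_to_clean hd hp hq hX hY zl (hzz0.le.trans hzq0) (hzz1.le.trans hzq1) ?_ τ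
    (15 * S.Δ) (by linarith) (by linarith) (by linarith) (by linarith) (by linarith)
    (by linarith)).trans
    (Relation.ReflTransGen.trans (b := z') ?_
    (hs.reach_from_clean hd hp hq hX hY zu' (hzp0.trans hzz0) (hzp1.trans hzz1) ?_ (ℓ - τ)
      (15 * S.Δ) (by linarith) (by linarith) (by linarith) (by linarith) (by linarith)
      (by linarith)))
  · intro t ht hsub
    have hb := Trap.bounds hsub
    have h1 := (hstrip t ht (hsub.trans (rectSet_mono_right (hzz0.le.trans hzq0)
      (hzz1.le.trans hzq1)))).1
    have h1' : (h : ℝ) ≤ t.a₁ := by exact_mod_cast h1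
    have := t.le₁
    linarith
  · have hle := hp.le
    have hσ0 := hd.σ_nonneg
    have hσ1 := hd.σ_le
    refine hs.reach_of_hop (k := .closed) ⟨by omega, by omega⟩ (zu z' hzz0.le hzz1.le)
      (zl' z (hu0.trans (hle.1.trans hzp0.le)) (hu1.trans (hle.2.trans hzp1.le)) hzz0.le hzz1.le
        .closed) ?_
      (hX.mono hzp0.le hzq0) (hY.mono hzp1.le hzq1)
      ⟨by linarith, by linarith, ?_, ?_⟩
    · intro t ht hsub
      have hb := Trap.bounds hsub
      have h1 := hstrip t ht (hsub.trans (rectSet_subset_of_lt hzp0 hzp1 hzq0 hzq1))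
      have h1' : (h : ℝ) ≤ t.a₁ := by exact_mod_cast h1.1
      have h2 := (hs.1.conditions.trap_size x y hs.1.walk hs.2.walk t ht).2
      rw [← hs.1.scale.Δ_eq] at h2
      refine hgap t ht ?_
      rintro r ⟨⟨r1, r2⟩, ⟨r3, r4⟩⟩
      exact ⟨⟨by linarith, by linarith⟩, ⟨by linarith, by linarith⟩⟩
    · have : P.σ * ((z'.1 : ℝ) - z.1) ≤ 1 / 10 * ((z'.1 : ℝ) - z.1) :=
        mul_le_mul_of_nonneg_right hσ1 (by linarith)
      linarith
    · have : P.σ * ((z'.2 : ℝ) - z.2) ≤ 1 / 10 * ((z'.2 : ℝ) - z.2) :=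
        mul_le_mul_of_nonneg_right hσ1 (by linarith)
      linarith
  · intro t ht hsub
    have hb := Trap.bounds hsub
    have := (hstrip t ht (hsub.trans (rectSet_subset_of_lt (hzp0.trans hzz0) (hzp1.trans hzz1)
      le_rfl le_rfl))).2
    linarith

/-- The traps of a wall-free rectangle being contained in a horizontal strip, the strip can be
passed. -/
theorem Setting.reach_of_strip (hs : M.Setting P S x y u v κ 𝒱 𝒲) {c α β ℓ : ℝ}
    (hd : Direction P.σ c α β) (hcg : 200 * S.Δ ≤ c * S.g)
    {p q : ℤ × ℤ} {k : Kind} (hp : M.Source S x y u v κ p k) (hq : M.Target S x y u v κ q)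
    (hℓ : S.g / 2 ≤ ℓ) (e0 : (q.1 : ℝ) - p.1 = ℓ * α) (e1 : (q.2 : ℝ) - p.2 = ℓ * β)
    (hX : M.NoWallIn .X x p.1 q.1) (hY : M.NoWallIn .Y y p.2 q.2) {h : ℤ}
    (hstrip : ∀ t ∈ M.trap x y, t.toSet ⊆ rectSet k p q → h ≤ t.a₁ ∧ (t.a₁ : ℝ) ≤ h + 3 * S.Δ) :
    Reach x y p q := by
  have hβ0 : 0 < β := hd.c_pos.trans_le hd.c_le_β
  have hτβ : ((h : ℝ) - p.2) / β * β = (h : ℝ) - p.2 := by field_simp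
  rcases lt_or_ge (((h : ℝ) - p.2) / β) (0.3 * S.g) with hnear | hfar
  · exact hs.reach_of_strip_near_source hd hcg hp hq e0 e1 hX hY hstrip hτβ hℓ hnear
  rcases lt_or_ge (ℓ - ((h : ℝ) - p.2) / β) (0.3 * S.g) with hnear | hfar'
  · exact hs.reach_of_strip_near_target hd hcg hp hq e0 e1 hX hY hstrip hτβ hℓ hnear
  · exact hs.reach_of_strip_far hd hcg hp hq e0 e1 hX hY hstrip hτβ hfar hfar'

/-- Two traps of the rectangle that are not far from each other have starting points close to each
other in one of the coordinates. -/
theorem Setting.close_of_traps (hs : M.Setting P S x y u v κ 𝒱 𝒲) {t t' : Trap}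
    (ht : t ∈ M.trap x y) (ht' : t' ∈ M.trap x y) (hsub : t.toSet ⊆ rectSet κ u v)
    (hsub' : t'.toSet ⊆ rectSet κ u v) (h0 : |(t.a₀ : ℝ) - t'.a₀| ≤ S.f)
    (h1 : |(t.a₁ : ℝ) - t'.a₁| ≤ S.f) :
    |(t.a₀ : ℝ) - t'.a₀| ≤ S.Δ ∨ |(t.a₁ : ℝ) - t'.a₁| ≤ S.Δ := by
  have hsz := hs.1.conditions.trap_size x y hs.1.walk hs.2.walk t ht
  have hsz' := hs.1.conditions.trap_size x y hs.1.walk hs.2.walk t' ht'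
  rw [← hs.1.scale.Δ_eq] at hsz hsz'
  have hnd := mt (hs.1.uncorrelated t ht t' ht' hsub hsub') (not_not.2 ⟨h0, h1⟩)
  rw [Trap.DisjointProj, not_and_or, Set.not_disjoint_iff, Set.not_disjoint_iff] at hnd
  rcases hnd with ⟨r, ⟨r1, r2⟩, ⟨r3, r4⟩⟩ | ⟨r, ⟨r1, r2⟩, ⟨r3, r4⟩⟩
  · left; rw [abs_le]; constructor <;> linarith
  · right; rw [abs_le]; constructor <;> linarith

/-- Since uncorrelated compound traps are absent, the traps of a region of size `f` are all
contained in a horizontal strip or in a vertical one. -/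
theorem Setting.exists_strip (hs : M.Setting P S x y u v κ 𝒱 𝒲) (𝒯 : Set Trap)
    (h𝒯 : ∀ t ∈ 𝒯, t ∈ M.trap x y ∧ t.toSet ⊆ rectSet κ u v)
    (hf : ∀ t ∈ 𝒯, ∀ t' ∈ 𝒯, |(t.a₀ : ℝ) - t'.a₀| ≤ S.f ∧ |(t.a₁ : ℝ) - t'.a₁| ≤ S.f) :
    (∃ h : ℤ, ∀ t ∈ 𝒯, h ≤ t.a₁ ∧ (t.a₁ : ℝ) ≤ h + 3 * S.Δ) ∨
      ∃ h : ℤ, ∀ t ∈ 𝒯, h ≤ t.a₀ ∧ (t.a₀ : ℝ) ≤ h + 3 * S.Δ := by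
  rcases 𝒯.eq_empty_or_nonempty with rfl | ⟨t₀, ht₀⟩
  · exact Or.inl ⟨0, fun t ht => ht.elim⟩
  have hcl : ∀ t ∈ 𝒯, ∀ t' ∈ 𝒯, |(t.a₀ : ℝ) - t'.a₀| ≤ S.Δ ∨ |(t.a₁ : ℝ) - t'.a₁| ≤ S.Δ :=
    fun t ht t' ht' => hs.close_of_traps (h𝒯 t ht).1 (h𝒯 t' ht').1 (h𝒯 t ht).2 (h𝒯 t' ht').2
      (hf t ht t' ht').1 (hf t ht t' ht').2
  by_cases hY : ∀ t ∈ 𝒯, ∀ t' ∈ 𝒯, (t.a₁ : ℝ) ≤ t'.a₁ + 3 * S.Δ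
  · left
    obtain ⟨h, ⟨t, ht, rfl⟩, hmin⟩ := Int.exists_least_of_bdd (P := fun h => ∃ t ∈ 𝒯, t.a₁ = h)
      ⟨0, by rintro z ⟨t, -, rfl⟩; exact t.nonneg₁⟩ ⟨_, t₀, ht₀, rfl⟩
    exact ⟨t.a₁, fun t' ht' => ⟨hmin _ ⟨t', ht', rfl⟩, hY t' ht' t ht⟩⟩
  by_cases hX : ∀ t ∈ 𝒯, ∀ t' ∈ 𝒯, (t.a₀ : ℝ) ≤ t'.a₀ + 3 * S.Δ
  · right
    obtain ⟨h, ⟨t, ht, rfl⟩, hmin⟩ := Int.exists_least_of_bdd (P := fun h => ∃ t ∈ 𝒯, t.a₀ = h)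
      ⟨0, by rintro z ⟨t, -, rfl⟩; exact t.nonneg₀⟩ ⟨_, t₀, ht₀, rfl⟩
    exact ⟨t.a₀, fun t' ht' => ⟨hmin _ ⟨t', ht', rfl⟩, hX t' ht' t ht⟩⟩
  -- Otherwise `t₁`, `t₂` are far from each other vertically and `t₃`, `t₄` horizontally.  But each
  -- of `t₃`, `t₄` cannot be close vertically to both `t₁` and `t₂`, so it is close horizontally to
  -- one of them, and these two are close to each other horizontally.
  exfalso
  push Not at hX hY
  obtain ⟨t₁, h₁, t₂, h₂, h12⟩ := hY
  obtain ⟨t₃, h₃, t₄, h₄, h34⟩ := hX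
  have h10 := hs.1.scale.ten_le
  have k12 := hcl t₁ h₁ t₂ h₂
  have k13 := hcl t₁ h₁ t₃ h₃
  have k23 := hcl t₂ h₂ t₃ h₃
  have k14 := hcl t₁ h₁ t₄ h₄
  have k24 := hcl t₂ h₂ t₄ h₄
  have k34 := hcl t₃ h₃ t₄ h₄
  simp only [abs_le] at k12 k13 k23 k14 k24 k34
  rcases k12 with k12 | k12
  swap
  · linarith
  rcases k34 with k34 | k34
  · linarith
  rcases k13 with k13 | k13
  · rcases k14 with k14 | k14
    · linarith
    · rcases k24 with k24 | k24 <;> linarith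
  · rcases k23 with k23 | k23
    · rcases k24 with k24 | k24 <;> linarith
    · linarith

/-- A wall-free rectangle of size at most `f` can be crossed if its slope has some margin. -/
theorem Setting.reach_of_wallFree (hs : M.Setting P S x y u v κ 𝒱 𝒲) {p q : ℤ × ℤ} {k : Kind}
    (hp : M.Source S x y u v κ p k) (hq : M.Target S x y u v κ q)
    (hX : M.NoWallIn .X x p.1 q.1) (hY : M.NoWallIn .Y y p.2 q.2) {A B : ℝ}
    (eA : (q.1 : ℝ) - p.1 = A) (eB : (q.2 : ℝ) - p.2 = B) (hA : 0 < A) (hB : 0 < B)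
    (hAf : A ≤ S.f) (hBf : B ≤ S.f)
    (h1 : 200 * (S.g / S.f) * A ≤ B - P.σ * A) (h2 : 200 * (S.g / S.f) * B ≤ B - P.σ * A)
    (h3 : 200 * (S.g / S.f) * A ≤ A - P.σ * B) (h4 : 200 * (S.g / S.f) * B ≤ A - P.σ * B) :
    Reach x y p q := by
  have h10 := hs.1.scale.ten_le
  have hg := hs.1.scale.g_ge
  have hf := hs.1.scale.f_ge
  have hσ := hs.1.scale.σ_nonneg
  have hg0 : 0 < S.g := by linarith
  have hf0 : 0 < S.f := by linarith
  have hε : 0 < S.g / S.f := by positivity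
  have hεA : 0 < 200 * (S.g / S.f) * A := by positivity
  have hεB : 0 < 200 * (S.g / S.f) * B := by positivity
  by_cases hT : ∀ t ∈ M.trap x y, t.toSet ⊆ rectSet k p q → False
  · have z0 : p.1 < q.1 := by exact_mod_cast sub_pos.1 (eA ▸ hA)
    have z1 : p.2 < q.2 := by exact_mod_cast sub_pos.1 (eB ▸ hB)
    refine hs.reach_of_hop hp.le (hp.clean q z0 z1 hq.le₀ hq.le₁)
      (hq.clean p k hp.start z0 z1) hT hX hY ?_
    rw [eA, eB]
    exact ⟨hA, hB, by linarith, by linarith⟩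
  push Not at hT
  obtain ⟨t₀, ht₀, hsub₀, -⟩ := hT
  have hb₀ := Trap.bounds hsub₀
  have hfar₀ := hp.far t₀ ht₀ (hsub₀.trans (rectSet_mono_right hq.le₀ hq.le₁))
  have hℓ : S.g / 2 ≤ max A B := by
    have := t₀.le₀
    have := t₀.le₁
    rw [le_max_iff]
    rcases hfar₀ with h | h
    · left; linarith
    · right; linarith
  have hℓ0 : 0 < max A B := lt_max_of_lt_left hA
  have hd : Direction P.σ (200 * (S.g / S.f)) (A / max A B) (B / max A B) := by
    refine ⟨hσ, by linarith [hs.1.scale.σ_le], by positivity,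
      (div_le_one hℓ0).2 (le_max_left _ _), (div_le_one hℓ0).2 (le_max_right _ _), ?_, ?_⟩
    · rw [show B / max A B - P.σ * (A / max A B) = (B - P.σ * A) / max A B by ring,
        le_div_iff₀ hℓ0]
      rcases max_cases A B with h | h <;> rw [h.1] <;> linarith
    · rw [show A / max A B - P.σ * (B / max A B) = (A - P.σ * B) / max A B by ring,
        le_div_iff₀ hℓ0]
      rcases max_cases A B with h | h <;> rw [h.1] <;> linarith
  have hcg : 200 * S.Δ ≤ 200 * (S.g / S.f) * S.g := by
    have : S.Δ ≤ S.g * S.g / S.f := (le_div_iff₀ hf0).2 hs.1.scale.mul_le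
    calc 200 * S.Δ ≤ 200 * (S.g * S.g / S.f) := by linarith
      _ = 200 * (S.g / S.f) * S.g := by ring
  have eA' : (q.1 : ℝ) - p.1 = max A B * (A / max A B) := by rw [eA]; field_simp
  have eB' : (q.2 : ℝ) - p.2 = max A B * (B / max A B) := by rw [eB]; field_simp
  rcases hs.exists_strip {t | t ∈ M.trap x y ∧ t.toSet ⊆ rectSet k p q}
    (fun t ht => ⟨ht.1, ht.2.trans (hp.rectSet_subset hq.le₀ hq.le₁)⟩) (fun t ht t' ht' => by
      have hb := Trap.bounds ht.2
      have hb' := Trap.bounds ht'.2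
      have := t.le₀
      have := t.le₁
      have := t'.le₀
      have := t'.le₁
      rw [abs_le, abs_le]
      refine ⟨⟨?_, ?_⟩, ⟨?_, ?_⟩⟩ <;> linarith) with ⟨h, hh⟩ | ⟨h, hh⟩
  · exact hs.reach_of_strip hd hcg hp hq hℓ eA' eB' hX hY fun t ht hsub => hh t ⟨ht, hsub⟩
  · exact (hs.swap.reach_of_strip hd.swap hcg hp.swap hq.swap hℓ eB' eA' hY hX
      fun t ht hsub => hh t.swap ⟨ht, Trap.subset_swap.1 hsub⟩).swap

end MazeData

theorem rectSet_subset_leftOpen (k : Kind) (p q : ℤ × ℤ) :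
    rectSet k p q ⊆ rectSet .leftOpen (p.1 - 1, p.2) q := by
  rintro r hr
  obtain ⟨q1, q2, q3, q4⟩ : (p.1 : ℝ) ≤ r.1 ∧ r.1 ≤ q.1 ∧ (p.2 : ℝ) ≤ r.2 ∧ r.2 ≤ q.2 := by
    cases k <;> obtain ⟨p0, p1⟩ := hr
    exacts [⟨p0.1, p0.2, p1.1, p1.2⟩, ⟨p0.1.le, p0.2, p1.1, p1.2⟩, ⟨p0.1, p0.2, p1.1.le, p1.2⟩]
  refine ⟨⟨?_, q2⟩, ⟨q3, q4⟩⟩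
  push_cast
  linarith

namespace MazeData

variable {m : ℕ} [m.AtLeastTwo] {M : MazeData m} {P : Params} {S : ScaleParams} {x y : Seq m}
  {u v : ℤ × ℤ} {κ : Kind} {𝒱 𝒲 : Set WallValue}

/-! ### Passing a wall through a hole -/

/-- The lower end of a good hole through a dominant wall is a target.  Its cleanness as seen from
the hole concerns left-open rectangles; those of other kinds are contained in left-open ones
starting one step further to the left, and where there is no room for this step, trap-cleanness is
deduced from that in a square of side `⌈Δ⌉`. -/
theorem Setting.target_of_goodHole (hs : M.Setting P S x y u v κ 𝒱 𝒲) {W : WallValue}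
    (hW : W ∈ 𝒲) {a₁ a₂ : ℤ} (hole : M.GoodHole x y W a₁ a₂) (h1 : u.1 + S.Δ + 2 ≤ a₁)
    (h2 : a₁ ≤ v.1)
    (hfar : ∀ t ∈ M.trap x y, t.toSet ⊆ rectSet κ u v → t.b₀ ≤ a₁ → t.b₁ ≤ W.left →
      t.b₀ + S.g / 2 ≤ a₁ ∨ t.b₁ + S.g / 2 ≤ W.left) :
    M.Target S x y u v κ (a₁, W.left) := by
  have hC := hs.1.conditions
  have hx := hs.1.walk
  have hy : IsWalk y := hs.2.walk
  have h10 := hs.1.scale.ten_le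
  have hg := hs.1.scale.g_ge
  have hf := hs.1.scale.f_ge
  have hl : (u.2 : ℝ) + S.f / 3 ≤ W.left := hs.2.left_far W hW
  have hr : (W.right : ℝ) + S.f / 3 ≤ v.2 := hs.2.right_far W hW
  have hu0 := hs.1.nonneg
  have hu1 : 0 ≤ u.2 := hs.2.nonneg
  have hlt : (W.left : ℝ) < W.right := by exact_mod_cast W.lt
  have hint : ∀ (p : ℤ × ℤ) (k : Kind), u.1 < p.1 → u.2 < p.2 → p.1 < a₁ → p.2 < W.left →
      M.trapClean x y p (a₁, W.left) .upper k := by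
    intro p k p0 p1 p2 p3
    exact hC.mono_trapClean_upper x y hx hy (p.1 - 1, p.2) p (a₁, W.left)
      (show 0 ≤ p.1 - 1 by omega) (hu1.trans p1.le) (show p.1 - 1 < a₁ by omega) p3 (by omega)
      (by omega) p2 p3 .leftOpen k (rectSet_subset_leftOpen k p _)
      ((hole.2.1 (p.1 - 1, p.2) (show 0 ≤ p.1 - 1 by omega) (hu1.trans p1.le)
        (show p.1 - 1 ≤ a₁ by omega) p3.le).1 (show p.1 - 1 < a₁ by omega) p3)
  refine ⟨h2, ?_, fun p k hp p0 p1 => ⟨fun _ _ => ?_, fun hlt' _ => ?_, ?_⟩, hfar⟩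
  · change W.left ≤ v.2
    exact_mod_cast (by linarith : (W.left : ℝ) ≤ v.2)
  · have p0' : p.1 < a₁ := p0
    have p1' : p.2 < W.left := p1
    obtain ⟨n, hn⟩ : ∃ n : ℤ, n = ⌈S.Δ⌉ := ⟨_, rfl⟩
    have hn1 : S.Δ ≤ n := by rw [hn]; exact Int.le_ceil _
    have hn2 : (n : ℝ) < S.Δ + 1 := by rw [hn]; exact Int.ceil_lt_add_one _
    have hn0 : 0 < n := by exact_mod_cast (by linarith : (0 : ℝ) < n)
    have hna : u.1 + n < a₁ := by exact_mod_cast (by linarith : (u.1 : ℝ) + n < a₁)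
    have hnW : u.2 + n < W.left := by exact_mod_cast (by linarith : (u.2 : ℝ) + n < W.left)
    have hup : u.1 ≤ p.1 ∧ u.2 ≤ p.2 := by
      rcases hp with ⟨rfl, -⟩ | hp
      · exact ⟨le_rfl, le_rfl⟩
      · exact ⟨hp.1.le, hp.2.le⟩
    exact hC.min_trapClean_upper x y hx hy p (a₁, W.left) (hu0.trans hup.1) (hu1.trans hup.2)
      p0 p1 n k hn0 (by rw [← hs.1.scale.Δ_eq]; exact hn1) (show n ≤ a₁ by omega)
      (show n ≤ W.left by omega)
      (hint _ k (show u.1 < a₁ - n by omega) (show u.2 < W.left - n by omega)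
        (show a₁ - n < a₁ by omega) (show W.left - n < W.left by omega))
  · have hup : u.1 ≤ p.1 ∧ u.2 ≤ p.2 := by
      rcases hp with ⟨rfl, -⟩ | hp
      · exact ⟨le_rfl, le_rfl⟩
      · exact ⟨hp.1.le, hp.2.le⟩
    exact hC.strong_clean x hx _ _ _ ((hole.2.1 p (hu0.trans hup.1) (hu1.trans hup.2)
      hlt'.le p1.le).2 hlt' (by simp))
  · have hup : u.2 ≤ p.2 := by
      rcases hp with ⟨rfl, -⟩ | hp
      · exact le_rfl
      · exact hp.2.le
    have p1' : p.2 < W.left := p1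
    exact hs.2.left_clean W hW p.2 (by omega) p1'.le

/-- The upper end of a good hole through a dominant wall is a source, for left-open rectangles. -/
theorem Setting.source_of_goodHole (hs : M.Setting P S x y u v κ 𝒱 𝒲) {W : WallValue}
    (hW : W ∈ 𝒲) {a₁ a₂ : ℤ} (hole : M.GoodHole x y W a₁ a₂) (h1 : u.1 < a₂)
    (hfar : ∀ t ∈ M.trap x y, t.toSet ⊆ rectSet κ u v → (a₂ : ℝ) ≤ t.a₀ → (W.right : ℝ) ≤ t.a₁ →
      (a₂ : ℝ) + S.g / 2 ≤ t.a₀ ∨ (W.right : ℝ) + S.g / 2 ≤ t.a₁) :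
    M.Source S x y u v κ (a₂, W.right) .leftOpen := by
  have hC := hs.1.conditions
  have hx := hs.1.walk
  have h10 := hs.1.scale.ten_le
  have hg := hs.1.scale.g_ge
  have hf := hs.1.scale.f_ge
  have hl : (u.2 : ℝ) + S.f / 3 ≤ W.left := hs.2.left_far W hW
  have hlt : (W.left : ℝ) < W.right := by exact_mod_cast W.lt
  have hW2 : u.2 < W.right := by exact_mod_cast (by linarith : (u.2 : ℝ) < W.right)
  refine ⟨Or.inr ⟨h1, hW2⟩, fun q q0 q1 _ _ => ?_, fun t ht hsub => ?_⟩
  · have hc := hole.2.2 q q0.le q1.le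
    refine ⟨hc.1, fun hlt' h0 => hC.strong_clean x hx _ _ _ (hc.2 hlt' h0), ?_⟩
    exact hs.2.right_clean W hW q.2 q1.le
  · have hb := Trap.bounds hsub
    exact hfar t ht (hsub.trans (rectSet_subset_of_lt h1 hW2 le_rfl le_rfl)) hb.1 hb.2.2.1

/-- A horizontal dominant wall can be crossed, through a hole that is not near any trap, in every
interval of length `9 g`. -/
theorem Setting.exists_crossing (hs : M.Setting P S x y u v κ 𝒱 𝒲) {W : WallValue}
    (hW : W ∈ 𝒲) {x₀ : ℝ} (hx₀ : u.1 + 20 * S.g ≤ x₀) (hx₀' : x₀ + 20 * S.g ≤ v.1) :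
    ∃ a₁ a₂ : ℤ, x₀ - 4.5 * S.g ≤ a₁ ∧ a₁ < a₂ ∧ (a₂ : ℝ) ≤ x₀ + 4.5 * S.g ∧
      M.Target S x y u v κ (a₁, W.left) ∧ M.Source S x y u v κ (a₂, W.right) .leftOpen ∧
      Reach x y (a₁, W.left) (a₂, W.right) := by
  have h10 := hs.1.scale.ten_le
  have hg := hs.1.scale.g_ge
  have hf := hs.1.scale.f_ge
  have hl : (u.2 : ℝ) + S.f / 3 ≤ W.left := hs.2.left_far W hW
  have hr : (W.right : ℝ) + S.f / 3 ≤ v.2 := hs.2.right_far W hW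
  have hlt : (W.left : ℝ) < W.right := by exact_mod_cast W.lt
  have hsz : (W.right : ℝ) ≤ W.left + S.Δ := hs.2.size W hW
  have hts : ∀ t ∈ M.trap x y, t.b₀ - t.a₀ ≤ S.Δ ∧ t.b₁ - t.a₁ ≤ S.Δ := fun t ht => by
    have := hs.1.conditions.trap_size x y hs.1.walk hs.2.walk t ht
    rwa [← hs.1.scale.Δ_eq] at this
  -- It suffices to find an interval of length `g` above and below which there are no traps.
  have key : ∀ j : ℤ, x₀ - 4.5 * S.g ≤ j → j + S.g ≤ x₀ + 4.5 * S.g →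
      (∀ t ∈ M.trap x y, t.toSet ⊆ rectSet κ u v → (j : ℝ) - S.g / 2 < t.a₀ →
        (t.a₀ : ℝ) < j + 3 / 2 * S.g - S.Δ → (W.left : ℝ) - S.g < t.a₁ →
        (t.a₁ : ℝ) < W.left + S.g → False) →
      ∃ a₁ a₂ : ℤ, x₀ - 4.5 * S.g ≤ a₁ ∧ a₁ < a₂ ∧ (a₂ : ℝ) ≤ x₀ + 4.5 * S.g ∧
      M.Target S x y u v κ (a₁, W.left) ∧ M.Source S x y u v κ (a₂, W.right) .leftOpen ∧
      Reach x y (a₁, W.left) (a₂, W.right) := by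
    intro j hj1 hj2 hT
    obtain ⟨a₁, a₂, h1, h2, hole⟩ := hs.1.hole W hW j (by linarith) (by linarith)
    have h12 : a₁ < a₂ := hole.1.2.2.1
    have h12' : (a₁ : ℝ) < a₂ := by exact_mod_cast h12
    refine ⟨a₁, a₂, by linarith, h12, by linarith,
      hs.target_of_goodHole hW hole (by linarith)
        (by exact_mod_cast (by linarith : (a₁ : ℝ) ≤ v.1)) ?_,
      hs.source_of_goodHole hW hole (by exact_mod_cast (by linarith : (u.1 : ℝ) < a₂)) ?_,
      hole.1.2.2.2.2.reach⟩
    · intro t ht hsub t0 t1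
      by_contra! hcon
      have := hts t ht
      have := t.le₀
      have := t.le₁
      exact hT t ht hsub (by linarith) (by linarith) (by linarith) (by linarith)
    · intro t ht hsub t0 t1
      by_contra! hcon
      exact hT t ht hsub (by linarith) (by linarith) (by linarith) (by linarith)
  rcases hs.exists_strip {t | t ∈ M.trap x y ∧ t.toSet ⊆ rectSet κ u v ∧
      |(t.a₀ : ℝ) - x₀| ≤ 6 * S.g ∧ |(t.a₁ : ℝ) - W.left| ≤ S.g} (fun t ht => ⟨ht.1, ht.2.1⟩)
    (fun t ht t' ht' => by
      obtain ⟨-, -, h1, h2⟩ := ht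
      obtain ⟨-, -, h3, h4⟩ := ht'
      rw [abs_le] at h1 h2 h3 h4 ⊢
      rw [abs_le]
      refine ⟨⟨?_, ?_⟩, ⟨?_, ?_⟩⟩ <;> linarith) with ⟨h, hh⟩ | ⟨h, hh⟩
  · -- A horizontal strip parallel to the wall: the hole is chosen at a long gap of the strip.
    by_cases hne : ∃ t ∈ M.trap x y, t.toSet ⊆ rectSet κ u v ∧
      |(t.a₀ : ℝ) - x₀| ≤ 6 * S.g ∧ |(t.a₁ : ℝ) - W.left| ≤ S.g
    swap
    · have f1 := Int.floor_le x₀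
      have f2 := Int.lt_floor_add_one x₀
      refine key ⌊x₀⌋ (by linarith) (by linarith) fun t ht hsub t0 t1 t2 t3 => hne ⟨t, ht, hsub, ?_⟩
      rw [abs_le, abs_le]
      refine ⟨⟨?_, ?_⟩, ⟨?_, ?_⟩⟩ <;> linarith
    obtain ⟨t₀, ht₀, hsub₀, hx0, hy0⟩ := hne
    obtain ⟨h1, h2⟩ := hh t₀ ⟨ht₀, hsub₀, hx0, hy0⟩
    have h1' : (h : ℝ) ≤ t₀.a₁ := by exact_mod_cast h1
    rw [abs_le] at hx0 hy0
    have f1 := Int.floor_le (x₀ - 4.4 * S.g)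
    have f2 := Int.lt_floor_add_one (x₀ - 4.4 * S.g)
    obtain ⟨s, s1, s2, hgap⟩ := hs.1.gap_long ⌊x₀ - 4.4 * S.g⌋ h (by linarith) (by linarith)
      (by exact_mod_cast (by linarith : (u.2 : ℝ) < h)) (by linarith)
    have e1 := Int.floor_le (s + 0.6 * S.g)
    have e2 := Int.lt_floor_add_one (s + 0.6 * S.g)
    refine key ⌊s + 0.6 * S.g⌋ (by linarith) (by linarith) fun t ht hsub t0 t1 t2 t3 => ?_
    have hht := hh t ⟨ht, hsub, by rw [abs_le]; constructor <;> linarith,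
      by rw [abs_le]; constructor <;> linarith⟩
    have hht1 : (h : ℝ) ≤ t.a₁ := by exact_mod_cast hht.1
    have := hts t ht
    refine hgap t ht ?_
    rintro r ⟨⟨r1, r2⟩, ⟨r3, r4⟩⟩
    exact ⟨⟨by linarith, by linarith⟩, ⟨by linarith, by linarith⟩⟩
  · -- A vertical strip: the hole is chosen beside the strip.
    rcases le_or_gt (h : ℝ) x₀ with hle | hgt
    · have c1 := Int.le_ceil (x₀ + 2 * S.g)
      have c2 := Int.ceil_lt_add_one (x₀ + 2 * S.g)
      refine key ⌈x₀ + 2 * S.g⌉ (by linarith) (by linarith) fun t ht hsub t0 t1 t2 t3 => ?_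
      have := (hh t ⟨ht, hsub, by rw [abs_le]; constructor <;> linarith,
        by rw [abs_le]; constructor <;> linarith⟩).2
      linarith
    · have c1 := Int.floor_le (x₀ - 3 * S.g)
      have c2 := Int.lt_floor_add_one (x₀ - 3 * S.g)
      refine key ⌊x₀ - 3 * S.g⌋ (by linarith) (by linarith) fun t ht hsub t0 t1 t2 t3 => ?_
      have hht := (hh t ⟨ht, hsub, by rw [abs_le]; constructor <;> linarith,
        by rw [abs_le]; constructor <;> linarith⟩).1
      have : (h : ℝ) ≤ t.a₀ := by exact_mod_cast hht
      linarith

/-! ### Resting points -/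

/-- If the traps near a point that is away from walls lie in a horizontal strip, there is a point
nearby that is both a source and a target. -/
theorem Setting.exists_resting_of_strip (hs : M.Setting P S x y u v κ 𝒱 𝒲) {cx cy : ℝ}
    (h0 : u.1 + 3 * S.g ≤ cx) (h1 : cx + 3 * S.g ≤ v.1) (h2 : u.2 + 3 * S.g ≤ cy)
    (h3 : cy + 3 * S.g ≤ v.2)
    (hV : ∀ D ∈ 𝒱, (D.right : ℝ) + 3 * S.g ≤ cx ∨ cx + 3 * S.g ≤ D.left)
    (hW : ∀ D ∈ 𝒲, (D.right : ℝ) + 3 * S.g ≤ cy ∨ cy + 3 * S.g ≤ D.left) {h : ℤ}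
    (hh : ∀ t ∈ M.trap x y, t.toSet ⊆ rectSet κ u v → |(t.a₀ : ℝ) - cx| ≤ 2 * S.g →
      |(t.a₁ : ℝ) - cy| ≤ 2 * S.g → h ≤ t.a₁ ∧ (t.a₁ : ℝ) ≤ h + 3 * S.Δ) :
    ∃ z : ℤ × ℤ, |(z.1 : ℝ) - cx| ≤ S.g ∧ |(z.2 : ℝ) - cy| ≤ S.g ∧
      M.Source S x y u v κ z .closed ∧ M.Target S x y u v κ z := by
  have h10 := hs.1.scale.ten_le
  have hg := hs.1.scale.g_ge
  have hts : ∀ t ∈ M.trap x y, t.b₀ - t.a₀ ≤ S.Δ ∧ t.b₁ - t.a₁ ≤ S.Δ := fun t ht => by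
    have := hs.1.conditions.trap_size x y hs.1.walk hs.2.walk t ht
    rwa [← hs.1.scale.Δ_eq] at this
  -- The point is chosen on the side of the strip that leaves more room.
  obtain ⟨cy', c1, c2, c3⟩ : ∃ cy' : ℝ, cy - 0.8 * S.g ≤ cy' ∧ cy' ≤ cy + 0.8 * S.g ∧
      ∀ a : ℝ, (h : ℝ) ≤ a → a ≤ h + 3 * S.Δ → cy' + 0.6 * S.g ≤ a ∨ a + 0.6 * S.g ≤ cy' := by
    rcases le_total (h : ℝ) cy with hle | hle
    · exact ⟨cy + 0.8 * S.g, by linarith, by linarith, fun a _ _ => by right; linarith⟩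
    · exact ⟨cy - 0.8 * S.g, by linarith, by linarith, fun a _ _ => by left; linarith⟩
  have hT : ∀ t ∈ M.trap x y, t.toSet ⊆ rectSet κ u v → |(t.a₀ : ℝ) - cx| ≤ 2 * S.g →
      |(t.a₁ : ℝ) - cy| ≤ 2 * S.g → cy' + 0.6 * S.g ≤ t.a₁ ∨ t.a₁ + 0.6 * S.g ≤ cy' :=
    fun t ht hsub a1 a2 => by
      obtain ⟨b1, b2⟩ := hh t ht hsub a1 a2
      exact c3 _ (by exact_mod_cast b1) b2
  obtain ⟨z, z1, z2, z3, z4, zu, zl⟩ := hs.exists_clean_near (cx := cx) (cy := cy')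
    (by linarith) (by linarith)
    (fun E hE ⟨e1, e2⟩ => by
      have e3 : (E.left : ℝ) < E.right := by exact_mod_cast E.lt
      obtain ⟨D, hD, d1, d2⟩ := hs.1.cover E hE
        ⟨by exact_mod_cast (by linarith : (u.1 : ℝ) ≤ E.left),
          by exact_mod_cast (by linarith : (E.right : ℝ) ≤ v.1)⟩
      have d1' : (D.left : ℝ) ≤ E.left := by exact_mod_cast d1
      have d2' : (E.right : ℝ) ≤ D.right := by exact_mod_cast d2
      rcases hV D hD with h | h <;> linarith)
    (fun E hE ⟨e1, e2⟩ => by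
      have e3 : (E.left : ℝ) < E.right := by exact_mod_cast E.lt
      obtain ⟨D, hD, d1, d2⟩ := hs.2.cover E hE
        ⟨show u.2 ≤ E.left by exact_mod_cast (by linarith : (u.2 : ℝ) ≤ E.left),
          show E.right ≤ v.2 by exact_mod_cast (by linarith : (E.right : ℝ) ≤ v.2)⟩
      have d1' : (D.left : ℝ) ≤ E.left := by exact_mod_cast d1
      have d2' : (E.right : ℝ) ≤ D.right := by exact_mod_cast d2
      rcases hW D hD with h | h <;> linarith)
    (fun t ht t0 t1 t2 t3 => by
      have := t.le₀
      have := t.le₁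
      rcases hT t ht (Trap.subset_rectSet (by linarith) (by linarith) (by linarith) (by linarith))
        (by rw [abs_le]; constructor <;> linarith) (by rw [abs_le]; constructor <;> linarith)
        with h | h <;> linarith)
  have hu0 := hs.1.nonneg
  have hu1 : 0 ≤ u.2 := hs.2.nonneg
  have hz0 : u.1 < z.1 := by exact_mod_cast (by linarith : (u.1 : ℝ) < z.1)
  have hz1 : u.2 < z.2 := by exact_mod_cast (by linarith : (u.2 : ℝ) < z.2)
  refine ⟨z, by rw [abs_le]; constructor <;> linarith, by rw [abs_le]; constructor <;> linarith,
    ⟨Or.inr ⟨hz0, hz1⟩, fun q q0 q1 _ _ => zu q q0.le q1.le, fun t ht hsub => ?_⟩,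
    ⟨by exact_mod_cast (by linarith : (z.1 : ℝ) ≤ v.1),
      by exact_mod_cast (by linarith : (z.2 : ℝ) ≤ v.2), fun p k hp p0 p1 => ?_,
      fun t ht hsub t0 t1 => ?_⟩⟩
  · by_contra! hcon
    have hb := Trap.bounds hsub
    rcases hT t ht (hsub.trans (rectSet_subset_of_lt hz0 hz1 le_rfl le_rfl))
      (by rw [abs_le]; constructor <;> linarith) (by rw [abs_le]; constructor <;> linarith)
      with h | h <;> linarith
  · have hup : u.1 ≤ p.1 ∧ u.2 ≤ p.2 := by
      rcases hp with ⟨rfl, -⟩ | hp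
      · exact ⟨le_rfl, le_rfl⟩
      · exact ⟨hp.1.le, hp.2.le⟩
    exact zl p (hu0.trans hup.1) (hu1.trans hup.2) p0.le p1.le k
  · by_contra! hcon
    have := hts t ht
    have := t.le₀
    have := t.le₁
    rcases hT t ht hsub
      (by rw [abs_le]; constructor <;> linarith) (by rw [abs_le]; constructor <;> linarith)
      with h | h <;> linarith

/-- Near any point that is away from walls there is a point that is both a source and a target: the
traps nearby lie in a strip. -/
theorem Setting.exists_resting (hs : M.Setting P S x y u v κ 𝒱 𝒲) {cx cy : ℝ}
    (h0 : u.1 + 3 * S.g ≤ cx) (h1 : cx + 3 * S.g ≤ v.1) (h2 : u.2 + 3 * S.g ≤ cy)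
    (h3 : cy + 3 * S.g ≤ v.2)
    (hV : ∀ D ∈ 𝒱, (D.right : ℝ) + 3 * S.g ≤ cx ∨ cx + 3 * S.g ≤ D.left)
    (hW : ∀ D ∈ 𝒲, (D.right : ℝ) + 3 * S.g ≤ cy ∨ cy + 3 * S.g ≤ D.left) :
    ∃ z : ℤ × ℤ, |(z.1 : ℝ) - cx| ≤ S.g ∧ |(z.2 : ℝ) - cy| ≤ S.g ∧
      M.Source S x y u v κ z .closed ∧ M.Target S x y u v κ z := by
  have h10 := hs.1.scale.ten_le
  have hg := hs.1.scale.g_ge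
  have hf := hs.1.scale.f_ge
  rcases hs.exists_strip {t | t ∈ M.trap x y ∧ t.toSet ⊆ rectSet κ u v ∧
      |(t.a₀ : ℝ) - cx| ≤ 2 * S.g ∧ |(t.a₁ : ℝ) - cy| ≤ 2 * S.g} (fun t ht => ⟨ht.1, ht.2.1⟩)
    (fun t ht t' ht' => by
      obtain ⟨-, -, h1, h2⟩ := ht
      obtain ⟨-, -, h3, h4⟩ := ht'
      rw [abs_le] at h1 h2 h3 h4 ⊢
      rw [abs_le]
      refine ⟨⟨?_, ?_⟩, ⟨?_, ?_⟩⟩ <;> linarith) with ⟨h, hh⟩ | ⟨h, hh⟩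
  · exact hs.exists_resting_of_strip h0 h1 h2 h3 hV hW
      fun t ht hsub a1 a2 => hh t ⟨ht, hsub, a1, a2⟩
  · obtain ⟨z, z1, z2, z3, z4⟩ := hs.swap.exists_resting_of_strip h2 h3 h0 h1 hW hV
      fun t ht hsub a1 a2 => hh t.swap ⟨ht, Trap.subset_swap.1 hsub, a2, a1⟩
    have z3' := z3.swap
    have z4' := z4.swap
    simp only [MazeData.swap_swap, Kind.swap_swap, Prod.swap_swap] at z3' z4'
    exact ⟨z.swap, z2, z1, z3', z4'⟩

/-! ### Following the diagonal -/

/-- The diagonal from `u` to `v` has length `L` and direction `(α, β)`. -/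
structure Diagonal (P : Params) (S : ScaleParams) (u v : ℤ × ℤ) (α β L : ℝ) : Prop where
  direction : Direction P.σ (500 * (S.g / S.f)) α β
  fst : (v.1 : ℝ) - u.1 = L * α
  snd : (v.2 : ℝ) - u.2 = L * β

omit [m.AtLeastTwo] in
theorem Diagonal.swap {α β L : ℝ} (h : Diagonal P S u v α β L) :
    Diagonal P S u.swap v.swap β α L :=
  ⟨h.direction.swap, h.snd, h.fst⟩

/-- `p` is within distance `η` of the point of the diagonal at distance `t` from `u`. -/
def NearDiagonal (u : ℤ × ℤ) (α β t η : ℝ) (p : ℤ × ℤ) : Prop :=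
  |(p.1 : ℝ) - (u.1 + t * α)| ≤ η ∧ |(p.2 : ℝ) - (u.2 + t * β)| ≤ η

/-- No wall of `𝒱` is met by the diagonal, whose coordinate starts at `a` and increases at speed
`α`, within distance `r` of its point at distance `t` from the start. -/
def ClearAt (𝒱 : Set WallValue) (a : ℤ) (α r t : ℝ) : Prop :=
  ∀ D ∈ 𝒱, ∀ τ : ℝ, (D.left : ℝ) = a + τ * α → τ ≤ t - r ∨ t + r ≤ τ

theorem NearDiagonal.swap {α β t η : ℝ} {p : ℤ × ℤ} (h : NearDiagonal u α β t η p) :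
    NearDiagonal u.swap β α t η p.swap := ⟨h.2, h.1⟩

/-- Moving along the diagonal in the absence of walls. -/
theorem Setting.reach_along (hs : M.Setting P S x y u v κ 𝒱 𝒲) {α β : ℝ}
    (hd : Direction P.σ (500 * (S.g / S.f)) α β) {p q : ℤ × ℤ} {k : Kind}
    (hp : M.Source S x y u v κ p k) (hq : M.Target S x y u v κ q) {ℓ η : ℝ} (hℓ : 0 < ℓ)
    (hη : 0 ≤ η) (hℓη : ℓ + η ≤ S.f) (hηℓ : 1.2 * η ≤ 300 * (S.g / S.f) * ℓ)
    (a1 : ℓ * α - η ≤ (q.1 : ℝ) - p.1) (a2 : (q.1 : ℝ) - p.1 ≤ ℓ * α + η)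
    (b1 : ℓ * β - η ≤ (q.2 : ℝ) - p.2) (b2 : (q.2 : ℝ) - p.2 ≤ ℓ * β + η)
    (hV : ∀ D ∈ 𝒱, (D.right : ℝ) ≤ p.1 ∨ (q.1 : ℝ) ≤ D.left)
    (hW : ∀ D ∈ 𝒲, (D.right : ℝ) ≤ p.2 ∨ (q.2 : ℝ) ≤ D.left) : Reach x y p q := by
  have h10 := hs.1.scale.ten_le
  have hg := hs.1.scale.g_ge
  have hf := hs.1.scale.f_ge
  have hσ := hd.σ_nonneg
  have hσ1 := hd.σ_le
  obtain ⟨ε, hε⟩ : ∃ ε, ε = S.g / S.f := ⟨_, rfl⟩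
  have hε0 : 0 < ε := by rw [hε]; exact div_pos (by linarith) (by linarith)
  have hε1 : ε ≤ 1 / 10000 := by rw [hε, div_le_iff₀ (by linarith)]; linarith
  rw [← hε] at hd hηℓ
  have hαℓ : ℓ * α ≤ ℓ := by nlinarith [hd.α_le]
  have hβℓ : ℓ * β ≤ ℓ := by nlinarith [hd.β_le]
  have l1 := mul_le_mul_of_nonneg_left hd.left hℓ.le
  have l2 := mul_le_mul_of_nonneg_left hd.right hℓ.le
  have l3 := mul_le_mul_of_nonneg_left hd.c_le_α hℓ.le
  have l4 := mul_le_mul_of_nonneg_left hd.c_le_β hℓ.le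
  have m1 : P.σ * η ≤ 1 / 10 * η := mul_le_mul_of_nonneg_right hσ1 hη
  have m2 : ε * η ≤ 1 / 10000 * η := mul_le_mul_of_nonneg_right hε1 hη
  have m3 : 0 < ε * ℓ := mul_pos hε0 hℓ
  have n1 := mul_le_mul_of_nonneg_left a2 hσ
  have n2 := mul_le_mul_of_nonneg_left b2 hσ
  have r1 : ε * ((q.1 : ℝ) - p.1) ≤ ε * (ℓ + η) :=
    mul_le_mul_of_nonneg_left (by linarith) hε0.le
  have r2 : ε * ((q.2 : ℝ) - p.2) ≤ ε * (ℓ + η) :=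
    mul_le_mul_of_nonneg_left (by linarith) hε0.le
  have hle := hp.le
  refine hs.reach_of_wallFree hp hq ?_ ?_ rfl rfl (by linarith) (by linarith) (by linarith)
    (by linarith) ?_ ?_ ?_ ?_
  · intro E hE ⟨e1, e2⟩
    have e3 := E.lt
    obtain ⟨D, hD, d1, d2⟩ := hs.1.cover E hE ⟨hle.1.trans e1, e2.trans hq.le₀⟩
    rcases hV D hD with h | h
    · have : D.right ≤ p.1 := by exact_mod_cast h
      omega
    · have : q.1 ≤ D.left := by exact_mod_cast h
      omega
  · intro E hE ⟨e1, e2⟩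
    have e3 := E.lt
    obtain ⟨D, hD, d1, d2⟩ := hs.2.cover E hE ⟨hle.2.trans e1, e2.trans hq.le₁⟩
    rcases hW D hD with h | h
    · have : D.right ≤ p.2 := by exact_mod_cast h
      omega
    · have : q.2 ≤ D.left := by exact_mod_cast h
      omega
  all_goals rw [← hε]; linarith

omit [m.AtLeastTwo] in
/-- The walls of one axis, relative to a segment of the diagonal that is clear at its ends. -/
theorem ClearAt.cases {α Δ f g t t' : ℝ} {a : ℤ} (h : ClearAt 𝒱 a α (0.12 * f) t)
    (h' : ClearAt 𝒱 a α (0.12 * f) t') (hα : 500 * (g / f) ≤ α) (hf : 0 < f) (hg : 0 < g)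
    (hΔ : Δ ≤ g) (hsize : ∀ D ∈ 𝒱, (D.right : ℝ) ≤ D.left + Δ) {D : WallValue} (hD : D ∈ 𝒱) :
    (D.right : ℝ) + 50 * g ≤ a + t * α ∨ a + t' * α + 50 * g ≤ D.left ∨
      ∃ τ, t + 0.12 * f ≤ τ ∧ τ ≤ t' - 0.12 * f ∧ (D.left : ℝ) = a + τ * α := by
  have hα0 : 0 < α := lt_of_lt_of_le (by positivity) hα
  have h60 : 60 * g ≤ 0.12 * f * α := by
    have := mul_le_mul_of_nonneg_left hα (show 0 ≤ 0.12 * f by positivity)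
    calc 60 * g = 0.12 * f * (500 * (g / f)) := by field_simp; ring
      _ ≤ _ := this
  have hτ : (D.left : ℝ) = a + ((D.left : ℝ) - a) / α * α := by field_simp; ring
  have hs := hsize D hD
  rcases h D hD _ hτ with h1 | h1
  · left
    have := mul_le_mul_of_nonneg_right h1 hα0.le
    linarith
  rcases h' D hD _ hτ with h2 | h2
  · exact Or.inr (Or.inr ⟨_, h1, h2, hτ⟩)
  · right; left
    have := mul_le_mul_of_nonneg_right h2 hα0.le
    linarith

/-- A segment of the diagonal that meets a horizontal wall and no vertical one. -/
theorem Setting.reach_through_wall (hs : M.Setting P S x y u v κ 𝒱 𝒲) {α β L t t' τ : ℝ}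
    (hL : Diagonal P S u v α β L) {p q : ℤ × ℤ} {k : Kind} (hp : M.Source S x y u v κ p k)
    (hq : M.Target S x y u v κ q) (hpt : NearDiagonal u α β t S.g p)
    (hqt : NearDiagonal u α β t' S.g q) (ht : 0 ≤ t) (ht' : t' ≤ L) (htt : t' - t ≤ 0.9 * S.f)
    (hV : ∀ D ∈ 𝒱, (D.right : ℝ) + 50 * S.g ≤ u.1 + t * α ∨ u.1 + t' * α + 50 * S.g ≤ D.left)
    {W : WallValue} (hW : W ∈ 𝒲) (hτ1 : t + 0.12 * S.f ≤ τ) (hτ2 : τ ≤ t' - 0.12 * S.f)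
    (hWτ : (W.left : ℝ) = u.2 + τ * β)
    (hW' : ∀ D ∈ 𝒲, (D.right : ℝ) + 50 * S.g ≤ u.2 + t * β ∨ u.2 + t' * β + 50 * S.g ≤ D.left ∨
      (D.left = W.left ∧ D.right = W.right)) : Reach x y p q := by
  have h10 := hs.1.scale.ten_le
  have hg := hs.1.scale.g_ge
  have hf := hs.1.scale.f_ge
  have hd := hL.direction
  have hf0 : 0 < S.f := by linarith
  have hα0 : 0 ≤ α := hd.c_pos.le.trans hd.c_le_α
  have hβ0 : 0 ≤ β := hd.c_pos.le.trans hd.c_le_β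
  have hεf : S.g / S.f * S.f = S.g := by field_simp
  have hsz : (W.right : ℝ) ≤ W.left + S.Δ := hs.2.size W hW
  have hlt : (W.left : ℝ) < W.right := by exact_mod_cast W.lt
  have h60 : 60 * S.g ≤ 0.12 * S.f * α := by
    have := mul_le_mul_of_nonneg_left hd.c_le_α (show 0 ≤ 0.12 * S.f by positivity)
    linarith
  have i1 : 0.12 * S.f * α ≤ τ * α := mul_le_mul_of_nonneg_right (by linarith) hα0
  have i2 : 0.12 * S.f * α ≤ (L - τ) * α := mul_le_mul_of_nonneg_right (by linarith) hα0
  have i3 : t * α ≤ τ * α := mul_le_mul_of_nonneg_right (by linarith) hα0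
  have i4 : τ * α ≤ t' * α := mul_le_mul_of_nonneg_right (by linarith) hα0
  have j3 : t * β ≤ τ * β := mul_le_mul_of_nonneg_right (by linarith) hβ0
  have j4 : τ * β ≤ t' * β := mul_le_mul_of_nonneg_right (by linarith) hβ0
  have hε0 : 0 < S.g / S.f := div_pos (by linarith) hf0
  have k1 : S.g / S.f * (0.12 * S.f) ≤ S.g / S.f * (τ - t) :=
    mul_le_mul_of_nonneg_left (by linarith) hε0.le
  have k2 : S.g / S.f * (0.12 * S.f) ≤ S.g / S.f * (t' - τ) :=
    mul_le_mul_of_nonneg_left (by linarith) hε0.le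
  have hfst := hL.fst
  obtain ⟨hp0, hp1⟩ := hpt
  obtain ⟨hq0, hq1⟩ := hqt
  rw [abs_le] at hp0 hp1 hq0 hq1
  obtain ⟨a₁, a₂, c1, c2, c3, hT, hS, hR⟩ := hs.exists_crossing hW (x₀ := u.1 + τ * α)
    (by linarith) (by linarith)
  have c2' : (a₁ : ℝ) < a₂ := by exact_mod_cast c2
  refine (hs.reach_along hd hp hT (ℓ := τ - t) (η := 5.5 * S.g) (by linarith) (by linarith)
    (by linarith) (by linarith) ?_ ?_ ?_ ?_ ?_ ?_).trans (hR.trans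
    (hs.reach_along hd hS hq (ℓ := t' - τ) (η := 5.5 * S.g) (by linarith) (by linarith)
    (by linarith) (by linarith) ?_ ?_ ?_ ?_ ?_ ?_))
  · simp only; linarith
  · simp only; linarith
  · simp only; linarith
  · simp only; linarith
  · intro D hD
    rcases hV D hD with h | h
    · left; linarith
    · right; simp only; linarith
  · intro D hD
    rcases hW' D hD with h | h | h
    · left; linarith
    · right; simp only; linarith
    · right; simp only [h.1, le_refl]
  · simp only; linarith
  · simp only; linarith
  · simp only; linarith
  · simp only; linarith
  · intro D hD
    rcases hV D hD with h | h
    · left; simp only; linarith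
    · right; linarith
  · intro D hD
    rcases hW' D hD with h | h | h
    · left; simp only; linarith
    · right; linarith
    · left; simp only [h.2, le_refl]

set_option maxHeartbeats 800000 in
/-- A segment of the diagonal that meets a horizontal wall and then a vertical one.  The horizontal
wall is crossed to the left of the diagonal and the vertical one above it, which leaves room to
manoeuvre between the two walls, however near to each other they are met. -/
theorem Setting.reach_through_walls (hs : M.Setting P S x y u v κ 𝒱 𝒲) {α β L t t' τ τ' : ℝ}
    (hL : Diagonal P S u v α β L) {p q : ℤ × ℤ} {k : Kind} (hp : M.Source S x y u v κ p k)
    (hq : M.Target S x y u v κ q) (hpt : NearDiagonal u α β t S.g p)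
    (hqt : NearDiagonal u α β t' S.g q) (ht : 0 ≤ t) (ht' : t' ≤ L) (htt : t' - t ≤ 0.9 * S.f)
    {V W : WallValue} (hV : V ∈ 𝒱) (hW : W ∈ 𝒲) (hτ1 : t + 0.12 * S.f ≤ τ) (hττ : τ ≤ τ')
    (hτ2 : τ' ≤ t' - 0.12 * S.f)
    (hWτ : (W.left : ℝ) = u.2 + τ * β) (hVτ : (V.left : ℝ) = u.1 + τ' * α)
    (hV' : ∀ D ∈ 𝒱, (D.right : ℝ) + 50 * S.g ≤ u.1 + t * α ∨ u.1 + t' * α + 50 * S.g ≤ D.left ∨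
      (D.left = V.left ∧ D.right = V.right))
    (hW' : ∀ D ∈ 𝒲, (D.right : ℝ) + 50 * S.g ≤ u.2 + t * β ∨ u.2 + t' * β + 50 * S.g ≤ D.left ∨
      (D.left = W.left ∧ D.right = W.right)) : Reach x y p q := by
  have h10 := hs.1.scale.ten_le
  have hg := hs.1.scale.g_ge
  have hf := hs.1.scale.f_ge
  have hd := hL.direction
  have hf0 : 0 < S.f := by linarith
  have hα0 : 0 ≤ α := hd.c_pos.le.trans hd.c_le_α
  have hβ0 : 0 ≤ β := hd.c_pos.le.trans hd.c_le_β
  have hεf : S.g / S.f * S.f = S.g := by field_simp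
  have hsz : (W.right : ℝ) ≤ W.left + S.Δ := hs.2.size W hW
  have hlt : (W.left : ℝ) < W.right := by exact_mod_cast W.lt
  have hszV : (V.right : ℝ) ≤ V.left + S.Δ := hs.1.size V hV
  have hltV : (V.left : ℝ) < V.right := by exact_mod_cast V.lt
  have h60 : 60 * S.g ≤ 0.12 * S.f * α := by
    have := mul_le_mul_of_nonneg_left hd.c_le_α (show 0 ≤ 0.12 * S.f by positivity)
    linarith
  have h60' : 60 * S.g ≤ 0.12 * S.f * β := by
    have := mul_le_mul_of_nonneg_left hd.c_le_β (show 0 ≤ 0.12 * S.f by positivity)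
    linarith
  have i1 : 0.12 * S.f * α ≤ τ * α := mul_le_mul_of_nonneg_right (by linarith) hα0
  have i2 : 0.12 * S.f * α ≤ (L - τ) * α := mul_le_mul_of_nonneg_right (by linarith) hα0
  have i3 : t * α ≤ τ * α := mul_le_mul_of_nonneg_right (by linarith) hα0
  have i4 : τ * α ≤ τ' * α := mul_le_mul_of_nonneg_right (by linarith) hα0
  have i5 : τ' * α ≤ t' * α := mul_le_mul_of_nonneg_right (by linarith) hα0
  have j1 : 0.12 * S.f * β ≤ τ' * β := mul_le_mul_of_nonneg_right (by linarith) hβ0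
  have j2 : 0.12 * S.f * β ≤ (L - τ') * β := mul_le_mul_of_nonneg_right (by linarith) hβ0
  have j3 : t * β ≤ τ * β := mul_le_mul_of_nonneg_right (by linarith) hβ0
  have j4 : τ * β ≤ τ' * β := mul_le_mul_of_nonneg_right (by linarith) hβ0
  have j5 : τ' * β ≤ t' * β := mul_le_mul_of_nonneg_right (by linarith) hβ0
  have hε0 : 0 < S.g / S.f := div_pos (by linarith) hf0
  have k1 : S.g / S.f * (0.12 * S.f) ≤ S.g / S.f * (τ - t) :=
    mul_le_mul_of_nonneg_left (by linarith) hε0.le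
  have k2 : S.g / S.f * (0.12 * S.f) ≤ S.g / S.f * (t' - τ') :=
    mul_le_mul_of_nonneg_left (by linarith) hε0.le
  have hfst := hL.fst
  have hsnd := hL.snd
  obtain ⟨hp0, hp1⟩ := hpt
  obtain ⟨hq0, hq1⟩ := hqt
  rw [abs_le] at hp0 hp1 hq0 hq1
  obtain ⟨a₁, a₂, c1, c2, c3, hT, hS, hR⟩ := hs.exists_crossing hW
    (x₀ := u.1 + τ * α - 10 * S.g) (by linarith) (by linarith)
  obtain ⟨b₁, b₂, d1, d2, d3, hT', hS', hR'⟩ := hs.swap.exists_crossing hV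
    (x₀ := u.2 + τ' * β + 10 * S.g) (by simp only [Prod.fst_swap]; linarith)
    (by simp only [Prod.fst_swap]; linarith)
  replace hT' := hT'.swap
  replace hS' := hS'.swap
  replace hR' := hR'.swap
  simp only [MazeData.swap_swap, Kind.swap_swap, Prod.swap_swap, Prod.swap_prod_mk] at hT' hS' hR'
  have c2' : (a₁ : ℝ) < a₂ := by exact_mod_cast c2
  have d2' : (b₁ : ℝ) < b₂ := by exact_mod_cast d2
  have first : Reach x y p (a₁, W.left) := by
    refine hs.reach_along hd hp hT (ℓ := τ - t) (η := 15.5 * S.g) (by linarith) (by linarith)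
      (by linarith) (by linarith) ?_ ?_ ?_ ?_ ?_ ?_
    · simp only; linarith
    · simp only; linarith
    · simp only; linarith
    · simp only; linarith
    · intro D hD
      rcases hV' D hD with h | h | h
      · left; linarith
      · right; simp only; linarith
      · right; simp only [h.1]; linarith
    · intro D hD
      rcases hW' D hD with h | h | h
      · left; linarith
      · right; simp only; linarith
      · right; simp only [h.1, le_refl]
  have last : Reach x y (V.right, b₂) q := by
    refine hs.reach_along hd hS' hq (ℓ := t' - τ') (η := 15.5 * S.g) (by linarith) (by linarith)
      (by linarith) (by linarith) ?_ ?_ ?_ ?_ ?_ ?_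
    · simp only; linarith
    · simp only; linarith
    · simp only; linarith
    · simp only; linarith
    · intro D hD
      rcases hV' D hD with h | h | h
      · left; simp only; linarith
      · right; linarith
      · left; simp only [h.2, le_refl]
    · intro D hD
      rcases hW' D hD with h | h | h
      · left; simp only; linarith
      · right; linarith
      · left; simp only [h.2]; linarith
  have middle : Reach x y (a₂, W.right) (V.left, b₁) := by
    have hℓ : 0 ≤ τ' - τ := by linarith
    have hσ := hd.σ_nonneg
    have hσ1 := hd.σ_le
    have hε1 : S.g / S.f ≤ 1 / 10000 := by rw [div_le_iff₀ hf0]; linarith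
    have l1 := mul_le_mul_of_nonneg_left hd.left hℓ
    have l2 := mul_le_mul_of_nonneg_left hd.right hℓ
    have hαℓ : (τ' - τ) * α ≤ τ' - τ := mul_le_of_le_one_right hℓ hd.α_le
    have hβℓ : (τ' - τ) * β ≤ τ' - τ := mul_le_of_le_one_right hℓ hd.β_le
    have m1 : P.σ * (14.5 * S.g) ≤ 1 / 10 * (14.5 * S.g) :=
      mul_le_mul_of_nonneg_right hσ1 (by linarith)
    have m2 : S.g / S.f * (14.5 * S.g) ≤ 1 / 10000 * (14.5 * S.g) :=
      mul_le_mul_of_nonneg_right hε1 (by linarith)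
    have m3 : 0 ≤ S.g / S.f * (τ' - τ) := mul_nonneg hε0.le hℓ
    obtain ⟨A, hA⟩ : ∃ A : ℝ, A = (V.left : ℝ) - a₂ := ⟨_, rfl⟩
    obtain ⟨B, hB⟩ : ∃ B : ℝ, B = (b₁ : ℝ) - W.right := ⟨_, rfl⟩
    have hA2 : A ≤ (τ' - τ) * α + 14.5 * S.g := by linarith
    have hB2 : B ≤ (τ' - τ) * β + 14.5 * S.g := by linarith
    have n1 := mul_le_mul_of_nonneg_left hA2 hσ
    have n2 := mul_le_mul_of_nonneg_left hB2 hσ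
    have r1 : S.g / S.f * A ≤ S.g / S.f * (τ' - τ + 14.5 * S.g) :=
      mul_le_mul_of_nonneg_left (by linarith) hε0.le
    have r2 : S.g / S.f * B ≤ S.g / S.f * (τ' - τ + 14.5 * S.g) :=
      mul_le_mul_of_nonneg_left (by linarith) hε0.le
    have hA1 : (τ' - τ) * α + 5.5 * S.g ≤ A := by linarith
    have hB1 : (τ' - τ) * β + 5.4 * S.g ≤ B := by linarith
    have s1 : 0 ≤ (τ' - τ) * α := mul_nonneg hℓ hα0
    have s2 : 0 ≤ (τ' - τ) * β := mul_nonneg hℓ hβ0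
    refine hs.reach_of_wallFree hS hT' ?_ ?_ hA.symm hB.symm (by linarith) (by linarith)
      (by linarith) (by linarith) (by linarith) (by linarith) (by linarith) (by linarith)
    · intro E hE ⟨e1, e2⟩
      have e3 := E.lt
      obtain ⟨D, hD, q1, q2⟩ := hs.1.cover E hE ⟨hS.le.1.trans e1, e2.trans hT'.le₀⟩
      have e1' : (a₂ : ℝ) ≤ E.left := by exact_mod_cast e1
      have e2' : (E.right : ℝ) ≤ V.left := by exact_mod_cast e2
      have e3' : (E.left : ℝ) < E.right := by exact_mod_cast e3
      have q1' : (D.left : ℝ) ≤ E.left := by exact_mod_cast q1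
      have q2' : (E.right : ℝ) ≤ D.right := by exact_mod_cast q2
      rcases hV' D hD with h | h | h
      · linarith
      · linarith
      · rw [h.1] at q1'; linarith
    · intro E hE ⟨e1, e2⟩
      have e3 := E.lt
      obtain ⟨D, hD, q1, q2⟩ := hs.2.cover E hE ⟨hS.le.2.trans e1, e2.trans hT'.le₁⟩
      have e1' : (W.right : ℝ) ≤ E.left := by exact_mod_cast e1
      have e2' : (E.right : ℝ) ≤ b₁ := by exact_mod_cast e2
      have e3' : (E.left : ℝ) < E.right := by exact_mod_cast e3
      have q1' : (D.left : ℝ) ≤ E.left := by exact_mod_cast q1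
      have q2' : (E.right : ℝ) ≤ D.right := by exact_mod_cast q2
      rcases hW' D hD with h | h | h
      · linarith
      · linarith
      · rw [h.2] at q2'; linarith
  exact first.trans (hR.trans (middle.trans (hR'.trans last)))

/-! ### From corner to corner -/

theorem Setting.source (hs : M.Setting P S x y u v κ 𝒱 𝒲) : M.Source S x y u v κ u κ := by
  have hg : 0 ≤ S.g := by linarith [hs.1.scale.g_ge, hs.1.scale.ten_le]
  have hu0 := hs.1.nonneg
  have hu1 : 0 ≤ u.2 := hs.2.nonneg
  have hl0 := hs.1.lt
  have hl1 : u.2 < v.2 := hs.2.lt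
  obtain ⟨c1, c2, c3⟩ := hs.1.clean_lower
  refine ⟨Or.inl ⟨rfl, rfl⟩, fun q q0 q1 q2 q3 => ⟨fun _ _ => ?_, fun _ _ => ?_, fun _ _ => ?_⟩,
    fun t ht hsub => ?_⟩
  · exact hs.1.conditions.mono_trapClean_lower x y hs.1.walk hs.2.walk u v q hu0 hu1 hl0 hl1 q0 q1
      κ κ (rectSet_mono_right q2 q3) (c1 hl0 hl1)
  · exact (hs.1.conditions.mono_lower x hs.1.walk u.1 v.1 q.1 hu0 q0 q2).1 (c2 hl0 fun _ => hu0)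
  · exact (hs.2.conditions.mono_lower y hs.2.walk u.2 v.2 q.2 hu1 q1 q3).1 (c3 hl1 fun _ => hu1)
  · rcases hs.1.far_lower t ht hsub with h | h
    · left; linarith
    · right; linarith

theorem Setting.target (hs : M.Setting P S x y u v κ 𝒱 𝒲) : M.Target S x y u v κ v := by
  have hg : 0 ≤ S.g := by linarith [hs.1.scale.g_ge, hs.1.scale.ten_le]
  have hu0 := hs.1.nonneg
  have hu1 : 0 ≤ u.2 := hs.2.nonneg
  have hl0 := hs.1.lt
  have hl1 : u.2 < v.2 := hs.2.lt
  have hcl := hs.1.clean_upper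
  refine ⟨le_rfl, le_rfl, fun p k hp p0 p1 => ?_, fun t ht hsub _ _ => ?_⟩
  · rcases hp with ⟨rfl, rfl⟩ | hp
    · exact hcl
    obtain ⟨c1, c2, c3⟩ := hcl
    refine ⟨fun _ _ => ?_, fun _ _ => ?_, fun _ _ => ?_⟩
    · exact hs.1.conditions.mono_trapClean_upper x y hs.1.walk hs.2.walk u p v hu0 hu1 hl0 hl1
        (by omega) (by omega) p0 p1 κ k (rectSet_subset_of_lt hp.1 hp.2 le_rfl le_rfl) (c1 hl0 hl1)
    · exact (hs.1.conditions.mono_upper x hs.1.walk u.1 p.1 v.1 (by omega) hp.1.le p0).1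
        (c2 hl0 (by simp))
    · exact (hs.2.conditions.mono_upper y hs.2.walk u.2 p.2 v.2 (by omega) hp.2.le p1).1
        (c3 hl1 (by simp))
  · rcases hs.1.far_upper t ht hsub with h | h
    · left; linarith
    · right; linarith

/-- Two walls met by the diagonal at parameters closer than `f` coincide. -/
theorem HalfSetting.eq_of_near (h : M.HalfSetting P S x y u v κ 𝒱 𝒲) {α τ τ' : ℝ} (hα : 0 < α)
    (hα1 : α ≤ 1) {D D' : WallValue} (hD : D ∈ 𝒱) (hD' : D' ∈ 𝒱)
    (hτ : (D.left : ℝ) = u.1 + τ * α) (hτ' : (D'.left : ℝ) = u.1 + τ' * α)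
    (h1 : |τ - τ'| ≤ S.f) : D.left = D'.left ∧ D.right = D'.right := by
  have hf : 0 ≤ S.f := (abs_nonneg _).trans h1
  rw [abs_le] at h1
  have h2 : (τ - τ') * α ≤ S.f := by nlinarith
  have h3 : -S.f ≤ (τ - τ') * α := by nlinarith
  rcases h.sep D hD D' hD' with h | h | h
  · exact h
  · linarith
  · linarith

/-- Between points of the diagonal that are away from the walls and from each other, but not too
far from each other, the diagonal can be followed. -/
theorem Setting.reach_segment (hs : M.Setting P S x y u v κ 𝒱 𝒲) {α β L t t' : ℝ}
    (hL : Diagonal P S u v α β L) {p q : ℤ × ℤ} {k : Kind} (hp : M.Source S x y u v κ p k)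
    (hq : M.Target S x y u v κ q) (hpt : NearDiagonal u α β t S.g p)
    (hqt : NearDiagonal u α β t' S.g q) (ht : 0 ≤ t) (ht' : t' ≤ L) (htt : 0.1 * S.f ≤ t' - t)
    (htt' : t' - t ≤ 0.9 * S.f)
    (cV : ClearAt 𝒱 u.1 α (0.12 * S.f) t) (cV' : ClearAt 𝒱 u.1 α (0.12 * S.f) t')
    (cW : ClearAt 𝒲 u.2 β (0.12 * S.f) t) (cW' : ClearAt 𝒲 u.2 β (0.12 * S.f) t') :
    Reach x y p q := by
  have h10 := hs.1.scale.ten_le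
  have hg := hs.1.scale.g_ge
  have hf := hs.1.scale.f_ge
  have hd := hL.direction
  have hα0 : 0 < α := hd.c_pos.trans_le hd.c_le_α
  have hβ0 : 0 < β := hd.c_pos.trans_le hd.c_le_β
  have kV := fun D hD => cV.cases cV' hd.c_le_α (by linarith) (by linarith)
    (by linarith : S.Δ ≤ S.g) hs.1.size (D := D) hD
  have kW := fun D hD => cW.cases cW' hd.c_le_β (by linarith) (by linarith)
    (by linarith : S.Δ ≤ S.g) hs.2.size (D := D) hD
  by_cases hV : ∃ V ∈ 𝒱, ∃ τ, t + 0.12 * S.f ≤ τ ∧ τ ≤ t' - 0.12 * S.f ∧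
      (V.left : ℝ) = u.1 + τ * α
  · obtain ⟨V, hVm, τ, τ1, τ2, hVτ⟩ := hV
    have hV' : ∀ D ∈ 𝒱, (D.right : ℝ) + 50 * S.g ≤ u.1 + t * α ∨
        u.1 + t' * α + 50 * S.g ≤ D.left ∨ (D.left = V.left ∧ D.right = V.right) := by
      intro D hD
      rcases kV D hD with h | h | ⟨τ', h1, h2, h3⟩
      · exact Or.inl h
      · exact Or.inr (Or.inl h)
      · exact Or.inr (Or.inr (hs.1.eq_of_near hα0 hd.α_le hD hVm h3 hVτ
          (by rw [abs_le]; constructor <;> linarith)))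
    by_cases hW : ∃ W ∈ 𝒲, ∃ τ, t + 0.12 * S.f ≤ τ ∧ τ ≤ t' - 0.12 * S.f ∧
        (W.left : ℝ) = u.2 + τ * β
    · obtain ⟨W, hWm, ρ, ρ1, ρ2, hWρ⟩ := hW
      have hW' : ∀ D ∈ 𝒲, (D.right : ℝ) + 50 * S.g ≤ u.2 + t * β ∨
          u.2 + t' * β + 50 * S.g ≤ D.left ∨ (D.left = W.left ∧ D.right = W.right) := by
        intro D hD
        rcases kW D hD with h | h | ⟨τ', h1, h2, h3⟩
        · exact Or.inl h
        · exact Or.inr (Or.inl h)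
        · exact Or.inr (Or.inr (hs.2.eq_of_near hβ0 hd.β_le hD hWm h3 hWρ
            (by rw [abs_le]; constructor <;> linarith)))
      rcases le_total ρ τ with h | h
      · exact hs.reach_through_walls hL hp hq hpt hqt ht ht' htt' hVm hWm ρ1 h τ2 hWρ hVτ hV' hW'
      · exact (hs.swap.reach_through_walls hL.swap hp.swap hq.swap hpt.swap hqt.swap ht ht' htt'
          hWm hVm τ1 h ρ2 hVτ hWρ hW' hV').swap
    · refine (hs.swap.reach_through_wall hL.swap hp.swap hq.swap hpt.swap hqt.swap ht ht' htt'
        (fun D hD => ?_) hVm τ1 τ2 hVτ hV').swap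
      rcases kW D hD with h | h | h
      · exact Or.inl h
      · exact Or.inr h
      · exact absurd ⟨D, hD, h⟩ hW
  · have hV' : ∀ D ∈ 𝒱, (D.right : ℝ) + 50 * S.g ≤ u.1 + t * α ∨
        u.1 + t' * α + 50 * S.g ≤ D.left := by
      intro D hD
      rcases kV D hD with h | h | h
      · exact Or.inl h
      · exact Or.inr h
      · exact absurd ⟨D, hD, h⟩ hV
    by_cases hW : ∃ W ∈ 𝒲, ∃ τ, t + 0.12 * S.f ≤ τ ∧ τ ≤ t' - 0.12 * S.f ∧
        (W.left : ℝ) = u.2 + τ * β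
    · obtain ⟨W, hWm, ρ, ρ1, ρ2, hWρ⟩ := hW
      refine hs.reach_through_wall hL hp hq hpt hqt ht ht' htt' hV' hWm ρ1 ρ2 hWρ fun D hD => ?_
      rcases kW D hD with h | h | ⟨τ', h1, h2, h3⟩
      · exact Or.inl h
      · exact Or.inr (Or.inl h)
      · exact Or.inr (Or.inr (hs.2.eq_of_near hβ0 hd.β_le hD hWm h3 hWρ
          (by rw [abs_le]; constructor <;> linarith)))
    · obtain ⟨hp0, hp1⟩ := hpt
      obtain ⟨hq0, hq1⟩ := hqt
      rw [abs_le] at hp0 hp1 hq0 hq1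
      have hε : S.g / S.f * S.f = S.g := div_mul_cancel₀ _ (by linarith)
      have hε0 : 0 ≤ S.g / S.f := div_nonneg (by linarith) (by linarith)
      refine hs.reach_along hd hp hq (ℓ := t' - t) (η := 2 * S.g) (by linarith) (by linarith)
        (by linarith) ?_ (by linarith) (by linarith) (by linarith) (by linarith)
        (fun D hD => ?_) (fun D hD => ?_)
      · have := mul_le_mul_of_nonneg_left htt hε0
        linarith
      · rcases hV' D hD with h | h
        · left; linarith
        · right; linarith
      · rcases kW D hD with h | h | h
        · left; linarith
        · right; linarith
        · exact absurd ⟨D, hD, h⟩ hW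

theorem HalfSetting.clearAt_start (h : M.HalfSetting P S x y u v κ 𝒱 𝒲) {α : ℝ}
    (hα : 0 < α) (hα1 : α ≤ 1) : ClearAt 𝒱 u.1 α (0.12 * S.f) 0 := by
  intro D hD τ hτ
  have hf : 0 ≤ S.f := by linarith [h.scale.g_ge, h.scale.ten_le, h.scale.f_ge]
  have h1 := h.left_far D hD
  right
  by_contra! hlt
  nlinarith

theorem HalfSetting.clearAt_end (h : M.HalfSetting P S x y u v κ 𝒱 𝒲) {α L : ℝ}
    (hα : 0 < α) (hα1 : α ≤ 1) (hL : (v.1 : ℝ) - u.1 = L * α) :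
    ClearAt 𝒱 u.1 α (0.12 * S.f) L := by
  intro D hD τ hτ
  have hf : 0 ≤ S.f := by linarith [h.scale.g_ge, h.scale.ten_le, h.scale.f_ge]
  have h1 := h.right_far D hD
  have h2 : (D.left : ℝ) < D.right := by exact_mod_cast D.lt
  left
  by_contra! hlt
  have h3 : (L - τ) * α < S.f / 3 := by nlinarith
  linarith

/-- At two points of the diagonal, neither too near to each other nor too far from each other,
there cannot both be walls, since walls are separated. -/
theorem HalfSetting.clearAt_or (h : M.HalfSetting P S x y u v κ 𝒱 𝒲) {α c c' : ℝ} (hα : 0 < α)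
    (hα1 : α ≤ 1) (h1 : 0.25 * S.f ≤ c' - c) (h2 : c' - c ≤ 0.5 * S.f) :
    ClearAt 𝒱 u.1 α (0.12 * S.f) c ∨ ClearAt 𝒱 u.1 α (0.12 * S.f) c' := by
  have hf : 0 < S.f := by linarith [h.scale.g_ge, h.scale.ten_le, h.scale.f_ge]
  by_contra! hcon
  simp only [ClearAt] at hcon
  push Not at hcon
  obtain ⟨⟨D, hD, τ, hτ, a1, a2⟩, D', hD', τ', hτ', b1, b2⟩ := hcon
  have heq := (h.eq_of_near hα hα1 hD hD' hτ hτ' (by rw [abs_le]; constructor <;> linarith)).1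
  rw [heq, hτ'] at hτ
  have : τ' = τ := mul_right_cancel₀ hα.ne' (by linarith)
  linarith

/-- Within distance `0.75 f` on the diagonal there is a point away from all walls. -/
theorem Setting.exists_clearAt (hs : M.Setting P S x y u v κ 𝒱 𝒲) {α β : ℝ} (hα : 0 < α)
    (hα1 : α ≤ 1) (hβ : 0 < β) (hβ1 : β ≤ 1) (t : ℝ) :
    ∃ c, t + 0.25 * S.f ≤ c ∧ c ≤ t + 0.75 * S.f ∧ ClearAt 𝒱 u.1 α (0.12 * S.f) c ∧
      ClearAt 𝒲 u.2 β (0.12 * S.f) c := by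
  have hf : 0 < S.f := by linarith [hs.1.scale.g_ge, hs.1.scale.ten_le, hs.1.scale.f_ge]
  have key : ∀ {c c' : ℝ}, 0.25 * S.f ≤ c' - c → c' - c ≤ 0.5 * S.f →
      (ClearAt 𝒱 u.1 α (0.12 * S.f) c ∨ ClearAt 𝒱 u.1 α (0.12 * S.f) c') ∧
      (ClearAt 𝒲 u.2 β (0.12 * S.f) c ∨ ClearAt 𝒲 u.2 β (0.12 * S.f) c') :=
    fun h1 h2 => ⟨hs.1.clearAt_or hα hα1 h1 h2, hs.2.clearAt_or hβ hβ1 h1 h2⟩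
  have k1 := key (c := t + 0.25 * S.f) (c' := t + 0.5 * S.f) (by linarith) (by linarith)
  have k2 := key (c := t + 0.25 * S.f) (c' := t + 0.75 * S.f) (by linarith) (by linarith)
  have k3 := key (c := t + 0.5 * S.f) (c' := t + 0.75 * S.f) (by linarith) (by linarith)
  have : (ClearAt 𝒱 u.1 α (0.12 * S.f) (t + 0.25 * S.f) ∧
        ClearAt 𝒲 u.2 β (0.12 * S.f) (t + 0.25 * S.f)) ∨
      (ClearAt 𝒱 u.1 α (0.12 * S.f) (t + 0.5 * S.f) ∧
        ClearAt 𝒲 u.2 β (0.12 * S.f) (t + 0.5 * S.f)) ∨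
      (ClearAt 𝒱 u.1 α (0.12 * S.f) (t + 0.75 * S.f) ∧
        ClearAt 𝒲 u.2 β (0.12 * S.f) (t + 0.75 * S.f)) := by tauto
  rcases this with h | h | h
  · exact ⟨_, by linarith, by linarith, h⟩
  · exact ⟨_, by linarith, by linarith, h⟩
  · exact ⟨_, by linarith, by linarith, h⟩

/-- The upper right corner is reached from a point near the diagonal, by segments of length at most
`0.9 f` between resting points near the diagonal. -/
theorem Setting.reach_end (hs : M.Setting P S x y u v κ 𝒱 𝒲) {α β L : ℝ}
    (hL : Diagonal P S u v α β L) (n : ℕ) : ∀ {t : ℝ} {p : ℤ × ℤ} {k : Kind},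
    M.Source S x y u v κ p k → NearDiagonal u α β t S.g p → 0 ≤ t → 0.1 * S.f ≤ L - t →
    L - t ≤ n * (0.25 * S.f) → ClearAt 𝒱 u.1 α (0.12 * S.f) t →
    ClearAt 𝒲 u.2 β (0.12 * S.f) t → Reach x y p v := by
  have h10 := hs.1.scale.ten_le
  have hg := hs.1.scale.g_ge
  have hf := hs.1.scale.f_ge
  have hd := hL.direction
  have hα0 : 0 < α := hd.c_pos.trans_le hd.c_le_α
  have hβ0 : 0 < β := hd.c_pos.trans_le hd.c_le_β
  have hε : S.g / S.f * S.f = S.g := div_mul_cancel₀ _ (by linarith)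
  have hfst := hL.fst
  have hsnd := hL.snd
  induction n with
  | zero =>
    intro t p k _ _ _ h1 h2
    simp only [Nat.cast_zero, zero_mul] at h2
    linarith
  | succ n ih =>
    intro t p k hp hpt ht h1 h2 cV cW
    rcases le_or_gt (L - t) (0.9 * S.f) with h3 | h3
    · refine hs.reach_segment hL hp hs.target hpt ⟨?_, ?_⟩ ht le_rfl h1 h3 cV
        (hs.1.clearAt_end hα0 hd.α_le hfst) cW (hs.2.clearAt_end hβ0 hd.β_le hsnd)
      · rw [abs_le]; constructor <;> linarith
      · rw [abs_le]; constructor <;> linarith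
    obtain ⟨c, c1, c2, dV, dW⟩ := hs.exists_clearAt hα0 hd.α_le hβ0 hd.β_le t
    have i1 := mul_le_mul (show 0.15 * S.f ≤ c by linarith) hd.c_le_α hd.c_pos.le (by linarith)
    have i2 := mul_le_mul (show 0.15 * S.f ≤ L - c by linarith) hd.c_le_α hd.c_pos.le (by linarith)
    have i3 := mul_le_mul (show 0.15 * S.f ≤ c by linarith) hd.c_le_β hd.c_pos.le (by linarith)
    have i4 := mul_le_mul (show 0.15 * S.f ≤ L - c by linarith) hd.c_le_β hd.c_pos.le (by linarith)
    obtain ⟨z, z0, z1, hS, hT⟩ := hs.exists_resting (cx := u.1 + c * α) (cy := u.2 + c * β)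
      (by linarith) (by linarith) (by linarith) (by linarith)
      (fun D hD => by
        rcases dV.cases dV hd.c_le_α (by linarith) (by linarith) (by linarith : S.Δ ≤ S.g)
          hs.1.size hD with h | h | ⟨τ, h, h', -⟩
        · left; linarith
        · right; linarith
        · linarith)
      (fun D hD => by
        rcases dW.cases dW hd.c_le_β (by linarith) (by linarith) (by linarith : S.Δ ≤ S.g)
          hs.2.size hD with h | h | ⟨τ, h, h', -⟩
        · left; linarith
        · right; linarith
        · linarith)
    push_cast at h2
    exact (hs.reach_segment hL hp hT hpt ⟨z0, z1⟩ ht (by linarith) (by linarith) (by linarith)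
      cV dV cW dW).trans (ih hS ⟨z0, z1⟩ (by linarith) (by linarith) (by linarith) dV dW)

/-- If the diagonal has a direction with some margin in the slope condition, the whole rectangle
can be crossed along it. -/
theorem Setting.reach_of_diagonal (hs : M.Setting P S x y u v κ 𝒱 𝒲) {α β L : ℝ}
    (hL : Diagonal P S u v α β L) : Reach x y u v := by
  have h10 := hs.1.scale.ten_le
  have hg := hs.1.scale.g_ge
  have hf := hs.1.scale.f_ge
  have hd := hL.direction
  have hα0 : 0 < α := hd.c_pos.trans_le hd.c_le_α
  have hβ0 : 0 < β := hd.c_pos.trans_le hd.c_le_β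
  have hfst := hL.fst
  have hsnd := hL.snd
  have hlt : (u.1 : ℝ) < v.1 := by exact_mod_cast hs.1.lt
  have hL0 : 0 < L := by
    by_contra! h
    linarith [mul_nonpos_of_nonpos_of_nonneg h hα0.le]
  rcases le_or_gt (0.1 * S.f) L with h | h
  · obtain ⟨n, hn⟩ := exists_nat_ge (L / (0.25 * S.f))
    rw [div_le_iff₀ (by linarith)] at hn
    refine hs.reach_end hL n hs.source ⟨?_, ?_⟩ le_rfl (by linarith) (by linarith)
      (hs.1.clearAt_start hα0 hd.α_le) (hs.2.clearAt_start hβ0 hd.β_le) <;>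
    · rw [abs_le]; constructor <;> linarith
  · -- The rectangle is too small to contain a wall at the required distance from its sides.
    have l1 : L * α ≤ L := mul_le_of_le_one_right hL0.le hd.α_le
    have l2 : L * β ≤ L := mul_le_of_le_one_right hL0.le hd.β_le
    have hε : 0 ≤ S.g / S.f := div_nonneg (by linarith) (by linarith)
    refine hs.reach_along hd hs.source hs.target hL0 le_rfl (by linarith)
      (by rw [mul_zero]; positivity) (by linarith) (by linarith) (by linarith) (by linarith)
      (fun D hD => ?_) (fun D hD => ?_)
    · have d1 := hs.1.left_far D hD
      have d2 := hs.1.right_far D hD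
      have d3 : (D.left : ℝ) < D.right := by exact_mod_cast D.lt
      linarith
    · have d1 := hs.2.left_far D hD
      have d2 := hs.2.right_far D hD
      have d3 : (D.left : ℝ) < D.right := by exact_mod_cast D.lt
      simp only [Prod.fst_swap] at d1 d2
      linarith

/-- If the slope condition holds for the whole rectangle, the upper right corner is reachable from
the lower left one. -/
theorem Setting.reach (hs : M.Setting P S x y u v κ 𝒱 𝒲)
    (hslope : P.σ + 500 * (S.g / S.f) ≤ minslope u v) : Reach x y u v := by
  have h10 := hs.1.scale.ten_le
  have hg := hs.1.scale.g_ge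
  have hf := hs.1.scale.f_ge
  have hε : 0 < S.g / S.f := div_pos (by linarith) (by linarith)
  have hσ0 := hs.1.scale.σ_nonneg
  have hσ1 := hs.1.scale.σ_le
  obtain ⟨A, hA⟩ : ∃ A : ℝ, A = (v.1 : ℝ) - u.1 := ⟨_, rfl⟩
  obtain ⟨B, hB⟩ : ∃ B : ℝ, B = (v.2 : ℝ) - u.2 := ⟨_, rfl⟩
  obtain ⟨c, hc⟩ : ∃ c : ℝ, c = 500 * (S.g / S.f) := ⟨_, rfl⟩
  have hA0 : 0 < A := by
    have : (u.1 : ℝ) < v.1 := by exact_mod_cast hs.1.lt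
    linarith
  have hB0 : 0 < B := by
    have : (u.2 : ℝ) < v.2 := by exact_mod_cast (show u.2 < v.2 from hs.2.lt)
    linarith
  rw [minslope, slope, one_div_div, le_min_iff, ← hA, ← hB, ← hc, le_div_iff₀ hA0,
    le_div_iff₀ hB0] at hslope
  rw [← hc] at hσ1
  have hc0 : 0 < c := by rw [hc]; positivity
  obtain ⟨L, hLe⟩ : ∃ L, L = max A B := ⟨_, rfl⟩
  have hAL : A ≤ L := hLe ▸ le_max_left _ _
  have hBL : B ≤ L := hLe ▸ le_max_right _ _
  have hL0 : 0 < L := hA0.trans_le hAL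
  -- The slope condition leaves a margin relative to the longer side: relative to the other side
  -- it does because `σ` is small.
  have hmargin : c * L ≤ B - P.σ * A ∧ c * L ≤ A - P.σ * B := by
    rcases max_cases A B with ⟨h1, h2⟩ | ⟨h1, h2⟩ <;> rw [hLe, h1] <;> constructor <;>
      nlinarith [mul_nonneg hσ0 hA0.le, mul_nonneg hσ0 hB0.le]
  refine hs.reach_of_diagonal (α := A / L) (β := B / L) (L := L) ⟨⟨hσ0, by linarith, ?_, ?_, ?_, ?_,
    ?_⟩, ?_, ?_⟩
  · rw [← hc]; exact hc0
  · exact (div_le_one hL0).2 hAL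
  · exact (div_le_one hL0).2 hBL
  · rw [← hc, show B / L - P.σ * (A / L) = (B - P.σ * A) / L by ring, le_div_iff₀ hL0]
    exact hmargin.1
  · rw [← hc, show A / L - P.σ * (B / L) = (A - P.σ * B) / L by ring, le_div_iff₀ hL0]
    exact hmargin.2
  · rw [← hA]; field_simp
  · rw [← hB]; field_simp

/-! ### Reachability in the scaled-up structure -/

omit [m.AtLeastTwo] in
/-- In the maximum distance, a trap far from the lower left corner is far from it along one axis. -/
theorem add_le_of_le_dist_lower {t : Trap} {g : ℝ} (hsub : t.toSet ⊆ rectSet κ u v)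
    (h : ∀ p ∈ t.toSet, g ≤ dist (corner u v .lower) p) :
    (u.1 : ℝ) + g ≤ t.a₀ ∨ (u.2 : ℝ) + g ≤ t.a₁ := by
  obtain ⟨b1, -, b3, -⟩ := Trap.bounds hsub
  have h1 := h (t.a₀, t.a₁) ⟨⟨le_rfl, t.le₀⟩, ⟨le_rfl, t.le₁⟩⟩
  rw [Prod.dist_eq, le_max_iff] at h1
  simp only [corner, Real.dist_eq] at h1
  rw [abs_of_nonpos (by linarith), abs_of_nonpos (by linarith)] at h1
  rcases h1 with h1 | h1
  · left; linarith
  · right; linarith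

omit [m.AtLeastTwo] in
theorem add_le_of_le_dist_upper {t : Trap} {g : ℝ} (hsub : t.toSet ⊆ rectSet κ u v)
    (h : ∀ p ∈ t.toSet, g ≤ dist (corner u v .upper) p) :
    t.b₀ + g ≤ v.1 ∨ t.b₁ + g ≤ v.2 := by
  obtain ⟨-, b2, -, b4⟩ := Trap.bounds hsub
  have h1 := h (t.b₀, t.b₁) ⟨⟨t.le₀, le_rfl⟩, ⟨t.le₁, le_rfl⟩⟩
  rw [Prod.dist_eq, le_max_iff] at h1
  simp only [corner, Real.dist_eq] at h1
  rw [abs_of_nonneg (by linarith), abs_of_nonneg (by linarith)] at h1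
  rcases h1 with h1 | h1
  · left; linarith
  · right; linarith

/-- A rectangle that is a hop of the scaled-up structure has all properties used to find a path. -/
theorem Setting.of_hopRect {ord : Axis → Seq m → Listing} (hC : M.Conditions P)
    (hC' : M.swap.Conditions P) (hR : M.Reachability P.σ) (hS : Scale P S) (hx : IsWalk x)
    (hy : IsWalk y) (hu0 : 0 ≤ u.1) (hu1 : 0 ≤ u.2) (hl0 : u.1 < v.1) (hl1 : u.2 < v.2)
    (h : (M.scaleUp S ord).HopRect x y u v κ) :
    M.Setting P S x y u v κ (M.domWalls S x u.1 v.1) (M.swap.domWalls S y u.2 v.2) := by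
  obtain ⟨⟨tl, xl, yl⟩, ⟨tu, xu, yu⟩, hT, hX, hY⟩ := h
  replace tl := tl hl0 hl1
  replace tu := tu hl0 hl1
  replace xl := xl hl0 fun _ => hu0
  replace yl := yl hl1 fun _ => hu1
  replace xu := xu hl0 (by simp)
  replace yu := yu hl1 (by simp)
  have hI : M.HopInterval S (ord .X x) x u.1 v.1 := ⟨hu0, xl.2, xu.2, hX⟩
  have hI' : M.swap.HopInterval S (ord .Y y) y u.2 v.2 := ⟨hu1, yl.2, yu.2, hY⟩
  have hcl : M.CornerClean x y u v .lower κ := ⟨fun _ _ => tl.1, fun _ _ => xl.1, fun _ _ => yl.1⟩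
  have hcu : M.CornerClean x y u v .upper κ := ⟨fun _ _ => tu.1, fun _ _ => xu.1, fun _ _ => yu.1⟩
  have hfl := fun t ht hsub => add_le_of_le_dist_lower hsub (tl.2 t ht hsub)
  have hfu := fun t ht hsub => add_le_of_le_dist_upper hsub (tu.2 t ht hsub)
  refine ⟨HalfSetting.of_hop hC hC' hR hS hx hy hI hI' hl0
    (fun t ht => hT t (Or.inr (Or.inl ht))) (fun t ht => hT t (Or.inl ht)) hfl hfu hcl hcu, ?_⟩
  have hCs : M.swap.swap.Conditions P := by rwa [swap_swap]
  have hIs : M.swap.swap.HopInterval S (ord .X x) x u.swap.2 v.swap.2 := by rwa [swap_swap]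
  have key := HalfSetting.of_hop (u := u.swap) (v := v.swap) (κ := κ.swap) hC' hCs hR.swap hS hy hx
    hI' hIs hl1
    (fun t ht hsub => hT t.swap (Or.inr (Or.inr ht)) (Trap.subset_swap.1 hsub))
    (fun t ht hsub => hT t.swap (Or.inl ht.of_swap) (Trap.subset_swap.1 hsub))
    (fun t ht hsub => (hfl t.swap ht (Trap.subset_swap.1 hsub)).symm)
    (fun t ht hsub => (hfu t.swap ht (Trap.subset_swap.1 hsub)).symm) hcl.swap hcu.swap
  rwa [swap_swap] at key

theorem reachability_scaleUp {ord : Axis → Seq m → Listing} (hC : M.Conditions P)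
    (hC' : M.swap.Conditions P) (hR : M.Reachability P.σ) (hS : Scale P S) :
    (M.scaleUp S ord).Reachability (P.σ + 500 * (S.g / S.f)) := by
  have h10 := hS.ten_le
  have hg := hS.g_ge
  have hf := hS.f_ge
  have hε : 0 ≤ S.g / S.f := div_nonneg (by linarith) (by linarith)
  refine ⟨by linarith [hS.σ_nonneg], by linarith [hS.σ_le], ?_⟩
  intro x y hx hy u v hu0 hu1 hl0 hl1 κ hslope hhop
  exact (Setting.of_hopRect hC hC' hR hS hx hy hu0 hu1 hl0 hl1 hhop).reach hslope

end MazeData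

/-! ### The parameters of the hierarchy for large `R₀` -/

namespace Exponents

open Filter

variable (e : Exponents) {R₀ : ℝ} (k : ℕ)

theorem le_R (h : 0 ≤ R₀) : R₀ ≤ e.R R₀ k :=
  le_mul_of_one_le_right h (one_le_pow₀ e.one_lt_τ.le)

theorem T_pos (R₀ : ℝ) : 0 < e.T R₀ k := Real.rpow_pos_of_pos (zero_lt_one.trans one_lt_lam) _

theorem T_succ (R₀ : ℝ) : e.T R₀ (k + 1) = e.T R₀ k ^ e.τ := by
  rw [T, T, ← Real.rpow_mul (zero_lt_one.trans one_lt_lam).le, R, R, pow_succ, mul_assoc]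

/-- All powers of the numbers `T_k` are large, uniformly in `k`, if `R₀` is large. -/
theorem eventually_le_T_rpow {c : ℝ} (hc : 0 < c) (K : ℝ) :
    ∀ᶠ R₀ in atTop, ∀ k, K ≤ e.T R₀ k ^ c := by
  have h1 : Tendsto (fun R₀ : ℝ => (lam ^ R₀) ^ c) atTop atTop := by
    refine (tendsto_rpow_atTop hc).comp (?_ : Tendsto (fun R₀ : ℝ => lam ^ R₀) atTop atTop)
    simp only [Real.rpow_def_of_pos (zero_lt_one.trans one_lt_lam)]
    exact Real.tendsto_exp_atTop.comp (tendsto_id.const_mul_atTop (Real.log_pos one_lt_lam))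
  filter_upwards [h1.eventually_ge_atTop K, eventually_ge_atTop 0] with R₀ h2 h3 k
  refine h2.trans (Real.rpow_le_rpow (Real.rpow_pos_of_pos (zero_lt_one.trans one_lt_lam) _).le ?_
    hc.le)
  exact Real.rpow_le_rpow_of_exponent_le one_lt_lam.le (e.le_R k h3)

/-- The slope bounds form a series dominated by a geometric one. -/
theorem σ_add_le {R₀ : ℝ} (h : ∀ k, 2 ≤ e.T R₀ k ^ ((e.φ - e.γ) * (e.τ - 1)))
    (h' : ∀ k, 10000 * e.g R₀ k ≤ e.f R₀ k) {k : ℕ} (hk : 1 ≤ k) :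
    e.σ R₀ k + 1000 * (e.g R₀ k / e.f R₀ k) ≤ 1 / 10 := by
  have hf : ∀ k, 0 < e.f R₀ k := fun k => Real.rpow_pos_of_pos (e.T_pos k R₀) _
  have hε : ∀ k, e.g R₀ k / e.f R₀ k = e.T R₀ k ^ (-(e.φ - e.γ)) := fun k => by
    rw [g, f, ← Real.rpow_sub (e.T_pos k R₀), neg_sub]
  induction k, hk using Nat.le_induction with
  | base =>
    have h1 : e.g R₀ 1 / e.f R₀ 1 ≤ 1 / 10000 := by
      rw [div_le_iff₀ (hf 1)]; linarith [h' 1]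
    simp only [σ, Finset.Ico_self, Finset.sum_empty]
    linarith
  | succ k hk ih =>
    have hε2 : e.g R₀ (k + 1) / e.f R₀ (k + 1) ≤ e.g R₀ k / e.f R₀ k / 2 := by
      rw [hε, hε, T_succ, ← Real.rpow_mul (e.T_pos k R₀).le,
        show e.τ * -(e.φ - e.γ) = -(e.φ - e.γ) - (e.φ - e.γ) * (e.τ - 1) by ring,
        Real.rpow_sub (e.T_pos k R₀)]
      exact div_le_div_of_nonneg_left (Real.rpow_pos_of_pos (e.T_pos k R₀) _).le two_pos (h k)
    have hσ : e.σ R₀ (k + 1) = e.σ R₀ k + 500 * (e.g R₀ k / e.f R₀ k) := by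
      rw [σ, Finset.sum_Ico_succ_top hk, σ, mul_div_assoc]
    linarith

theorem eventually_scale : ∀ᶠ R₀ in atTop, ∀ k, 1 ≤ k → ∀ q c₁ c₂ c₃ : ℝ,
    Scale (e.params R₀ k q c₁ c₂ c₃) (e.scaleParams R₀ k) := by
  have hφ : 0 < e.φ := e.δ_pos.trans (e.δ_lt_γ.trans e.γ_lt_φ)
  filter_upwards [e.eventually_le_T_rpow e.δ_pos 10,
    e.eventually_le_T_rpow (sub_pos.2 e.δ_lt_γ) 1000,
    e.eventually_le_T_rpow (sub_pos.2 e.γ_lt_φ) 10000,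
    e.eventually_le_T_rpow (mul_pos (sub_pos.2 e.γ_lt_φ) (sub_pos.2 e.one_lt_τ)) 2,
    eventually_ge_atTop 0, eventually_ge_atTop e.φ⁻¹] with R₀ h1 h2 h3 h4 h5 h6 k hk q c₁ c₂ c₃
  have hT := fun k => e.T_pos k R₀
  have hg : ∀ k, 10000 * e.g R₀ k ≤ e.f R₀ k := fun k => by
    have := h3 k
    rw [Real.rpow_sub (hT k), le_div_iff₀ (Real.rpow_pos_of_pos (hT k) _)] at this
    exact this
  have hσ := e.σ_add_le h4 hg hk
  have hT1 : 1 ≤ e.T R₀ k :=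
    Real.one_le_rpow one_lt_lam.le (h5.trans (e.le_R k h5))
  have hε : ∀ k, 0 ≤ e.g R₀ k / e.f R₀ k := fun k =>
    div_nonneg (Real.rpow_nonneg (hT k).le _) (Real.rpow_nonneg (hT k).le _)
  have hR : R₀ ≤ e.R R₀ k := e.le_R k h5
  refine ⟨rfl, h1 k, ?_, hg k, ?_, ?_, ?_, fun i hi => ?_, ?_⟩
  · have := h2 k
    rw [Real.rpow_sub (hT k), le_div_iff₀ (Real.rpow_pos_of_pos (hT k) _)] at this
    exact this
  · change e.T R₀ k ^ e.δ * e.T R₀ k ^ e.φ ≤ e.T R₀ k ^ e.γ * e.T R₀ k ^ e.γ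
    rw [← Real.rpow_add (hT k), ← Real.rpow_add (hT k)]
    exact Real.rpow_le_rpow_of_exponent_le hT1 (by linarith [e.γ_ge])
  · change 0 ≤ ∑ i ∈ Finset.Ico 1 k, 500 * e.g R₀ i / e.f R₀ i
    refine Finset.sum_nonneg fun i _ => ?_
    rw [mul_div_assoc]
    linarith [hε i]
  · change e.σ R₀ k + 500 * (e.g R₀ k / e.f R₀ k) ≤ 1 / 10
    linarith [hε k]
  · -- A jump type `i` occurring up to distance `f` has `i ≤ φ R`, and `τ = 2 - φ`.
    change e.R R₀ (k + 1) ≤ 2 * e.R R₀ k - i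
    have hRs : e.R R₀ (k + 1) = e.R R₀ k * (2 - e.φ) := by
      rw [R, R, pow_succ, ← mul_assoc, ← e.τ_eq]
    have hi' : (i : ℝ) ≤ e.R R₀ k * e.φ := by
      by_cases hi1 : i ≤ 1
      · have a1 : (i : ℝ) ≤ 1 := by exact_mod_cast hi1
        have a2 : e.φ⁻¹ * e.φ ≤ e.R R₀ k * e.φ :=
          mul_le_mul_of_nonneg_right (h6.trans hR) hφ.le
        rw [inv_mul_cancel₀ hφ.ne'] at a2
        linarith
      · rw [jump, if_neg hi1] at hi
        have a1 : lam ^ (i : ℝ) ≤ lam ^ (e.R R₀ k * e.φ) := by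
          rw [Real.rpow_natCast, Real.rpow_mul (zero_lt_one.trans one_lt_lam).le]
          exact (Int.le_ceil _).trans hi
        exact (Real.rpow_le_rpow_left_iff one_lt_lam).1 a1
    rw [hRs]; linarith
  · change e.R R₀ (k + 1) ≤ e.τ' * e.R R₀ k
    have hRs : e.R R₀ (k + 1) = e.τ * e.R R₀ k := by rw [R, R, pow_succ]; ring
    rw [hRs]
    exact mul_le_mul_of_nonneg_right e.τ_lt_τ'.le (h5.trans hR)

end Exponents
end Clairvoyant

theorem mainTheorem3 (e : Exponents) (c₁ c₂ c₃ : ℝ) :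
    ∃ R₁ : ℝ, 1 < R₁ ∧ ∀ R₀ : ℝ, R₁ ≤ R₀ → ∀ k : ℕ, 1 ≤ k →
      ∀ (m : ℕ) [m.AtLeastTwo] (q : ℝ) (M : MazeData m),
        M.IsMazery (e.params R₀ k q c₁ c₂ c₃) →
        ∀ ord : Axis → Seq m → Listing,
          (M.scaleUp (e.scaleParams R₀ k) ord).Reachability
            (e.σ R₀ k + 500 * e.g R₀ k / e.f R₀ k) := by
  obtain ⟨R₁, hR₁⟩ := Filter.eventually_atTop.1 e.eventually_scale
  refine ⟨max R₁ 2, lt_max_of_lt_right one_lt_two, fun R₀ hR₀ k hk m _ q M hM ord => ?_⟩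
  rw [mul_div_assoc]
  exact MazeData.reachability_scaleUp hM.conditions hM.conditions_swap hM.reachability
    (hR₁ R₀ ((le_max_left _ _).trans hR₀) k hk q c₁ c₂ c₃)
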